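/- **Theorem (Quantum 2-distance Estimator).** *Setting.* Let $N\ge 2$, let $G$ be an undirected graph on $N$ nodes with all degrees at most $d$ ($d\ge1$), and let $P$ be the lazy symmetric random walk on $G$: $P(i,j)=\frac1{2d}$ if $j\sim i$, $P(j,j)=1-\frac{\deg j}{2d}$, and $0$ otherwise. Let $U=V^\dagger SV$ be the quantum walk of $P$ on $\mathrm{span}\{|i,j\rangle,|i,\flat\rangle\}$, where $S|i,j\rangle=|j,i\rangle$ on edges and $S$ fixes all other basis states, and $V=\sum_i|i\rangle\langle i|\otimes V_i$ with $V_i$ any unitary such that $V_i|\flat\rangle=\sum_j\sqrt{P(j,i)}\,|j\rangle$. One (controlled) use of $U$ is one *quantum-walk (QW) step*; unitaries that do not depend on $G$, and classical control, are free. Put $R_\flat=2\Pi_\flat-1$, $W=R_\flat U$, and $$W_\tau=V_q^\dagger\Big(\sum_{l=0}^{\tau}W^l\otimes|l\rangle\langle l|\Big)V_q,\qquad V_q|0\rangle=\sum_{l\le\tau}\sqrt{q_l}\,|l\rangle,\qquad q_l=\frac{p_l}{\sum_{k\le\tau}p_k},$$ where $p_l$ is the probability that the simple random walk on $\mathbb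 Z$ from $0$ is at distance $l$ from $0$ after $t$ steps. The walk step is controlled on $l$, so $W_\tau$ uses $\tau$ QW steps. Below, $\Pi_\flat$ is also the projector on the states $|j,\flat,0\rangle$. *Subroutines.* - *Amplitude estimation* of $\|\Pi A|i_0\rangle\|$ to error $\epsilon$ with confidence $1-\delta$: run phase estimation (quantum Fourier transform modulo $M=\lceil 12\pi/\epsilon\rceil+1$) of $-R_\psi R_\Pi$ on $\psi=A|i_0\rangle$, with outcome $y\mapsto\sin(\pi y/M)$; do this $\lceil18\ln(1/\delta)\rceil$ times and output an estimate $x$ such that at least $2/3$ of all estimates lie in $[x,x+2\epsilon/3]$ (and $0$ if there is none). - *2-norm estimator* ($s,t,\epsilon,\delta$): amplitude estimation of $\|\Pi_\flat W_\tau|s,\flat,0\rangle\|$ to error $\epsilon/2$ with confidence $1-\delta$, for $\tau=\lceil\sqrt{2t\ln(8\sqrt N/\epsilon)}\,\rceil$. - *Multiplicative 2-norm estimator* ($s,t,\epsilon,\delta$): for $k=1,\dots,T=\lceil\frac12\log_2N\rceil$ let $\alpha$ be the output of the 2-norm estimator with error $\epsilon2^{-k-2}$ and confidence $1-\delta/T$,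 stopping as soon as $\alpha\ge(1+\epsilon)2^{-k}$. Output the last $\alpha$. - *Fixed-point amplitude amplification* $U_L$ of $\Pi$ on $\psi$: $L$ pairs of generalized (phase) reflections around the image of $\Pi$ and around $\psi$, with phases depending only on $L$ and the accuracy $\nu$. *The algorithm*, on input $N$, nodes $u,v$, $t\in\mathbb N$, $\epsilon,\delta>0$, with absolute constants $c_\mu,c_\nu,c_L,c_\tau>0$, $\kappa\in\mathbb N$: 1. Make multiplicative estimates $\alpha_0,\beta_0$ of $\|P^t|u\rangle\|,\|P^t|v\rangle\|$ with error $1/4$, each with confidence $1-\delta/(8N^\kappa)$. 2. Set $\mu=c_\mu\min(1,\epsilon/\max(\alpha_0,\beta_0)^2)$. 3. Make new multiplicative estimates $\alpha,\beta$ with error $\mu$, each with confidence $1-\delta/(8N^\kappa)$. 4. Set $\nu=c_\nu\mu^2$, $\lambda=\max(\min(\alpha,\beta),N^{-1/2})$, $L=\lceil c_L\lambda^{-1}\ln(2/\nu)\rceil$, $\tau=\lceil\sqrt{2t\ln(c_\tau/(\lambda\nu))}\,\rceil$. 5. Let $|\psi\rangle=U_{\mathrm{SWAP}}|0\rangle(U_LW_\tau|u,\flat,0\rangle)(U_LW_\tau|v,\flat,0\rangle)$,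 where $U_{\mathrm{SWAP}}=(H\otimes I\otimes I)\,cS\,(H\otimes I\otimes I)$ is the SWAP test. 6. Let $\gamma=2\gamma_1$, where $\gamma_1$ is the amplitude estimate of $\|\Pi_1|\psi\rangle\|$, $\Pi_1=|1\rangle\langle1|\otimes I\otimes I$, to error $\nu$ with confidence $1-\delta/2$. 7. Output $a=\alpha^2+\beta^2-2\alpha\beta\sqrt{1-\gamma^2/2}$ (the root being read as $0$ if $\gamma^2>2$). *Claim.* There are a choice of the absolute constants and of the amplification phases, and a constant $C>0$, such that for all $N\ge2$, $G$, $d$, choices of the coins $V_i$, nodes $u,v$, $t\in\mathbb N$ and $\epsilon,\delta>0$ the output satisfies, with probability at least $1-\delta$, $$\Big|\,\|P^t|u\rangle-P^t|v\rangle\|^2-a\,\Big|\le\epsilon,$$ and, if $\delta\le1/2$, the expected number of QW steps is at most $$C\,\sqrt t\left(\frac{\overline a}{\epsilon'}+\frac{\overline a^4}{\underline a\,\epsilon'^2}\right)\log\frac{\log N}{\delta}\;\log^{3/2}\frac N{\epsilon'},\qquad \epsilon'=\min(\epsilon,\overline a^2),$$ where $\overline a$ and $\underline a$ are the maximum and the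 minimum of $\|P^t|u\rangle\|$ and $\|P^t|v\rangle\|$. For $\epsilon\le\overline a^2$, $\epsilon'$ is $\epsilon$. -/

import Mathlib

noncomputable section

namespace QuantumWalk

/-! ### The lazy random walk on a graph and the associated quantum walk -/

/-- Transition matrix of the lazy symmetric random walk on a graph with degree bound `d`:
from a node `j` jump to each neighbour with probability `1/(2d)`, and stay put otherwise.
The entry `(i, j)` is the probability of going from `j` to `i`. -/
def lazyWalk {N : ℕ} (G : SimpleGraph (Fin N)) [DecidableRel G.Adj] (d : ℕ) :
    Matrix (Fin N) (Fin N) ℝ :=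
  Matrix.of fun i j =>
    if i = j then 1 - (G.degree j : ℝ) / (2 * d) else if G.Adj j i then 1 / (2 * d) else 0

/-- The distribution `P ^ t |u⟩` of the `t`-step lazy walk started in `u`, as a vector with the
Euclidean norm. -/
def walkDist {N : ℕ} (G : SimpleGraph (Fin N)) [DecidableRel G.Adj] (d t : ℕ) (u : Fin N) :
    EuclideanSpace ℝ (Fin N) :=
  WithLp.toLp 2 ((lazyWalk G d ^ t).mulVec (Pi.single u 1))

/-- Basis states of the coined node space. `(i, some j)` is `|i, j⟩` and `(i, none)` is the
flat state `|i, ♭⟩`. -/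
abbrev WalkReg (N : ℕ) : Type := Fin N × Option (Fin N)

/-- A coin toss for the stochastic matrix `P`: a family of unitaries `V_i` with
`V_i |♭⟩ = ∑ j, √P(j,i) |j⟩`, otherwise arbitrary. -/
def IsCoin {N : ℕ} (P : Matrix (Fin N) (Fin N) ℝ)
    (coin : Fin N → Matrix (Option (Fin N)) (Option (Fin N)) ℂ) : Prop :=
  (∀ i, coin i ∈ Matrix.unitaryGroup (Option (Fin N)) ℂ) ∧
    (∀ i, coin i none none = 0) ∧ ∀ i j, coin i (some j) none = (Real.sqrt (P j i) : ℂ)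

/-- The coin toss operator `V = ∑ i, |i⟩⟨i| ⊗ V_i`. -/
def coinOp {N : ℕ} (coin : Fin N → Matrix (Option (Fin N)) (Option (Fin N)) ℂ) :
    Matrix (WalkReg N) (WalkReg N) ℂ :=
  Matrix.of fun x y => if x.1 = y.1 then coin x.1 x.2 y.2 else 0

/-- Action of the shift on basis states: `(i, j) ↦ (j, i)` along edges, other states fixed. -/
def shiftMap {N : ℕ} (G : SimpleGraph (Fin N)) [DecidableRel G.Adj] : WalkReg N → WalkReg N
  | (i, some j) => if G.Adj i j then (j, some i) else (i, some j)
  | (i, none) => (i, none)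

/-- The shift operator `S`. -/
def shiftOp {N : ℕ} (G : SimpleGraph (Fin N)) [DecidableRel G.Adj] :
    Matrix (WalkReg N) (WalkReg N) ℂ :=
  Matrix.of fun x y => if x = shiftMap G y then 1 else 0

/-- The quantum walk operator `U = V† S V`. -/
def walkOp {N : ℕ} (G : SimpleGraph (Fin N)) [DecidableRel G.Adj]
    (coin : Fin N → Matrix (Option (Fin N)) (Option (Fin N)) ℂ) :
    Matrix (WalkReg N) (WalkReg N) ℂ :=
  (coinOp coin).conjTranspose * shiftOp G * coinOp coin

/-! ### Circuits with quantum walk steps, and adaptive programs -/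

/-- Quantum circuits on registers with basis `ι`, built from fixed gates and quantum walk steps.
The circuit does not contain the graph; the walk operator is supplied when it is evaluated. -/
inductive Circuit (N : ℕ) : Type → Type 1
  /-- a fixed unitary, free of charge -/
  | gate {ι : Type} [Fintype ι] [DecidableEq ι] (g : Matrix.unitaryGroup ι ℂ) : Circuit N ι
  /-- one quantum walk step -/
  | walk : Circuit N (WalkReg N)
  /-- first `c₁`, then `c₂` -/
  | seq {ι : Type} [Fintype ι] (c₁ c₂ : Circuit N ι) : Circuit N ι
  /-- apply `c` to the first register if the second register satisfies `p` -/
  | ctrl {ι κ : Type} [DecidableEq ι] [DecidableEq κ] (p : κ → Prop) [DecidablePred p]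
      (c : Circuit N ι) : Circuit N (ι × κ)
  /-- rename basis states -/
  | relabel {ι κ : Type} (e : ι ≃ κ) (c : Circuit N ι) : Circuit N κ

namespace Circuit

variable {N : ℕ}

/-- The operator implemented by a circuit when the walk operator is `U`. -/
def eval (U : Matrix (WalkReg N) (WalkReg N) ℂ) : {ι : Type} → Circuit N ι → Matrix ι ι ℂ
  | _, gate g => g.1
  | _, walk => U
  | _, seq c₁ c₂ => eval U c₂ * eval U c₁
  | _, ctrl p c => Matrix.blockDiagonal fun b => if p b then eval U c else 1
  | _, relabel e c => Matrix.reindex e e (eval U c)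

/-- Number of quantum walk steps of a circuit. -/
def steps : {ι : Type} → Circuit N ι → ℕ
  | _, gate _ => 0
  | _, walk => 1
  | _, seq c₁ c₂ => steps c₁ + steps c₂
  | _, ctrl _ c => steps c
  | _, relabel _ c => steps c

/-- The inverse circuit. The walk operator `U = V† S V` is its own inverse. -/
def inv : {ι : Type} → Circuit N ι → Circuit N ι
  | _, gate g => gate g⁻¹
  | _, walk => walk
  | _, seq c₁ c₂ => seq (inv c₂) (inv c₁)
  | _, ctrl p c => ctrl p (inv c)
  | _, relabel e c => relabel e (inv c)

/-- Apply a circuit to the first of two registers. -/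
def left {ι κ : Type} [DecidableEq ι] [DecidableEq κ] (c : Circuit N ι) : Circuit N (ι × κ) :=
  ctrl (fun _ => True) c

/-- Apply a circuit to the second of two registers. -/
def right {ι κ : Type} [DecidableEq ι] [DecidableEq κ] (c : Circuit N κ) : Circuit N (ι × κ) :=
  relabel (Equiv.prodComm κ ι) (left c)

/-- Start with `c`, then apply `f 0`, `f 1`, …, `f (n - 1)`. -/
def iter {ι : Type} [Fintype ι] (c : Circuit N ι) (f : ℕ → Circuit N ι) : ℕ → Circuit N ι
  | 0 => c
  | n + 1 => seq (iter c f n) (f n)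

end Circuit

/-- Programs: classical control together with runs of quantum circuits. A run prepares a basis
state, applies a circuit, measures all registers in the computational basis, and continues
depending on the outcome. -/
inductive Program (N : ℕ) (α : Type) : Type 1
  | ret (x : α) : Program N α
  | run {ι : Type} [Fintype ι] [DecidableEq ι] (c : Circuit N ι) (start : ι)
      (k : ι → Program N α) : Program N α

namespace Program

variable {N : ℕ}

open Classical in
/-- Probability that the output of the program satisfies `E`, when the walk operator is `U`. -/
def prob {α : Type} (U : Matrix (WalkReg N) (WalkReg N) ℂ) (E : α → Prop) : Program N α → ℝ
  | ret x => if E x then 1 else 0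
  | run c start k => ∑ j, ‖c.eval U j start‖ ^ 2 * prob U E (k j)

/-- Expected number of quantum walk steps of the program, when the walk operator is `U`. -/
def expectedSteps {α : Type} (U : Matrix (WalkReg N) (WalkReg N) ℂ) : Program N α → ℝ
  | ret _ => 0
  | run c start k => (c.steps : ℝ) + ∑ j, ‖c.eval U j start‖ ^ 2 * expectedSteps U (k j)

/-- Sequential composition of programs. -/
def bind {α β : Type} : Program N α → (α → Program N β) → Program N β
  | ret x, f => f x
  | run c start k, f => run c start fun j => bind (k j) f

instance : Monad (Program N) where
  pure := ret
  bind := bind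

/-- Run a program `n` times independently and collect the outputs. -/
def times {α : Type} (p : Program N α) : ℕ → Program N (List α)
  | 0 => ret []
  | n + 1 => do
      let x ← p
      let xs ← times p n
      return x :: xs

end Program

/-! ### Gates -/

/-- Multiply the basis states satisfying `p` by the phase `exp (i φ)`. -/
def phaseOn {ι : Type} [Fintype ι] [DecidableEq ι] (p : ι → Prop) [DecidablePred p] (φ : ℝ) :
    Matrix.unitaryGroup ι ℂ :=
  ⟨Matrix.diagonal fun x => if p x then Complex.exp (φ * Complex.I) else 1, by
    rw [Matrix.mem_unitaryGroup_iff, Matrix.star_eq_conjTranspose,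
      Matrix.diagonal_conjTranspose, Matrix.diagonal_mul_diagonal, ← Matrix.diagonal_one]
    congr 1
    funext x
    by_cases h : p x
    · simp [h, ← Complex.exp_conj, ← Complex.exp_add]
    · simp [h]⟩

/-- The permutation gate `|x⟩ ↦ |σ x⟩`. -/
def permGate {ι : Type} [Fintype ι] [DecidableEq ι] (σ : Equiv.Perm ι) :
    Matrix.unitaryGroup ι ℂ :=
  ⟨Matrix.of fun x y => if x = σ y then 1 else 0, by
    rw [Matrix.mem_unitaryGroup_iff]
    ext x y
    have h : ∀ z j, (z = σ j) ↔ (σ.symm z = j) := fun z j => by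
      rw [Equiv.symm_apply_eq]
    simp [Matrix.mul_apply, Matrix.star_apply, h, Matrix.one_apply, eq_comm]⟩

/-- The Hadamard gate. -/
def hadamard : Matrix.unitaryGroup Bool ℂ :=
  ⟨Matrix.of fun x y => ((if x && y then -1 else 1 : ℂ)) / (Real.sqrt 2 : ℂ), by
    have h2 : (Real.sqrt 2 : ℂ) * (Real.sqrt 2 : ℂ) = 2 := by
      rw [← Complex.ofReal_mul, Real.mul_self_sqrt (by norm_num)]; norm_num
    have h0 : (Real.sqrt 2 : ℂ) ≠ 0 := by
      intro h; rw [h] at h2; norm_num at h2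
    rw [Matrix.mem_unitaryGroup_iff]
    ext x y
    cases x <;> cases y <;>
      simp [Matrix.mul_apply, Matrix.star_apply] <;> field_simp <;>
      simp only [pow_two, h2] <;> norm_num⟩

/-- The quantum Fourier transform `|x⟩ ↦ M^(-1/2) ∑ y, exp (2πi x y / M) |y⟩`. -/
def fourier (M : ℕ) [NeZero M] : Matrix.unitaryGroup (ZMod M) ℂ :=
  ⟨Matrix.of fun x y => ZMod.stdAddChar (x * y) / (Real.sqrt M : ℂ), by
    have hM : (Real.sqrt M : ℂ) * (Real.sqrt M : ℂ) = M := by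
      rw [← Complex.ofReal_mul, Real.mul_self_sqrt (Nat.cast_nonneg M)]; simp
    have hM0 : (M : ℂ) ≠ 0 := Nat.cast_ne_zero.2 (NeZero.ne M)
    rw [Matrix.mem_unitaryGroup_iff]
    ext x y
    have hs : ∀ j : ZMod M, (starRingEnd ℂ) (ZMod.stdAddChar (y * j))
        = ZMod.stdAddChar (-(y * j)) := fun j => by
      rw [AddChar.map_neg_eq_conj]
    have key : ∀ j : ZMod M, (ZMod.stdAddChar (x * j) / (Real.sqrt M : ℂ)) *
        (star (ZMod.stdAddChar (y * j) / (Real.sqrt M : ℂ)))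
        = ZMod.stdAddChar (j * (x - y)) / (M : ℂ) := fun j => by
      rw [← starRingEnd_apply, map_div₀, hs, Complex.conj_ofReal, div_mul_div_comm, hM, ← AddChar.map_add_eq_mul]
      congr 2; ring
    rw [Matrix.mul_apply]
    simp only [Matrix.star_apply, Matrix.of_apply]
    rw [Finset.sum_congr rfl fun j _ => key j, ← Finset.sum_div,
      AddChar.sum_mulShift (x - y) (ZMod.isPrimitive_stdAddChar M)]
    by_cases h : x = y
    · subst h; simp [hM0]
    · simp [sub_eq_zero, h]⟩

/-- A unitary taking the basis state `|i₀⟩` to the state with real amplitudes `s`, whenever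
`∑ i, s i ^ 2 = 1`: the reflection that exchanges the two. -/
def prepare {ι : Type} [Fintype ι] [DecidableEq ι] (i₀ : ι) (s : ι → ℝ) :
    Matrix.unitaryGroup ι ℂ :=
  let w : ι → ℝ := Pi.single i₀ 1 - s
  ⟨(1 - (2 / (w ⬝ᵥ w)) • Matrix.vecMulVec w w).map Complex.ofReal, by
    rw [Matrix.mem_unitaryGroup_iff]
    set A : Matrix ι ι ℝ := 1 - (2 / (w ⬝ᵥ w)) • Matrix.vecMulVec w w with hA
    have hsymm : A.transpose = A := by
      ext i j
      simp [hA, Matrix.vecMulVec_apply, Matrix.one_apply, mul_comm, eq_comm]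
    have hstar : star (A.map Complex.ofReal) = A.map Complex.ofReal := by
      ext i j
      have := congrFun (congrFun hsymm i) j
      simpa [Matrix.star_apply] using this
    have hsq : Matrix.vecMulVec w w * Matrix.vecMulVec w w
        = (w ⬝ᵥ w) • Matrix.vecMulVec w w := by
      ext i j
      simp only [Matrix.mul_apply, Matrix.vecMulVec_apply, Matrix.smul_apply, dotProduct,
        smul_eq_mul, Finset.sum_mul]
      exact Finset.sum_congr rfl fun k _ => by ring
    have hAA : A * A = 1 := by
      rw [hA, sub_mul, mul_sub, mul_sub, one_mul, mul_one, one_mul, smul_mul_assoc,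
        mul_smul_comm, hsq, smul_smul, smul_smul]
      by_cases h : w ⬝ᵥ w = 0
      · simp [h]
      · have h2 : 2 / (w ⬝ᵥ w) * (2 / (w ⬝ᵥ w)) * (w ⬝ᵥ w) = 2 / (w ⬝ᵥ w) + 2 / (w ⬝ᵥ w) := by
          field_simp; norm_num
        rw [h2, add_smul]
        abel
    rw [hstar]
    ext i j
    have h3 := congrArg Complex.ofReal (congrFun (congrFun hAA i) j)
    simpa [Matrix.mul_apply, Matrix.one_apply, apply_ite Complex.ofReal] using h3⟩

/-! ### Quantum fast-forwarding: the operator `W_τ` -/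

/-- Chebyshev coefficients of `x ^ t`: the probability that `|X_t| = l` for the simple random
walk `X` on the integers started in the origin. -/
def chebCoeff (t l : ℕ) : ℝ :=
  if l = 0 then (if t % 2 = 0 then (t.choose (t / 2) : ℝ) / 2 ^ t else 0)
  else if l ≤ t ∧ l % 2 = t % 2 then (t.choose ((t - l) / 2) : ℝ) / 2 ^ (t - 1) else 0

/-- Registers of `W_τ`: the walk registers and a counter in `{0, …, τ}`. -/
abbrev FFReg (N τ : ℕ) : Type := WalkReg N × Fin (τ + 1)

/-- The flat subspace, spanned by the states `|j, ♭, 0⟩`. -/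
def IsFlat {N τ : ℕ} (x : FFReg N τ) : Prop := x.1.2 = none ∧ x.2 = 0

instance {N τ : ℕ} : DecidablePred (IsFlat (N := N) (τ := τ)) :=
  fun _ => inferInstanceAs (Decidable (_ ∧ _))

/-- The walk with reflection around the flat subspace, `W = (2 Π_♭ - 1) U`. -/
def reflectedWalk (N : ℕ) : Circuit N (WalkReg N) :=
  .seq .walk (.gate (phaseOn (fun x => x.2 ≠ none) Real.pi))

/-- The state `∑ l, √q_l |l⟩` with `q_l = p_l / ∑_{k ≤ τ} p_k`. -/
def lcuAmplitude (t τ : ℕ) (l : Fin (τ + 1)) : ℝ :=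
  Real.sqrt (chebCoeff t l / ∑ k : Fin (τ + 1), chebCoeff t k)

/-- The operator `W_τ = V_q† (∑ l, W ^ l ⊗ |l⟩⟨l|) V_q`. The controlled power is carried out by
applying `W`, for each `k < τ`, under the control `k < l`. -/
def fastForward (N t τ : ℕ) : Circuit N (FFReg N τ) :=
  .seq
    (.iter (.right (.gate (prepare 0 (lcuAmplitude t τ))))
      (fun k => .ctrl (fun l : Fin (τ + 1) => k < (l : ℕ)) (reflectedWalk N)) τ)
    (.right (.gate (prepare 0 (lcuAmplitude t τ))⁻¹))

/-! ### Amplitude estimation and fixed-point amplitude amplification -/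

/-- The operator `-R_ψ R_Π` for `ψ = A |i₀⟩` and `Π` the projector on the basis states in
`good`. -/
def groverOp {N : ℕ} {ι : Type} [Fintype ι] [DecidableEq ι] (A : Circuit N ι) (i₀ : ι)
    (good : ι → Prop) [DecidablePred good] : Circuit N ι :=
  .seq (.gate (phaseOn good Real.pi))
    (.seq A.inv (.seq (.gate (phaseOn (fun x => x ≠ i₀) Real.pi)) A))

/-- Phase estimation circuit for `-R_ψ R_Π` on the state `ψ = A |i₀⟩`, with `m + 1` phases. -/
def phaseEstimation {N : ℕ} {ι : Type} [Fintype ι] [DecidableEq ι] (A : Circuit N ι) (i₀ : ι)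
    (good : ι → Prop) [DecidablePred good] (m : ℕ) : Circuit N (ι × ZMod (m + 1)) :=
  .seq
    (.iter (.seq (.right (.gate (fourier (m + 1)))) (.left A))
      (fun k => .ctrl (fun y : ZMod (m + 1) => k < y.val) (groverOp A i₀ good)) m)
    (.right (.gate (fourier (m + 1))⁻¹))

/-- One run of amplitude estimation: output `sin (π y / (m + 1))` for the measured phase `y`. -/
def amplitudeEstimationOnce {N : ℕ} {ι : Type} [Fintype ι] [DecidableEq ι] (A : Circuit N ι)
    (i₀ : ι) (good : ι → Prop) [DecidablePred good] (m : ℕ) : Program N ℝ :=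
  .run (phaseEstimation A i₀ good m) (i₀, 0)
    fun x => .ret (Real.sin (Real.pi * (x.2.val : ℝ) / ((m : ℝ) + 1)))

/-- An element `x` of the list such that at least two thirds of the list lie in `[x, x + w]`. -/
def clusterPoint (l : List ℝ) (w : ℝ) : ℝ :=
  (l.find? fun x =>
    decide (2 * l.length ≤ 3 * l.countP fun y => decide (x ≤ y ∧ y ≤ x + w))).getD 0

/-- Amplitude estimation of the norm `‖Π A |i₀⟩‖` with additive error `ε` and failure
probability `δ`. -/
def amplitudeEstimation {N : ℕ} {ι : Type} [Fintype ι] [DecidableEq ι] (A : Circuit N ι) (i₀ : ι)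
    (good : ι → Prop) [DecidablePred good] (ε δ : ℝ) : Program N ℝ := do
  let l ← (amplitudeEstimationOnce A i₀ good ⌈12 * Real.pi / ε⌉₊).times ⌈18 * Real.log (1 / δ)⌉₊
  return clusterPoint l (2 * (ε / 3))

/-- The state `U_L A |i₀⟩`: fixed-point amplitude amplification of the states in `good`, by `L`
pairs of generalized reflections around `good` and around `A |i₀⟩` with the given phases. -/
def fixedPointAmplify {N : ℕ} {ι : Type} [Fintype ι] [DecidableEq ι] (A : Circuit N ι) (i₀ : ι)
    (good : ι → Prop) [DecidablePred good] (phase : ℕ → ℝ × ℝ) (L : ℕ) : Circuit N ι :=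
  .iter A
    (fun j => .seq (.gate (phaseOn good (phase j).1))
      (.seq A.inv (.seq (.gate (phaseOn (fun x => x = i₀) (phase j).2)) A))) L

/-! ### The SWAP test -/

/-- Swap two registers conditionally on a qubit. -/
def condSwap (ι : Type) : Equiv.Perm ((ι × ι) × Bool) where
  toFun x := if x.2 then ((x.1.2, x.1.1), x.2) else x
  invFun x := if x.2 then ((x.1.2, x.1.1), x.2) else x
  left_inv := by rintro ⟨⟨a, b⟩, c⟩; cases c <;> rfl
  right_inv := by rintro ⟨⟨a, b⟩, c⟩; cases c <;> rfl

/-- Prepare two states and apply `U_SWAP = (H ⊗ 1 ⊗ 1) cS (H ⊗ 1 ⊗ 1)`. The ancilla qubit is the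
last register. -/
def swapTest {N : ℕ} {ι : Type} [Fintype ι] [DecidableEq ι] (A B : Circuit N ι) :
    Circuit N ((ι × ι) × Bool) :=
  .seq (.left (.seq (.left A) (.right B)))
    (.seq (.right (.gate hadamard))
      (.seq (.gate (permGate (condSwap ι))) (.right (.gate hadamard))))

/-! ### The estimators -/

/-- Quantum 2-norm estimator: estimate `‖P ^ t |s⟩‖` with additive error `ε` and failure
probability `δ`. -/
def normEstimator (N : ℕ) (s : Fin N) (t : ℕ) (ε δ : ℝ) : Program N ℝ :=
  let τ := ⌈Real.sqrt (2 * t * Real.log (8 * Real.sqrt N / ε))⌉₊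
  amplitudeEstimation (fastForward N t τ) ((s, none), 0) IsFlat (ε / 2) δ

/-- Loop of the multiplicative estimator, starting in round `k` with at most `n` more rounds
after it. -/
def multNormLoop (N : ℕ) (s : Fin N) (t : ℕ) (ε δ : ℝ) : ℕ → ℕ → Program N ℝ
  | 0, k => normEstimator N s t (ε / 2 ^ (k + 2)) δ
  | n + 1, k => do
      let α ← normEstimator N s t (ε / 2 ^ (k + 2)) δ
      if (1 + ε) / 2 ^ k ≤ α then return α else multNormLoop N s t ε δ n (k + 1)

/-- Quantum multiplicative 2-norm estimator: estimate `‖P ^ t |s⟩‖` with multiplicative error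
`ε` and failure probability `δ`, in at most `T = ⌈(log₂ N) / 2⌉` rounds. -/
def multNormEstimator (N : ℕ) (s : Fin N) (t : ℕ) (ε δ : ℝ) : Program N ℝ :=
  let T := ⌈Real.logb 2 N / 2⌉₊
  multNormLoop N s t ε (δ / T) (T - 1) 1

/-- The absolute constants hidden in the parameter settings of the 2-distance estimator, and the
phases of fixed-point amplitude amplification (as a function of the number of pairs of
reflections, of the accuracy, and of the position in the sequence). -/
structure EstimatorConstants where
  cμ : ℝ
  cν : ℝ
  cL : ℝ
  cτ : ℝ
  cμ_pos : 0 < cμ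
  cν_pos : 0 < cν
  cL_pos : 0 < cL
  cτ_pos : 0 < cτ
  /-- the norm estimates are made with failure probability `δ / (8 N ^ k)` -/
  k : ℕ
  phase : ℕ → ℝ → ℕ → ℝ × ℝ

/-- Quantum 2-distance estimator: estimate `‖P ^ t |u⟩ - P ^ t |v⟩‖ ^ 2` with additive error `ε`
and failure probability `δ`. -/
def distanceEstimator (c : EstimatorConstants) (N : ℕ) (u v : Fin N) (t : ℕ) (ε δ : ℝ) :
    Program N ℝ := do
  let α₀ ← multNormEstimator N u t (1 / 4) (δ / (8 * N ^ c.k))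
  let β₀ ← multNormEstimator N v t (1 / 4) (δ / (8 * N ^ c.k))
  let μ : ℝ := c.cμ * min 1 (ε / max α₀ β₀ ^ 2)
  let α ← multNormEstimator N u t μ (δ / (8 * N ^ c.k))
  let β ← multNormEstimator N v t μ (δ / (8 * N ^ c.k))
  let ν : ℝ := c.cν * μ ^ 2
  let lam : ℝ := max (min α β) (1 / Real.sqrt N)
  let L : ℕ := ⌈c.cL / lam * Real.log (2 / ν)⌉₊
  let τ : ℕ := ⌈Real.sqrt (2 * t * Real.log (c.cτ / (lam * ν)))⌉₊
  let W := fastForward N t τ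
  let ψu := fixedPointAmplify W ((u, none), 0) IsFlat (c.phase L ν) L
  let ψv := fixedPointAmplify W ((v, none), 0) IsFlat (c.phase L ν) L
  let γ₁ ← amplitudeEstimation (swapTest ψu ψv) ((((u, none), 0), ((v, none), 0)), false)
    (fun x => x.2 = true) ν (δ / 2)
  let γ : ℝ := 2 * γ₁
  return α ^ 2 + β ^ 2 - 2 * α * β * Real.sqrt (1 - γ ^ 2 / 2)

end QuantumWalk

end

/-! The flat block of the walk unitary `U` is `P` itself (`walkOp_none_none`). Alternating `U` with
the reflection around the flat space reproduces the Chebyshev recursion, so the flat block of `W ^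
l` is `T_l(P)` (`reflectedWalk_pow`). The expansion of `x ^ t` in Chebyshev polynomials has as
coefficients the distribution of the distance of a simple random walk on the integers
(`X_pow_eq_sum_chebCoeff`), and by a Chernoff bound only `l` up to about `√t` matters
(`sum_chebCoeff_tail`). Hence `W_τ` produces a flat part close to `P ^ t |u⟩` with `τ` of order
`√t`, up to logarithms (`fastForward_eval`, `norm_ffDist_sub_le`).

Norms are read off by amplitude estimation. In the plane of the good and the bad part the Grover
operator is a rotation, the phase estimation outcomes follow Fejér kernels around the two
eigenphases (`sum_norm_sq_phaseEstimation`, `sum_fejer_tail_le`), and repetition with a cluster rule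
makes failure exponentially rare (`prob_amplitudeEstimation`). Halving the error from round to round
gives multiplicative accuracy, within `T` rounds because `‖P ^ t |u⟩‖ ≥ N^(-1/2)`.

The distance follows from the law of cosines. The cosine is the inner product of the normalized
distributions; it is nonnegative, so the SWAP test, which only sees its absolute value, loses
nothing. The normalized states come from fixed-point amplification. Its phases are explicit:
three-fold sequences are nested `k` times, and the bad amplitude becomes `|cos (3 ^ k φ)| / cosh (3
^ k η)` (`nested_amplify`). An error `ν` in the SWAP amplitude may cause an error of order `√ν` in
the cosine, whence `ν` of order `μ ^ 2`.

The expected cost is a product of circuit lengths on the event that the estimates are good. On the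
complement `λ` is still at least `N^(-1/2)` and `μ` is either `0`, which costs nothing, or at least
`ε' / 10`; the failure probability `δ / (8 N ^ 3)` of the norm estimates pays for this
(`expectedSteps_refinedEstimate_le`, `expectedSteps_distanceEstimator_le`). -/

namespace QuantumWalk

open Matrix

/-! ### Circuits: inverses, unitarity, action on vectors, step counts -/

namespace Circuit

variable {N : ℕ} {U : Matrix (WalkReg N) (WalkReg N) ℂ}

/-- The formal inverse leaves walk steps unchanged, so it is the adjoint exactly when the walk
operator is Hermitian. -/
theorem eval_inv (hU : Uᴴ = U) {ι : Type} (c : Circuit N ι) :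
    c.inv.eval U = (c.eval U)ᴴ := by
  induction c with
  | gate g => rfl
  | walk => exact hU.symm
  | seq c₁ c₂ h₁ h₂ => simp [inv, eval, h₁, h₂]
  | ctrl p c h =>
    simp only [inv, eval, blockDiagonal_conjTranspose, h]
    congr 1
    funext b
    split_ifs <;> simp
  | relabel e c h => simp [inv, eval, h, conjTranspose_submatrix]

theorem steps_inv {ι : Type} (c : Circuit N ι) : c.inv.steps = c.steps := by
  induction c with
  | gate g => rfl
  | walk => rfl
  | seq c₁ c₂ h₁ h₂ => simp [inv, steps, h₁, h₂, add_comm]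
  | ctrl p c h => simpa [inv, steps] using h
  | relabel e c h => simpa [inv, steps] using h

/-- The finiteness instances are quantified after the circuit because `ctrl` and `relabel` carry
none for their subcircuits; the induction has to supply them. -/
theorem eval_conjTranspose_mul_self (hU : Uᴴ = U) (hU2 : U * U = 1) {ι : Type}
    (c : Circuit N ι) : ∀ [Fintype ι] [DecidableEq ι], (c.eval U)ᴴ * c.eval U = 1 := by
  classical
  induction c with
  | @gate ι i1 i2 g =>
    intro i3 i4
    obtain rfl : i1 = i3 := Subsingleton.elim _ _
    obtain rfl : i2 = i4 := Subsingleton.elim _ _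
    exact mem_unitaryGroup_iff'.1 g.2
  | walk =>
    intro _ _
    simp only [eval, hU]
    convert hU2
  | @seq ι i1 c₁ c₂ h₁ h₂ =>
    intro i2 i3
    obtain rfl : i1 = i2 := Subsingleton.elim _ _
    simp only [eval, conjTranspose_mul]
    rw [Matrix.mul_assoc, ← Matrix.mul_assoc ((eval U c₂)ᴴ), h₂, Matrix.one_mul, h₁]
  | @ctrl ι κ _ _ p _ c h =>
    intro i3 i4
    -- Finiteness of a factor follows from that of the product once the other factor is nonempty; if
    -- either is empty, all matrices on the product agree.
    rcases isEmpty_or_nonempty ι with hι | ⟨⟨i₀⟩⟩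
    · exact Subsingleton.elim _ _
    rcases isEmpty_or_nonempty κ with hκ | ⟨⟨k₀⟩⟩
    · exact Subsingleton.elim _ _
    have : Finite ι := Finite.of_injective (fun i => (i, k₀)) fun a b h => by simpa using h
    have : Finite κ := Finite.of_injective (fun i => (i₀, i)) fun a b h => by simpa using h
    have := Fintype.ofFinite ι
    have := Fintype.ofFinite κ
    obtain rfl : i3 = instFintypeProd ι κ := Subsingleton.elim _ _
    simp only [eval, blockDiagonal_conjTranspose, ← blockDiagonal_mul]
    have h1 : (fun k => (if p k then eval U c else 1)ᴴ * if p k then eval U c else 1) =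
        (1 : κ → Matrix ι ι ℂ) := by
      funext k
      split_ifs
      · exact h
      · simp
    rw [h1, blockDiagonal_one]
    congr
    exact Subsingleton.elim _ _
  | @relabel ι κ e c h =>
    intro _ _
    have := Fintype.ofEquiv _ e.symm
    change ((eval U c).submatrix e.symm e.symm)ᴴ * (eval U c).submatrix e.symm e.symm = 1
    rw [conjTranspose_submatrix, submatrix_mul_equiv, h]
    simp

theorem sum_norm_sq_eval (hU : Uᴴ = U) (hU2 : U * U = 1) {ι : Type}
    [Fintype ι] [DecidableEq ι] (c : Circuit N ι) (i : ι) : ∑ j, ‖c.eval U j i‖ ^ 2 = 1 := by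
  have h := congrFun (congrFun (eval_conjTranspose_mul_self hU hU2 c) i) i
  rw [Matrix.mul_apply, Matrix.one_apply_eq] at h
  have h2 : ((∑ j, ‖c.eval U j i‖ ^ 2 : ℝ) : ℂ) = 1 := by
    rw [← h]
    push_cast
    refine Finset.sum_congr rfl fun j _ => ?_
    rw [Matrix.conjTranspose_apply, Complex.star_def, Complex.conj_mul']
  exact_mod_cast h2

theorem eval_mul_conjTranspose_self (hU : Uᴴ = U) (hU2 : U * U = 1) {ι : Type}
    (c : Circuit N ι) [Fintype ι] [DecidableEq ι] : c.eval U * (c.eval U)ᴴ = 1 :=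
  mul_eq_one_comm.1 (eval_conjTranspose_mul_self hU hU2 c)

theorem eval_seq_mulVec {ι : Type} [Fintype ι] (c₁ c₂ : Circuit N ι) (v : ι → ℂ) :
    (seq c₁ c₂).eval U *ᵥ v = c₂.eval U *ᵥ (c₁.eval U *ᵥ v) := by
  simp [eval]

variable {ι κ : Type} [Fintype ι] [Fintype κ] [DecidableEq ι] [DecidableEq κ]

theorem eval_ctrl_mulVec (p : κ → Prop) [DecidablePred p] (c : Circuit N ι) (v : ι × κ → ℂ)
    (i : ι) (k : κ) : ((ctrl p c).eval U *ᵥ v) (i, k) =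
      if p k then (c.eval U *ᵥ fun i' => v (i', k)) i else v (i, k) := by
  simp only [eval, mulVec, dotProduct, Fintype.sum_prod_type, blockDiagonal_apply, ite_mul,
    zero_mul, Finset.sum_ite_eq, Finset.mem_univ, if_true]
  split_ifs
  · rfl
  · simp [one_apply]

theorem eval_left_mulVec (c : Circuit N ι) (v : ι × κ → ℂ) (i : ι) (k : κ) :
    ((left c).eval U *ᵥ v) (i, k) = (c.eval U *ᵥ fun i' => v (i', k)) i := by
  rw [left, eval_ctrl_mulVec, if_pos trivial]

theorem eval_right_mulVec (c : Circuit N κ) (v : ι × κ → ℂ) (i : ι) (k : κ) :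
    ((right c).eval U *ᵥ v) (i, k) = (c.eval U *ᵥ fun k' => v (i, k')) k := by
  have := eval_left_mulVec (U := U) c (fun x : κ × ι => v (x.2, x.1)) k i
  rw [← this, right, eval, reindex_apply, submatrix_mulVec_equiv]
  rfl

/-- On the branch `y` of the control register the `k`-th gate fires exactly for `k < g y`. This
gives the controlled powers both in `W_τ` and in phase estimation. -/
theorem eval_iter_ctrl_mulVec (c : Circuit N (ι × κ)) (D : Circuit N ι) (g : κ → ℕ) (n : ℕ)
    (v : ι × κ → ℂ) (i : ι) (y : κ) :
    ((iter c (fun k => ctrl (fun y => k < g y) D) n).eval U *ᵥ v) (i, y) =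
      ((D.eval U) ^ (min n (g y)) *ᵥ fun i' => (c.eval U *ᵥ v) (i', y)) i := by
  induction n generalizing i with
  | zero => simp [iter]
  | succ n ih =>
    rw [iter, eval_seq_mulVec, eval_ctrl_mulVec]
    split_ifs with h
    · rw [min_eq_left (by omega : n + 1 ≤ g y), pow_succ', ← mulVec_mulVec]
      congr 2
      funext i'
      rw [ih, min_eq_left h.le]
    · rw [ih, min_eq_right (by omega), min_eq_right (by omega)]

omit [DecidableEq ι] in
theorem steps_iter (c : Circuit N ι) (f : ℕ → Circuit N ι) (s : ℕ) (hf : ∀ k, (f k).steps = s)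
    (n : ℕ) : (iter c f n).steps = c.steps + n * s := by
  induction n with
  | zero => simp [iter]
  | succ n ih => simp [iter, steps, ih, hf]; ring

end Circuit

/-! ### Programs: expectations, union bounds, independent repetition -/

namespace Program

variable {N : ℕ} {U : Matrix (WalkReg N) (WalkReg N) ℂ} {α β : Type}

/-- Expected value of a function of the output of the program, when the walk operator is `U`. -/
noncomputable def expect (U : Matrix (WalkReg N) (WalkReg N) ℂ) (g : α → ℝ) : Program N α → ℝ
  | ret x => g x
  | run c start k => ∑ j, ‖c.eval U j start‖ ^ 2 * expect U g (k j)

/-- Every possible output of the program satisfies `E`. -/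
def Outputs (E : α → Prop) : Program N α → Prop
  | ret x => E x
  | run _ _ k => ∀ j, Outputs E (k j)

open Classical in
theorem prob_eq_expect (E : α → Prop) (p : Program N α) :
    p.prob U E = p.expect U fun x => if E x then 1 else 0 := by
  induction p with
  | ret x => rfl
  | run c s k ih => simp only [prob, expect, ih]

theorem expect_bind (p : Program N α) (f : α → Program N β) (g : β → ℝ) :
    (p >>= f).expect U g = p.expect U fun x => (f x).expect U g := by
  change (bind p f).expect U g = _
  induction p with
  | ret x => rfl
  | run c s k ih => simp only [bind, expect, ih]

theorem expect_pure (x : α) (g : α → ℝ) : (pure x : Program N α).expect U g = g x := rfl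

theorem expectedSteps_bind (p : Program N α) (f : α → Program N β) :
    (p >>= f).expectedSteps U = p.expectedSteps U + p.expect U fun x => (f x).expectedSteps U := by
  change (bind p f).expectedSteps U = _
  induction p with
  | ret x => simp [bind, expectedSteps, expect]
  | run c s k ih => simp only [bind, expectedSteps, expect, ih, mul_add, Finset.sum_add_distrib,
      add_assoc]

theorem expectedSteps_pure (x : α) : (pure x : Program N α).expectedSteps U = 0 := rfl

theorem expect_mono {p : Program N α} {E : α → Prop} (hp : p.Outputs E) {f g : α → ℝ}
    (h : ∀ x, E x → f x ≤ g x) : p.expect U f ≤ p.expect U g := by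
  induction p with
  | ret x => exact h x hp
  | run c s k ih =>
    exact Finset.sum_le_sum fun j _ => mul_le_mul_of_nonneg_left (ih j (hp j)) (sq_nonneg _)

theorem outputs_true (p : Program N α) : p.Outputs fun _ => True := by
  induction p with
  | ret x => trivial
  | run c s k ih => exact ih

theorem expect_le_expect (p : Program N α) {f g : α → ℝ} (h : ∀ x, f x ≤ g x) :
    p.expect U f ≤ p.expect U g :=
  expect_mono p.outputs_true fun x _ => h x

theorem expect_add (p : Program N α) (f g : α → ℝ) :
    p.expect U (fun x => f x + g x) = p.expect U f + p.expect U g := by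
  induction p with
  | ret x => rfl
  | run c s k ih => simp only [expect, ih, mul_add, Finset.sum_add_distrib]

theorem expect_mul (p : Program N α) (a : ℝ) (f : α → ℝ) :
    p.expect U (fun x => a * f x) = a * p.expect U f := by
  induction p with
  | ret x => rfl
  | run c s k ih =>
    simp only [expect, ih, Finset.mul_sum]
    exact Finset.sum_congr rfl fun j _ => by ring

/-- Outcome probabilities sum to one because every circuit is unitary; this is where the two
hypotheses on `U` enter the probability calculus. -/
theorem expect_const (hU : U.conjTranspose = U) (hU2 : U * U = 1) (p : Program N α) (a : ℝ) :
    p.expect U (fun _ => a) = a := by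
  induction p with
  | ret x => rfl
  | run c s k ih => simp only [expect, ih, ← Finset.sum_mul, c.sum_norm_sq_eval hU hU2, one_mul]

theorem prob_nonneg (E : α → Prop) (p : Program N α) : 0 ≤ p.prob U E := by
  induction p with
  | ret x => simp only [prob]; split_ifs <;> norm_num
  | run c s k ih => exact Finset.sum_nonneg fun j _ => mul_nonneg (sq_nonneg _) (ih j)

theorem expectedSteps_nonneg (p : Program N α) : 0 ≤ p.expectedSteps U := by
  induction p with
  | ret x => exact le_rfl
  | run c s k ih =>
    exact add_nonneg (Nat.cast_nonneg _)
      (Finset.sum_nonneg fun j _ => mul_nonneg (sq_nonneg _) (ih j))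

theorem prob_mono {E F : α → Prop} (h : ∀ x, E x → F x) (p : Program N α) :
    p.prob U E ≤ p.prob U F := by
  classical
  rw [prob_eq_expect, prob_eq_expect]
  refine p.expect_le_expect fun x => ?_
  by_cases hE : E x
  · simp [hE, h x hE]
  · simp only [hE, if_false]
    split_ifs <;> norm_num

open Classical in
theorem prob_not (hU : U.conjTranspose = U) (hU2 : U * U = 1) (p : Program N α) (E : α → Prop) :
    (p.expect U fun x => if E x then 0 else 1) = 1 - p.prob U E := by
  rw [eq_sub_iff_add_eq, prob_eq_expect, ← expect_add]
  refine Eq.trans ?_ (expect_const hU hU2 p 1)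
  congr 1
  funext x
  split_ifs
  · simp
  · simp

theorem prob_bind (E : β → Prop) (p : Program N α) (f : α → Program N β) :
    (p >>= f).prob U E = p.expect U fun x => (f x).prob U E := by
  simp only [prob_eq_expect, expect_bind]

/-- Union bound for sequential composition. -/
theorem prob_bind_ge (hU : U.conjTranspose = U) (hU2 : U * U = 1) {E : β → Prop} {F : α → Prop}
    {p : Program N α} {f : α → Program N β} {a b : ℝ} (hb : 0 ≤ b)
    (hp : 1 - a ≤ p.prob U F) (hf : ∀ x, F x → 1 - b ≤ (f x).prob U E) :
    1 - (a + b) ≤ (p >>= f).prob U E := by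
  classical
  rw [prob_bind]
  have h : (p.expect U fun x => (if F x then 1 else 0) + -b) ≤
      p.expect U fun x => (f x).prob U E := by
    refine p.expect_le_expect fun x => ?_
    split_ifs with hx
    · linarith [hf x hx]
    · linarith [prob_nonneg (U := U) E (f x)]
  rw [expect_add, expect_const hU hU2, ← prob_eq_expect] at h
  linarith

/-- An expectation is controlled by a bound on a likely event and a bound in general. -/
theorem expect_le_of_prob (hU : U.conjTranspose = U) (hU2 : U * U = 1) {p : Program N α}
    {E F : α → Prop} (hE : p.Outputs E) {g : α → ℝ} {δ a b : ℝ} (hF : 1 - δ ≤ p.prob U F)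
    (ha : 0 ≤ a) (hb : 0 ≤ b) (hga : ∀ x, E x → F x → g x ≤ a) (hgb : ∀ x, E x → g x ≤ b) :
    p.expect U g ≤ a + δ * b := by
  classical
  have h : p.expect U g ≤ p.expect U fun x => a + b * (if F x then 0 else 1) := by
    refine expect_mono hE fun x hx => ?_
    split_ifs with h
    · simpa using hga x hx h
    · linarith [hgb x hx]
  rw [expect_add, expect_const hU hU2, expect_mul, prob_not hU hU2] at h
  nlinarith

theorem Outputs.bind {p : Program N α} {f : α → Program N β} {E : α → Prop} {F : β → Prop}
    (h : p.Outputs E) (hf : ∀ x, E x → (f x).Outputs F) : (p >>= f).Outputs F := by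
  change (Program.bind p f).Outputs F
  induction p with
  | ret x => exact hf x h
  | run c s k ih => exact fun j => ih j (h j)

theorem Outputs.times {p : Program N α} {E : α → Prop} (h : p.Outputs E) (n : ℕ) :
    (p.times n).Outputs fun l => ∀ x ∈ l, E x := by
  induction n with
  | zero => exact fun x hx => by simp at hx
  | succ n ih =>
    refine h.bind fun x hx => ih.bind fun l hl => ?_
    intro y hy
    rcases List.mem_cons.1 hy with rfl | hy
    · exact hx
    · exact hl y hy

/-- Independence of the runs. With suitable weights `w` this replaces a binomial tail estimate in
the analysis of repeated amplitude estimation. -/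
theorem expect_times_prod (p : Program N α) (w : α → ℝ) (n : ℕ) :
    ((p.times n).expect U fun l => (l.map w).prod) = (p.expect U w) ^ n := by
  induction n with
  | zero => simp [times, expect]
  | succ n ih =>
    have h (x : α) : ((do let xs ← p.times n; return x :: xs : Program N (List α)).expect U
        fun l => (l.map w).prod) = (p.expect U w) ^ n * w x := by
      rw [expect_bind, mul_comm, ← ih, ← expect_mul]
      simp [expect_pure]
    rw [times, expect_bind]
    simp only [h]
    rw [expect_mul, pow_succ]

theorem expectedSteps_times (hU : U.conjTranspose = U) (hU2 : U * U = 1) (p : Program N α)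
    (n : ℕ) : (p.times n).expectedSteps U = n * p.expectedSteps U := by
  induction n with
  | zero => simp [times, expectedSteps]
  | succ n ih =>
    simp only [times, expectedSteps_bind, ih, expectedSteps_pure]
    rw [expect_const hU hU2, expect_const hU hU2]
    push_cast
    ring

theorem times_length (p : Program N α) (n : ℕ) :
    (p.times n).Outputs fun l => l.length = n := by
  induction n with
  | zero => rfl
  | succ n ih =>
    refine p.outputs_true.bind fun x _ => ih.bind fun l hl => ?_
    change (x :: l).length = n + 1
    simp [hl]

end Program

/-! ### The quantum walk is a Hermitian unitary with flat block `P` -/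

section WalkOperator

variable {N : ℕ} (G : SimpleGraph (Fin N)) [DecidableRel G.Adj]

theorem shiftMap_shiftMap (x : WalkReg N) : shiftMap G (shiftMap G x) = x := by
  rcases x with ⟨i, _ | j⟩
  · rfl
  · by_cases h : G.Adj i j
    · simp [shiftMap, h, h.symm]
    · simp [shiftMap, h]

theorem conjTranspose_shiftOp : (shiftOp G)ᴴ = shiftOp G := by
  ext x y
  have : y = shiftMap G x ↔ x = shiftMap G y := by
    constructor <;> rintro rfl <;> rw [shiftMap_shiftMap]
  simp [shiftOp, this, apply_ite]

theorem shiftOp_mul_self : shiftOp G * shiftOp G = 1 := by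
  ext x y
  simp [shiftOp, mul_apply, one_apply, shiftMap_shiftMap]

variable {G} {d : ℕ} {coin : Fin N → Matrix (Option (Fin N)) (Option (Fin N)) ℂ}

theorem coinOp_mul_conjTranspose {P : Matrix (Fin N) (Fin N) ℝ} (h : IsCoin P coin) :
    coinOp coin * (coinOp coin)ᴴ = 1 := by
  ext ⟨i, a⟩ ⟨j, b⟩
  simp only [mul_apply, Fintype.sum_prod_type, coinOp, of_apply, conjTranspose_apply]
  have h1 := congrFun (congrFun (mem_unitaryGroup_iff.1 (h.1 i)) a) b
  rw [star_eq_conjTranspose, mul_apply] at h1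
  by_cases hij : i = j
  · subst hij
    rw [Finset.sum_eq_single i]
    · simpa [one_apply] using h1
    · intro k _ hk
      simp [hk.symm]
    · simp
  · rw [one_apply_ne (by simp [hij])]
    refine Finset.sum_eq_zero fun k _ => Finset.sum_eq_zero fun c _ => ?_
    by_cases hk : i = k
    · subst hk
      simp [Ne.symm hij]
    · simp [hk]

variable (G) in
theorem conjTranspose_walkOp : (walkOp G coin)ᴴ = walkOp G coin := by
  simp [walkOp, conjTranspose_shiftOp, Matrix.mul_assoc]

theorem walkOp_mul_self (h : IsCoin (lazyWalk G d) coin) :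
    walkOp G coin * walkOp G coin = 1 := by
  have h1 := coinOp_mul_conjTranspose h
  calc walkOp G coin * walkOp G coin
      = (coinOp coin)ᴴ * shiftOp G * (coinOp coin * (coinOp coin)ᴴ) * shiftOp G * coinOp coin := by
        simp only [walkOp, Matrix.mul_assoc]
    _ = (coinOp coin)ᴴ * (shiftOp G * shiftOp G) * coinOp coin := by
        rw [h1, Matrix.mul_one]; simp only [Matrix.mul_assoc]
    _ = 1 := by rw [shiftOp_mul_self, Matrix.mul_one, mul_eq_one_comm.1 h1]

theorem lazyWalk_nonneg (hd : 1 ≤ d) (hdeg : ∀ i, G.degree i ≤ d) (i j : Fin N) :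
    0 ≤ lazyWalk G d i j := by
  have hd' : (0 : ℝ) < d := by exact_mod_cast hd
  simp only [lazyWalk, of_apply]
  split_ifs
  · have : (G.degree j : ℝ) ≤ d := by exact_mod_cast hdeg j
    rw [sub_nonneg, div_le_one (by positivity)]
    linarith
  · positivity
  · exact le_rfl

theorem lazyWalk_symm (i j : Fin N) : lazyWalk G d i j = lazyWalk G d j i := by
  simp only [lazyWalk, of_apply, G.adj_comm j i]
  by_cases h : i = j
  · subst h; rfl
  · simp [h, Ne.symm h]

theorem sum_lazyWalk (j : Fin N) : ∑ i, lazyWalk G d i j = 1 := by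
  classical
  have h1 (i : Fin N) : lazyWalk G d i j =
      (if i = j then 1 - (G.degree j : ℝ) / (2 * d) else 0) +
        if G.Adj j i then 1 / (2 * d : ℝ) else 0 := by
    simp only [lazyWalk, of_apply]
    by_cases h : i = j
    · subst h; simp
    · simp [h]
  simp only [h1, Finset.sum_add_distrib, Finset.sum_ite_eq', Finset.mem_univ, if_true]
  rw [← Finset.sum_filter, Finset.sum_const, ← G.neighborFinset_eq_filter,
    G.card_neighborFinset_eq_degree]
  simp only [nsmul_eq_mul]
  ring

/-- The quantum walk is a block encoding of the random walk. -/
theorem walkOp_none_none (hd : 1 ≤ d) (hdeg : ∀ i, G.degree i ≤ d)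
    (h : IsCoin (lazyWalk G d) coin) (i j : Fin N) :
    walkOp G coin (i, none) (j, none) = (lazyWalk G d i j : ℂ) := by
  have hV (x : WalkReg N) : coinOp coin x (j, none) =
      if x.1 = j then coin j x.2 none else 0 := by
    rcases x with ⟨a, b⟩
    by_cases hx : a = j
    · subst hx; simp [coinOp]
    · simp [coinOp, hx]
  have hS (x : WalkReg N) : (shiftOp G * coinOp coin) x (j, none) =
      coinOp coin (shiftMap G x) (j, none) := by
    rw [mul_apply, Finset.sum_eq_single (shiftMap G x)]
    · simp [shiftOp, shiftMap_shiftMap]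
    · intro y _ hy
      have : x ≠ shiftMap G y := fun h => hy (by rw [h, shiftMap_shiftMap])
      simp [shiftOp, this]
    · simp
  rw [walkOp, Matrix.mul_assoc, mul_apply]
  simp only [hS, Fintype.sum_prod_type]
  rw [Finset.sum_eq_single i]
  · have hsq (k l : Fin N) : star ((√(lazyWalk G d k l) : ℝ) : ℂ) * (√(lazyWalk G d k l) : ℝ) =
        lazyWalk G d k l := by
      rw [Complex.star_def, Complex.conj_ofReal, ← Complex.ofReal_mul,
        Real.mul_self_sqrt (lazyWalk_nonneg hd hdeg k l)]
    -- Only the coin state `j` contributes: along an edge the shift turns `(i, j)` into `(j, i)`,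
    -- and for `i = j` the state is fixed since a simple graph has no loops.
    rw [Fintype.sum_option, Finset.sum_eq_single j]
    · simp only [conjTranspose_apply, coinOp, of_apply, if_true, h.2.1, h.2.2, star_zero, zero_mul,
        zero_add, shiftMap]
      by_cases hij : G.Adj i j
      · rw [if_pos hij]
        simp only [if_true, h.2.2]
        rw [lazyWalk_symm j i, hsq]
      · rw [if_neg hij]
        by_cases he : i = j
        · subst he
          simp only [if_true, h.2.2]
          rw [hsq]
        · have : lazyWalk G d i j = 0 := by
            simp [lazyWalk, he, G.adj_comm j i, hij]
          simp [he, this]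
    · intro k _ hk
      simp only [conjTranspose_apply, coinOp, of_apply, if_true, h.2.2, shiftMap]
      by_cases hik : G.Adj i k
      · simp [hik, hk]
      · simp only [hik, if_false]
        by_cases he : i = j
        · subst he
          simp only [if_true, h.2.2]
          rw [hsq]
          simp [lazyWalk, hk, hik]
        · simp [he]
    · simp
  · intro k _ hk
    simp [coinOp, hk]
  · simp

end WalkOperator

/-! ### Chebyshev expansion of `x ^ t` and its truncation -/

section Chebyshev

open Polynomial

theorem two_mul_X_mul_chebyshev_T (n : ℤ) :
    2 * X * Chebyshev.T ℝ n = Chebyshev.T ℝ (n + 1) + Chebyshev.T ℝ (n - 1) := by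
  have h := Chebyshev.T_add_two ℝ (n - 1)
  rw [show n - 1 + 2 = n + 1 by ring, show n - 1 + 1 = n by ring] at h
  rw [h]
  ring

/-- Multiplication by `2 X` turns `T_n` into `T_(n+1) + T_(n-1)`, one step of a simple random walk
on the index. After `m.1` steps down and `m.2` steps up the index is `m.2 - m.1`, reached along a
binomial number of paths. -/
theorem two_pow_smul_X_pow (t : ℕ) : (2 : ℝ[X]) ^ t * X ^ t =
    ∑ m ∈ Finset.HasAntidiagonal.antidiagonal t, t.choose m.1 • Chebyshev.T ℝ ((m.2 : ℤ) - m.1) := by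
  induction t with
  | zero => simp
  | succ t ih =>
    rw [Finset.sum_antidiagonal_choose_succ_nsmul
      (fun i j : ℕ => Chebyshev.T ℝ ((j : ℤ) - i)) t, ← Finset.sum_add_distrib, pow_succ, pow_succ,
      show (2 : ℝ[X]) ^ t * 2 * (X ^ t * X) = 2 * X * (2 ^ t * X ^ t) by ring, ih,
      Finset.mul_sum]
    refine Finset.sum_congr rfl fun m hm => ?_
    have hm' : t.choose m.2 = t.choose m.1 := by
      rw [← Finset.HasAntidiagonal.mem_antidiagonal.1 hm, Nat.add_comm, Nat.choose_symm_add, Nat.add_comm]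
    rw [mul_smul_comm, two_mul_X_mul_chebyshev_T, hm', ← smul_add]
    congr 3 <;> push_cast <;> ring_nf

/-- A distance `l > 0` of the right parity is attained by two mirror-image pairs with equal binomial
coefficients, hence the exponent `t - 1` in `chebCoeff`; distance `0` is attained by one pair only.
-/
theorem sum_choose_natAbs_eq (t l : ℕ) (hl : l ≤ t) :
    ∑ m ∈ Finset.HasAntidiagonal.antidiagonal t with ((m.2 : ℤ) - m.1).natAbs = l, (t.choose m.1 : ℝ) =
      2 ^ t * chebCoeff t l := by
  unfold chebCoeff
  by_cases h0 : l = 0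
  · subst h0
    rw [if_pos rfl]
    split_ifs with h
    · have : (Finset.HasAntidiagonal.antidiagonal t).filter (fun m => ((m.2 : ℤ) - m.1).natAbs = 0) =
          {(t / 2, t / 2)} := by
        ext ⟨a, b⟩
        simp only [Finset.mem_filter, Finset.HasAntidiagonal.mem_antidiagonal, Finset.mem_singleton, Prod.mk.injEq]
        omega
      rw [this, Finset.sum_singleton]
      field_simp
    · rw [Finset.sum_eq_zero, mul_zero]
      rintro ⟨a, b⟩ hm
      simp only [Finset.mem_filter, Finset.HasAntidiagonal.mem_antidiagonal] at hm
      omega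
  · rw [if_neg h0]
    split_ifs with h
    · have : (Finset.HasAntidiagonal.antidiagonal t).filter (fun m => ((m.2 : ℤ) - m.1).natAbs = l) =
          {((t - l) / 2, (t + l) / 2), ((t + l) / 2, (t - l) / 2)} := by
        ext ⟨a, b⟩
        simp only [Finset.mem_filter, Finset.HasAntidiagonal.mem_antidiagonal, Finset.mem_insert,
          Finset.mem_singleton, Prod.mk.injEq]
        omega
      have hs : t.choose ((t + l) / 2) = t.choose ((t - l) / 2) := by
        rw [← Nat.choose_symm (by omega : (t - l) / 2 ≤ t)]
        congr 1
        omega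
      rw [this, Finset.sum_pair (by simp only [ne_eq, Prod.mk.injEq]; omega)]
      simp only [hs]
      obtain ⟨t, rfl⟩ : ∃ s, t = s + 1 := ⟨t - 1, by omega⟩
      rw [Nat.add_sub_cancel, pow_succ]
      field_simp
      ring
    · rw [Finset.sum_eq_zero, mul_zero]
      rintro ⟨a, b⟩ hm
      simp only [Finset.mem_filter, Finset.HasAntidiagonal.mem_antidiagonal] at hm
      omega

/-- The distance from the origin of the simple random walk after `t` steps is distributed
according to `chebCoeff t`. -/
theorem sum_choose_smul_natAbs {M : Type*} [AddCommGroup M] [Module ℝ M] (t : ℕ) (g : ℕ → M) :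
    ∑ m ∈ Finset.HasAntidiagonal.antidiagonal t, (t.choose m.1 : ℝ) • g ((m.2 : ℤ) - m.1).natAbs =
      (2 : ℝ) ^ t • ∑ l ∈ Finset.range (t + 1), chebCoeff t l • g l := by
  have hmap : ∀ m ∈ Finset.HasAntidiagonal.antidiagonal t,
      ((m.2 : ℤ) - m.1).natAbs ∈ Finset.range (t + 1) := by
    rintro ⟨a, b⟩ hm
    rw [Finset.HasAntidiagonal.mem_antidiagonal] at hm
    rw [Finset.mem_range]
    simp only at hm ⊢
    omega
  rw [← Finset.sum_fiberwise_of_maps_to hmap, Finset.smul_sum]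
  refine Finset.sum_congr rfl fun l hl => ?_
  rw [smul_smul, ← sum_choose_natAbs_eq t l (by rw [Finset.mem_range] at hl; omega),
    Finset.sum_smul]
  refine Finset.sum_congr rfl fun m hm => ?_
  rw [(Finset.mem_filter.1 hm).2]

theorem X_pow_eq_sum_chebCoeff (t : ℕ) :
    (X : ℝ[X]) ^ t = ∑ l ∈ Finset.range (t + 1), chebCoeff t l • Chebyshev.T ℝ l := by
  have h := sum_choose_smul_natAbs t fun l : ℕ => Chebyshev.T ℝ l
  simp only [Chebyshev.T_natAbs] at h
  have h2 : (2 : ℝ[X]) ^ t * X ^ t = (2 : ℝ) ^ t • X ^ t := by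
    rw [smul_eq_C_mul, C_pow]
    rfl
  have h3 := two_pow_smul_X_pow t
  simp only [← Nat.cast_smul_eq_nsmul ℝ] at h3
  rw [h2, h] at h3
  exact smul_right_injective _ (by positivity : (2 : ℝ) ^ t ≠ 0) h3

theorem chebCoeff_nonneg (t l : ℕ) : 0 ≤ chebCoeff t l := by
  unfold chebCoeff
  split_ifs <;> positivity

theorem chebCoeff_eq_zero {t l : ℕ} (h : t < l) : chebCoeff t l = 0 := by
  unfold chebCoeff
  rw [if_neg (by omega), if_neg (by omega)]

/-- Evaluate the expansion at `1`, where every `T_l` equals `1`. -/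
theorem sum_chebCoeff (t : ℕ) : ∑ l ∈ Finset.range (t + 1), chebCoeff t l = 1 := by
  have h := congrArg (eval 1) (X_pow_eq_sum_chebCoeff t)
  simpa [eval_finsetSum] using h.symm

/-- Chernoff bound for the simple random walk. -/
theorem sum_chebCoeff_tail (t τ : ℕ) :
    ∑ l ∈ Finset.range (t + 1), chebCoeff t l • (if τ < l then (1 : ℝ) else 0) ≤
      2 * Real.exp (-(τ ^ 2 / (2 * t))) := by
  rcases Nat.eq_zero_or_pos t with rfl | ht
  · simp
  have ht' : (0 : ℝ) < t := by exact_mod_cast ht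
  have h := sum_choose_smul_natAbs t fun l : ℕ => if τ < l then (1 : ℝ) else 0
  -- This exponent minimizes `t s ^ 2 / 2 - s τ`, the bound that results from `cosh s ≤ exp (s ^ 2 /
  -- 2)`.
  set s : ℝ := τ / t with hs
  have hs0 : 0 ≤ s := by positivity
  have hpt (n : ℤ) : (if τ < n.natAbs then (1 : ℝ) else 0) ≤
      Real.exp (-(s * τ)) * (Real.exp (s * n) + Real.exp (-(s * n))) := by
    split_ifs with hn
    · rw [mul_add, ← Real.exp_add, ← Real.exp_add]
      have hn' : (τ : ℝ) ≤ |(n : ℝ)| := by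
        rw [← Int.cast_abs, Int.abs_eq_natAbs]
        exact_mod_cast hn.le
      rcases le_total 0 (n : ℝ) with h0 | h0
      · rw [abs_of_nonneg h0] at hn'
        have := Real.one_le_exp (by nlinarith : 0 ≤ -(s * τ) + s * n)
        have := Real.exp_pos (-(s * τ) + -(s * n))
        linarith
      · rw [abs_of_nonpos h0] at hn'
        have := Real.one_le_exp (by nlinarith : 0 ≤ -(s * τ) + -(s * n))
        have := Real.exp_pos (-(s * τ) + (s * n))
        linarith
    · positivity
  have hbin (x : ℝ) : ∑ m ∈ Finset.HasAntidiagonal.antidiagonal t,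
      (t.choose m.1 : ℝ) * Real.exp (x * ((m.2 : ℤ) - m.1 : ℤ)) = (2 * Real.cosh x) ^ t := by
    rw [Real.cosh_eq, mul_div_cancel₀ _ two_ne_zero, add_comm,
      (Commute.all (Real.exp (-x)) (Real.exp x)).add_pow']
    refine Finset.sum_congr rfl fun m _ => ?_
    rw [nsmul_eq_mul, ← Real.exp_nat_mul, ← Real.exp_nat_mul, ← Real.exp_add]
    congr 2
    push_cast
    ring
  have h1 : (2 : ℝ) ^ t * ∑ l ∈ Finset.range (t + 1), chebCoeff t l • (if τ < l then (1 : ℝ) else 0)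
      ≤ Real.exp (-(s * τ)) * (2 * (2 * Real.cosh s) ^ t) := by
    rw [← smul_eq_mul, ← h]
    calc _ ≤ ∑ m ∈ Finset.HasAntidiagonal.antidiagonal t, Real.exp (-(s * τ)) *
          ((t.choose m.1 : ℝ) * Real.exp (s * ((m.2 : ℤ) - m.1 : ℤ)) +
            (t.choose m.1 : ℝ) * Real.exp (-s * ((m.2 : ℤ) - m.1 : ℤ))) := by
          refine Finset.sum_le_sum fun m _ => ?_
          have := mul_le_mul_of_nonneg_left (hpt ((m.2 : ℤ) - m.1))
            (Nat.cast_nonneg (α := ℝ) (t.choose m.1))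
          rw [smul_eq_mul]
          refine this.trans (le_of_eq ?_)
          rw [neg_mul]
          ring
      _ = _ := by
          rw [← Finset.mul_sum, Finset.sum_add_distrib, hbin, hbin, Real.cosh_neg]
          ring
  have h2 : (2 * Real.cosh s) ^ t ≤ 2 ^ t * Real.exp (t * (s ^ 2 / 2)) := by
    rw [mul_pow, Real.exp_nat_mul]
    gcongr
    exact Real.cosh_le_exp_half_sq s
  have h3 : Real.exp (-(s * τ)) * Real.exp (t * (s ^ 2 / 2)) =
      Real.exp (-(τ ^ 2 / (2 * t))) := by
    rw [← Real.exp_add, hs]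
    congr 1
    field_simp
    ring
  refine le_of_mul_le_mul_left (h1.trans ?_) (by positivity : (0 : ℝ) < 2 ^ t)
  rw [← h3]
  have := mul_le_mul_of_nonneg_left h2 (Real.exp_pos (-(s * τ))).le
  linarith

theorem one_sub_sum_chebCoeff_le (t τ : ℕ) :
    1 - ∑ l ∈ Finset.range (τ + 1), chebCoeff t l ≤ 2 * Real.exp (-(τ ^ 2 / (2 * t))) := by
  refine le_trans ?_ (sum_chebCoeff_tail t τ)
  have h1 : ∑ l ∈ Finset.range (t + 1), chebCoeff t l • (if τ < l then (0 : ℝ) else 1) ≤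
      ∑ l ∈ Finset.range (τ + 1), chebCoeff t l := by
    have : ∑ l ∈ Finset.range (t + 1), chebCoeff t l • (if τ < l then (0 : ℝ) else 1) =
        ∑ l ∈ (Finset.range (t + 1)).filter (fun l => ¬ τ < l), chebCoeff t l := by
      rw [Finset.sum_filter]
      refine Finset.sum_congr rfl fun l _ => ?_
      split_ifs <;> simp
    rw [this]
    refine Finset.sum_le_sum_of_subset_of_nonneg (fun l hl => ?_) fun l _ _ => chebCoeff_nonneg t l
    simp only [Finset.mem_filter, Finset.mem_range] at hl ⊢
    omega
  have h2 := sum_chebCoeff t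
  have h3 : ∑ l ∈ Finset.range (t + 1), chebCoeff t l • (if τ < l then (1 : ℝ) else 0) +
      ∑ l ∈ Finset.range (t + 1), chebCoeff t l • (if τ < l then (0 : ℝ) else 1) = 1 := by
    rw [← Finset.sum_add_distrib]
    refine Eq.trans ?_ h2
    refine Finset.sum_congr rfl fun l _ => ?_
    split_ifs <;> simp
  linarith

theorem sum_chebCoeff_le_one (t τ : ℕ) : ∑ l ∈ Finset.range (τ + 1), chebCoeff t l ≤ 1 := by
  have h : ∑ l ∈ Finset.range (τ + 1), chebCoeff t l ≤
      ∑ l ∈ Finset.range (t + 1 + τ), chebCoeff t l :=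
    Finset.sum_le_sum_of_subset_of_nonneg (Finset.range_mono (by omega))
      fun l _ _ => chebCoeff_nonneg t l
  rw [Finset.sum_range_add _ (t + 1) τ, sum_chebCoeff, Finset.sum_eq_zero (s := Finset.range τ),
    add_zero] at h
  · exact h
  · exact fun l _ => chebCoeff_eq_zero (by omega)

/-- Error of normalized truncation. -/
theorem norm_truncate_sub_le {E : Type*} [NormedAddCommGroup E] [NormedSpace ℝ E] {t τ : ℕ}
    (hS : 0 < ∑ l ∈ Finset.range (τ + 1), chebCoeff t l) {v : ℕ → E} (hv : ∀ l, ‖v l‖ ≤ 1) :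
    ‖(∑ l ∈ Finset.range (τ + 1), (chebCoeff t l / ∑ k ∈ Finset.range (τ + 1), chebCoeff t k) • v l)
      - ∑ l ∈ Finset.range (t + 1), chebCoeff t l • v l‖ ≤
      2 * (1 - ∑ l ∈ Finset.range (τ + 1), chebCoeff t l) := by
  have hS1 := sum_chebCoeff_le_one t τ
  set S := ∑ l ∈ Finset.range (τ + 1), chebCoeff t l with hSd
  have h1 : ∑ l ∈ Finset.range (τ + 1 + t), chebCoeff t l = 1 := by
    rw [show τ + 1 + t = t + 1 + τ by ring, Finset.sum_range_add _ (t + 1) τ, sum_chebCoeff,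
      Finset.sum_eq_zero (s := Finset.range τ), add_zero]
    exact fun l _ => chebCoeff_eq_zero (by omega)
  have h2 : ∑ l ∈ Finset.range (t + 1), chebCoeff t l • v l =
      ∑ l ∈ Finset.range (τ + 1 + t), chebCoeff t l • v l := by
    rw [show τ + 1 + t = t + 1 + τ by ring, Finset.sum_range_add _ (t + 1) τ,
      Finset.sum_eq_zero (s := Finset.range τ), add_zero]
    intro l _
    rw [chebCoeff_eq_zero (by omega), zero_smul]
  rw [h2, Finset.sum_range_add _ (τ + 1) t, ← sub_sub, ← Finset.sum_sub_distrib]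
  rw [Finset.sum_range_add _ (τ + 1) t, ← hSd] at h1
  refine (norm_sub_le _ _).trans ?_
  -- With `S` the retained mass, renormalizing the retained terms and dropping the tail cost `1 - S`
  -- each.
  have h3 : ‖∑ l ∈ Finset.range (τ + 1), ((chebCoeff t l / S) • v l - chebCoeff t l • v l)‖ ≤
      1 - S := by
    calc _ ≤ ∑ l ∈ Finset.range (τ + 1), (chebCoeff t l / S - chebCoeff t l) := by
          refine norm_sum_le_of_le _ fun l _ => ?_
          have : 0 ≤ chebCoeff t l / S - chebCoeff t l := by
            rw [sub_nonneg, le_div_iff₀ hS]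
            nlinarith [chebCoeff_nonneg t l]
          rw [← sub_smul, norm_smul, Real.norm_of_nonneg this]
          exact mul_le_of_le_one_right this (hv l)
      _ = 1 - S := by
          rw [Finset.sum_sub_distrib, ← Finset.sum_div, ← hSd, div_self hS.ne']
  have h4 : ‖∑ l ∈ Finset.range t, chebCoeff t (τ + 1 + l) • v (τ + 1 + l)‖ ≤ 1 - S := by
    calc _ ≤ ∑ l ∈ Finset.range t, chebCoeff t (τ + 1 + l) := by
          refine norm_sum_le_of_le _ fun l _ => ?_
          rw [norm_smul, Real.norm_of_nonneg (chebCoeff_nonneg _ _)]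
          exact mul_le_of_le_one_right (chebCoeff_nonneg _ _) (hv _)
      _ = 1 - S := by linarith
  linarith

end Chebyshev

/-! ### The fast-forwarded walk encodes `P ^ t` -/

section FastForward

open Polynomial

/-- For unit vectors `e` and `s`, the reflection along `w = e - s` exchanges them, because `w ⬝ᵥ w =
2 (1 - s i₀)`. If `w = 0`, the quotient `2 / 0 = 0` makes the gate the identity, which is right
since then `s = e`. -/
theorem prepare_apply_self {ι : Type} [Fintype ι] [DecidableEq ι] (i₀ : ι) (s : ι → ℝ)
    (hs : ∑ i, s i ^ 2 = 1) (i : ι) : (prepare i₀ s).1 i i₀ = (s i : ℂ) := by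
  simp only [prepare, map_apply, Matrix.sub_apply, Matrix.smul_apply, vecMulVec_apply, smul_eq_mul]
  set w : ι → ℝ := Pi.single i₀ 1 - s with hw
  have hww : w ⬝ᵥ w = 2 * w i₀ := by
    have h1 (j : ι) : w j * w j = Pi.single (M := fun _ => ℝ) i₀ (1 - 2 * s i₀) j + s j ^ 2 := by
      by_cases h : j = i₀
      · subst h
        simp [hw]
        ring
      · simp [hw, h]
        ring
    simp only [dotProduct, h1, Finset.sum_add_distrib, hs, Finset.sum_pi_single']
    simp [hw]
    ring
  norm_cast
  by_cases h : w ⬝ᵥ w = 0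
  · have h2 : w i = 0 := by
      rw [dotProduct_self_eq_zero] at h
      exact congrFun h i
    have h3 : s i = (1 : Matrix ι ι ℝ) i i₀ := by
      have : w i = (1 : Matrix ι ι ℝ) i i₀ - s i := by
        simp [hw, Pi.single_apply, one_apply]
      linarith
    rw [h2, h3]
    simp
  · have h0 : w i₀ ≠ 0 := fun h0 => h (by rw [hww, h0, mul_zero])
    have : w i = (1 : Matrix ι ι ℝ) i i₀ - s i := by
      simp [hw, Pi.single_apply, one_apply]
    rw [hww]
    field_simp
    linarith

variable {N : ℕ} (G : SimpleGraph (Fin N)) [DecidableRel G.Adj] (d : ℕ)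

/-- The vector `T_l(P) |u⟩`, with `T_l` the `l`-th Chebyshev polynomial. -/
noncomputable def chebDist (l : ℕ) (u : Fin N) : EuclideanSpace ℝ (Fin N) :=
  WithLp.toLp 2 ((aeval (lazyWalk G d) (Chebyshev.T ℝ l)) *ᵥ Pi.single u 1)

/-- The vector encoded by the fast-forwarded quantum walk. -/
noncomputable def ffDist (t τ : ℕ) (u : Fin N) : EuclideanSpace ℝ (Fin N) :=
  ∑ l ∈ Finset.range (τ + 1),
    (chebCoeff t l / ∑ k ∈ Finset.range (τ + 1), chebCoeff t k) • chebDist G d l u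

variable {G d} {coin : Fin N → Matrix (Option (Fin N)) (Option (Fin N)) ℂ}

theorem walkDist_eq_sum (t : ℕ) (u : Fin N) :
    walkDist G d t u = ∑ l ∈ Finset.range (t + 1), chebCoeff t l • chebDist G d l u := by
  have h := congrArg (aeval (lazyWalk G d)) (X_pow_eq_sum_chebCoeff t)
  simp only [map_pow, aeval_X, map_sum, map_smul] at h
  rw [walkDist, h]
  ext j
  simp [chebDist, Matrix.sum_apply]

theorem chebDist_add_two (l : ℕ) (u j : Fin N) : chebDist G d (l + 2) u j =
    2 * ∑ i, lazyWalk G d j i * chebDist G d (l + 1) u i - chebDist G d l u j := by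
  simp only [chebDist]
  push_cast
  rw [Chebyshev.T_add_two, map_sub, map_mul, map_mul, aeval_X, sub_mulVec]
  simp only [map_ofNat, ← mulVec_mulVec]
  simp only [ofNat_mulVec, mulVec_single_one]
  simp [mulVec, dotProduct]

theorem reflectedWalk_eval_mulVec (U : Matrix (WalkReg N) (WalkReg N) ℂ) (v : WalkReg N → ℂ)
    (x : WalkReg N) : ((reflectedWalk N).eval U *ᵥ v) x =
      (if x.2 = none then 1 else -1) * (U *ᵥ v) x := by
  rw [reflectedWalk, Circuit.eval_seq_mulVec]
  simp only [Circuit.eval, phaseOn, mulVec_diagonal, Complex.exp_pi_mul_I]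
  by_cases h : x.2 = none <;> simp [h]

/-- Put `f = W ^ (l + 1) e` and `R = 2 Π_♭ - 1`. Since `R` and `U` are involutions, `W ^ l e = U R
f`, while the flat part of `W ^ (l + 2) e` is that of `U f`. Their sum has the flat part of `U (1 +
R) f = 2 U Π_♭ f`, which is `2 P` applied to the flat part of `f`: the Chebyshev recursion. -/
theorem reflectedWalk_pow (hd : 1 ≤ d) (hdeg : ∀ i, G.degree i ≤ d)
    (h : IsCoin (lazyWalk G d) coin) (l : ℕ) (u j : Fin N) :
    (((reflectedWalk N).eval (walkOp G coin)) ^ l *ᵥ Pi.single (u, none) 1) (j, none) =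
      (chebDist G d l u j : ℂ) := by
  set U := walkOp G coin with hUdef
  set W := (reflectedWalk N).eval U with hW
  induction l using Nat.twoStepInduction generalizing j with
  | zero =>
    by_cases hj : j = u
    · subst hj; simp [chebDist]
    · simp [chebDist, hj]
  | one =>
    rw [pow_one, hW, reflectedWalk_eval_mulVec, if_pos rfl, one_mul]
    simp [hUdef, walkOp_none_none hd hdeg h, chebDist]
  | more l h0 h1 =>
    set e : WalkReg N → ℂ := Pi.single (u, none) 1
    have hU2 := walkOp_mul_self h
    have e1 : W ^ (l + 2) *ᵥ e = W *ᵥ (W ^ (l + 1) *ᵥ e) := by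
      rw [mulVec_mulVec, ← pow_succ']
    set f := W ^ (l + 1) *ᵥ e with hf
    have e0 : W ^ l *ᵥ e = U *ᵥ fun x => (if x.2 = none then 1 else -1) * f x := by
      have hf' : f = W *ᵥ (W ^ l *ᵥ e) := by
        rw [hf, mulVec_mulVec, ← pow_succ']
      have : (fun x => (if x.2 = none then 1 else -1) * f x) = U *ᵥ (W ^ l *ᵥ e) := by
        funext x
        rw [hf', hW, reflectedWalk_eval_mulVec, ← mul_assoc]
        split_ifs <;> simp
      rw [this, mulVec_mulVec, hU2, one_mulVec]
    have e2 : (W ^ (l + 2) *ᵥ e) (j, none) + (W ^ l *ᵥ e) (j, none) =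
        2 * ∑ i, (lazyWalk G d j i : ℂ) * f (i, none) := by
      rw [e1, hW, reflectedWalk_eval_mulVec, if_pos rfl, one_mul, e0]
      simp only [mulVec, dotProduct, Fintype.sum_prod_type, Finset.mul_sum,
        ← Finset.sum_add_distrib]
      refine Finset.sum_congr rfl fun i _ => ?_
      rw [Fintype.sum_option]
      simp only [if_true, reduceCtorEq, if_false]
      rw [hUdef, walkOp_none_none hd hdeg h, Finset.sum_eq_zero]
      · ring
      · intro k _
        ring
    rw [eq_sub_of_add_eq e2, h0, chebDist_add_two]
    push_cast
    simp only [h1]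

theorem norm_sq_mulVec_single {ι : Type} [Fintype ι] [DecidableEq ι] {A : Matrix ι ι ℂ}
    (hA : Aᴴ * A = 1) (i : ι) : ∑ j, ‖(A *ᵥ Pi.single i 1) j‖ ^ 2 = 1 := by
  have h := congrFun (congrFun hA i) i
  rw [Matrix.mul_apply, Matrix.one_apply_eq] at h
  have h2 : ((∑ j, ‖(A *ᵥ Pi.single i 1) j‖ ^ 2 : ℝ) : ℂ) = 1 := by
    refine Eq.trans ?_ h
    push_cast
    refine Finset.sum_congr rfl fun j _ => ?_
    rw [Matrix.conjTranspose_apply, Complex.star_def, Complex.conj_mul', mulVec_single_one]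
    rfl
  exact_mod_cast h2

/-- The vector is part of a column of the unitary `W ^ l`, so no spectral theorem for `P` is needed.
-/
theorem norm_chebDist_le (hd : 1 ≤ d) (hdeg : ∀ i, G.degree i ≤ d)
    (h : IsCoin (lazyWalk G d) coin) (l : ℕ) (u : Fin N) : ‖chebDist G d l u‖ ≤ 1 := by
  have hW := Circuit.eval_conjTranspose_mul_self (conjTranspose_walkOp G (coin := coin))
    (walkOp_mul_self h) (reflectedWalk N)
  set W := (reflectedWalk N).eval (walkOp G coin) with hWd
  have hWl : (W ^ l)ᴴ * W ^ l = 1 := by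
    have : W ∈ unitaryGroup (WalkReg N) ℂ := mem_unitaryGroup_iff'.2 hW
    exact mem_unitaryGroup_iff'.1 (pow_mem this l)
  have h1 := norm_sq_mulVec_single hWl (u, none)
  rw [EuclideanSpace.norm_eq, Real.sqrt_le_one]
  rw [← h1, Fintype.sum_prod_type]
  refine Finset.sum_le_sum fun j _ => ?_
  rw [Fintype.sum_option, reflectedWalk_pow hd hdeg h, Complex.norm_real]
  exact le_add_of_nonneg_right (Finset.sum_nonneg fun _ _ => sq_nonneg _)

/-- The fast-forwarded walk encodes the normalized truncation of the Chebyshev expansion of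
`P ^ t`. -/
theorem fastForward_eval (hd : 1 ≤ d) (hdeg : ∀ i, G.degree i ≤ d)
    (h : IsCoin (lazyWalk G d) coin) {t τ : ℕ}
    (hS : 0 < ∑ l ∈ Finset.range (τ + 1), chebCoeff t l) (u j : Fin N) :
    (fastForward N t τ).eval (walkOp G coin) ((j, none), 0) ((u, none), 0) =
      (ffDist G d t τ u j : ℂ) := by
  set S := ∑ l ∈ Finset.range (τ + 1), chebCoeff t l with hSd
  have hSf : ∑ k : Fin (τ + 1), chebCoeff t k = S := by
    rw [hSd, Finset.sum_range]
  have hq (l : Fin (τ + 1)) : lcuAmplitude t τ l ^ 2 = chebCoeff t l / S := by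
    rw [lcuAmplitude, hSf, Real.sq_sqrt (div_nonneg (chebCoeff_nonneg _ _) hS.le)]
  have hsum : ∑ l, lcuAmplitude t τ l ^ 2 = 1 := by
    simp only [hq]
    rw [← Finset.sum_div, hSf, div_self hS.ne']
  have hcol := prepare_apply_self 0 _ hsum
  set V := prepare 0 (lcuAmplitude t τ) with hV
  have hVinv (l : Fin (τ + 1)) : (V⁻¹).1 0 l = (lcuAmplitude t τ l : ℂ) := by
    have : (V⁻¹).1 0 l = star (V.1 l 0) := rfl
    rw [this, hcol, Complex.star_def, Complex.conj_ofReal]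
  have e1 : (fastForward N t τ).eval (walkOp G coin) ((j, none), 0) ((u, none), 0) =
      ((fastForward N t τ).eval (walkOp G coin) *ᵥ Pi.single ((u, none), 0) 1) ((j, none), 0) := by
    rw [mulVec_single_one]; rfl
  rw [e1, fastForward, Circuit.eval_seq_mulVec, Circuit.eval_right_mulVec]
  simp only [Circuit.eval, mulVec, dotProduct, ← hV, hVinv]
  have e2 (l : Fin (τ + 1)) :
      ((Circuit.iter (Circuit.right (Circuit.gate V)) (fun k => Circuit.ctrl
        (fun l : Fin (τ + 1) => k < (l : ℕ)) (reflectedWalk N)) τ).eval (walkOp G coin) *ᵥ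
          Pi.single ((u, none), 0) 1) ((j, none), l) =
        lcuAmplitude t τ l * (chebDist G d l u j : ℂ) := by
    -- The counter never exceeds `τ`, so all `l` powers of `W` are carried out.
    rw [Circuit.eval_iter_ctrl_mulVec, min_eq_right (by omega)]
    have : (fun i' => ((Circuit.right (Circuit.gate V)).eval (walkOp G coin) *ᵥ
        Pi.single ((u, none), 0) 1) (i', l)) =
        (lcuAmplitude t τ l : ℂ) • (Pi.single (u, none) 1 : WalkReg N → ℂ) := by
      funext i'
      rw [Circuit.eval_right_mulVec]
      simp only [Circuit.eval, mulVec, dotProduct]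
      rw [Finset.sum_eq_single 0, hcol]
      · by_cases hi : i' = (u, none)
        · subst hi; simp
        · simp [hi]
      · intro k _ hk
        simp [hk]
      · simp
    rw [this, mulVec_smul, Pi.smul_apply, reflectedWalk_pow hd hdeg h, smul_eq_mul]
  have e3 (l : Fin (τ + 1)) := e2 l
  simp only [mulVec, dotProduct] at e3
  simp only [e3]
  rw [ffDist, Finset.sum_range]
  simp only [← hSd, WithLp.ofLp_sum, Finset.sum_apply, WithLp.ofLp_smul, Pi.smul_apply,
    smul_eq_mul, Complex.ofReal_sum]
  refine Finset.sum_congr rfl fun l _ => ?_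
  rw [← hq]
  push_cast
  ring

/-- This choice of `τ` brings the Chernoff tail down to `2 / x`; the truncation error is at most
twice the tail. The condition `x > 2` keeps the retained mass positive, so that the normalization
makes sense. -/
theorem norm_ffDist_sub_le (hd : 1 ≤ d) (hdeg : ∀ i, G.degree i ≤ d)
    (h : IsCoin (lazyWalk G d) coin) {t τ : ℕ} (u : Fin N) {x : ℝ} (hx : 2 < x)
    (hτ : √(2 * t * Real.log x) ≤ τ) :
    0 < ∑ l ∈ Finset.range (τ + 1), chebCoeff t l ∧
      ‖ffDist G d t τ u - walkDist G d t u‖ ≤ 4 / x := by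
  have hR : 1 - ∑ l ∈ Finset.range (τ + 1), chebCoeff t l ≤ 2 / x := by
    -- For `t = 0` the Chernoff exponent is a division by zero and says nothing, but no mass is cut
    -- off.
    rcases Nat.eq_zero_or_pos t with rfl | ht
    · have : ∑ l ∈ Finset.range (τ + 1), chebCoeff 0 l = 1 := by
        refine le_antisymm (sum_chebCoeff_le_one _ _) ?_
        rw [← sum_chebCoeff 0]
        exact Finset.sum_le_sum_of_subset_of_nonneg (Finset.range_mono (by omega))
          fun l _ _ => chebCoeff_nonneg 0 l
      rw [this, sub_self]
      positivity
    · have ht' : (0 : ℝ) < t := by exact_mod_cast ht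
      refine (one_sub_sum_chebCoeff_le t τ).trans ?_
      rw [div_eq_mul_inv 2 x]
      refine mul_le_mul_of_nonneg_left ?_ zero_le_two
      rw [← Real.exp_log (by positivity : 0 < x⁻¹), Real.log_inv, Real.exp_le_exp, neg_le_neg_iff]
      rw [le_div_iff₀ (by positivity)]
      have := (Real.sqrt_le_left (Nat.cast_nonneg τ)).1 hτ
      linarith
  have hS : 0 < ∑ l ∈ Finset.range (τ + 1), chebCoeff t l := by
    have : 2 / x < 1 := by rw [div_lt_one] <;> linarith
    linarith
  refine ⟨hS, ?_⟩
  rw [ffDist, walkDist_eq_sum]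
  refine (norm_truncate_sub_le hS fun l => norm_chebDist_le hd hdeg h l u).trans ?_
  calc _ ≤ 2 * (2 / x) := by gcongr
    _ = 4 / x := by ring

theorem steps_fastForward (t τ : ℕ) : (fastForward N t τ).steps = τ := by
  rw [fastForward, Circuit.steps, Circuit.steps_iter _ _ 1 fun _ => rfl]
  simp [Circuit.steps, Circuit.right, Circuit.left]

theorem walkDist_nonneg (hd : 1 ≤ d) (hdeg : ∀ i, G.degree i ≤ d) (t : ℕ) (u j : Fin N) :
    0 ≤ walkDist G d t u j := by
  have h (t : ℕ) (i : Fin N) : 0 ≤ (lazyWalk G d ^ t) i u := by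
    induction t generalizing i with
    | zero => rw [pow_zero, one_apply]; split_ifs <;> norm_num
    | succ t ih =>
      rw [pow_succ', mul_apply]
      exact Finset.sum_nonneg fun k _ => mul_nonneg (lazyWalk_nonneg hd hdeg _ _) (ih k)
  simpa [walkDist] using h t j

theorem sum_walkDist (t : ℕ) (u : Fin N) : ∑ j, walkDist G d t u j = 1 := by
  have h (t : ℕ) : ∑ i, (lazyWalk G d ^ t) i u = 1 := by
    induction t with
    | zero => simp [one_apply]
    | succ t ih =>
      simp only [pow_succ', mul_apply]
      rw [Finset.sum_comm]
      simp only [← Finset.sum_mul, sum_lazyWalk, one_mul, ih]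
  simpa [walkDist] using h t

/-- For a probability vector `p j ^ 2 ≤ p j`. -/
theorem norm_walkDist_le_one (hd : 1 ≤ d) (hdeg : ∀ i, G.degree i ≤ d) (t : ℕ) (u : Fin N) :
    ‖walkDist G d t u‖ ≤ 1 := by
  rw [EuclideanSpace.norm_eq, Real.sqrt_le_one, ← sum_walkDist (G := G) (d := d) t u]
  refine Finset.sum_le_sum fun j _ => ?_
  have h0 := walkDist_nonneg hd hdeg t u j
  have h1 : walkDist G d t u j ≤ 1 := by
    rw [← sum_walkDist (G := G) (d := d) t u]
    exact Finset.single_le_sum (f := fun j => walkDist G d t u j)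
      (fun i _ => walkDist_nonneg hd hdeg t u i) (Finset.mem_univ j)
  rw [Real.norm_of_nonneg h0]
  nlinarith

/-- Cauchy–Schwarz against the constant vector. This lower bound limits the number of rounds of the
multiplicative estimator and justifies the floor in the definition of `λ`. -/
theorem one_div_sqrt_le_norm_walkDist (t : ℕ) (u : Fin N) :
    1 / √N ≤ ‖walkDist G d t u‖ := by
  have hN : (0 : ℝ) < √N := by
    have := u.pos
    positivity
  rw [div_le_iff₀ hN, EuclideanSpace.norm_eq, ← Real.sqrt_mul (by positivity), Real.one_le_sqrt]
  have h := sq_sum_le_card_mul_sum_sq (s := Finset.univ) (f := fun j => walkDist G d t u j)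
  rw [sum_walkDist] at h
  simp only [Finset.card_univ, Fintype.card_fin, one_pow] at h
  simp only [Real.norm_eq_abs, sq_abs]
  linarith

end FastForward

/-! ### Tails of the Fejér kernel -/

section FejerTail

/-- Telescoping, with `1 / z ^ 2 ≤ 1 / (z - 1) - 1 / z` for `z > 1`. -/
theorem sum_Ico_inv_sq_le (a : ℤ) (x : ℝ) (hx : x + 1 < a) (n : ℕ) :
    ∑ k ∈ Finset.range n, 1 / ((a + k : ℤ) - x : ℝ) ^ 2 ≤ 1 / (a - 1 - x) - 1 / (a - 1 + n - x) := by
  induction n with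
  | zero => simp
  | succ n ih =>
    rw [Finset.sum_range_succ]
    have h1 : 0 < a - 1 + n - x := by linarith [(Nat.cast_nonneg n : (0 : ℝ) ≤ n)]
    have h2 : 1 / ((a + n : ℤ) - x : ℝ) ^ 2 ≤
        1 / (a - 1 + n - x) - 1 / (a - 1 + (n + 1 : ℕ) - x) := by
      push_cast
      rw [div_sub_div _ _ h1.ne' (by linarith), div_le_div_iff₀ (by nlinarith) (by nlinarith)]
      nlinarith
    linarith

theorem sum_inv_sq_le_of_lt (S : Finset ℤ) (x r : ℝ) (hr : 1 < r) (hS : ∀ n ∈ S, r < n - x) :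
    ∑ n ∈ S, 1 / ((n : ℝ) - x) ^ 2 ≤ 1 / (r - 1) := by
  set a : ℤ := ⌊x + r⌋ + 1 with ha
  have hax : x + r < a := by
    rw [ha]; push_cast; exact Int.lt_floor_add_one _
  obtain ⟨m, hm⟩ : ∃ m : ℕ, ∀ n ∈ S, n < a + m := by
    refine ⟨∑ n ∈ S, (n - a + 1).toNat, fun n hn => ?_⟩
    have := Finset.single_le_sum (f := fun n : ℤ => (n - a + 1).toNat) (fun _ _ => Nat.zero_le _) hn
    omega
  have hsub : S ⊆ (Finset.range m).image fun k : ℕ => a + (k : ℤ) := by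
    intro n hn
    have h1 : a ≤ n := by
      rw [ha, Int.add_one_le_iff, Int.floor_lt]
      linarith [hS n hn]
    have h2 := hm n hn
    rw [Finset.mem_image]
    exact ⟨(n - a).toNat, Finset.mem_range.2 (by omega), by omega⟩
  refine (Finset.sum_le_sum_of_subset_of_nonneg hsub fun n _ _ => by positivity).trans ?_
  rw [Finset.sum_image fun i _ j _ h => by simpa using h]
  refine (sum_Ico_inv_sq_le a x (by linarith) m).trans ?_
  have h1 : 1 / ((a : ℝ) - 1 - x) ≤ 1 / (r - 1) :=
    one_div_le_one_div_of_le (by linarith) (by linarith)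
  have h2 : 0 ≤ 1 / ((a : ℝ) - 1 + m - x) :=
    one_div_nonneg.2 (by linarith [(Nat.cast_nonneg m : (0 : ℝ) ≤ m)])
  linarith

theorem sum_inv_sq_le (S : Finset ℤ) (x r : ℝ) (hr : 1 < r) (hS : ∀ n ∈ S, r < |n - x|) :
    ∑ n ∈ S, 1 / ((n : ℝ) - x) ^ 2 ≤ 2 / (r - 1) := by
  classical
  rw [← Finset.sum_filter_add_sum_filter_not S fun n : ℤ => x ≤ n]
  have h1 : ∑ n ∈ S with x ≤ (n : ℤ), 1 / ((n : ℝ) - x) ^ 2 ≤ 1 / (r - 1) := by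
    refine sum_inv_sq_le_of_lt _ x r hr fun n hn => ?_
    rw [Finset.mem_filter] at hn
    have := hS n hn.1
    rwa [abs_of_nonneg (by linarith)] at this
  have h2 : ∑ n ∈ S with ¬ x ≤ (n : ℤ), 1 / ((n : ℝ) - x) ^ 2 ≤ 1 / (r - 1) := by
    have := sum_inv_sq_le_of_lt ((S.filter fun n : ℤ => ¬ x ≤ n).map (Equiv.neg ℤ).toEmbedding)
      (-x) r hr ?_
    · rw [Finset.sum_map] at this
      refine le_trans (le_of_eq (Finset.sum_congr rfl fun n _ => ?_)) this
      simp only [Equiv.coe_toEmbedding, Equiv.neg_apply, Int.cast_neg]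
      rw [← neg_sq]
      congr 2
      ring
    · intro n hn
      simp only [Finset.mem_map, Finset.mem_filter, Equiv.coe_toEmbedding, Equiv.neg_apply] at hn
      obtain ⟨k, hk, rfl⟩ := hn
      have := hS k hk.1
      rw [abs_of_neg (by linarith [not_le.1 hk.2])] at this
      push_cast
      linarith
  calc _ ≤ 1 / (r - 1) + 1 / (r - 1) := add_le_add h1 h2
    _ = 2 / (r - 1) := by ring

/-- The sum is geometric: its numerator has norm at most `2`, its denominator norm `2 |sin Δ|`. The
product form covers `sin Δ = 0`. -/
theorem norm_geom_sum_mul_abs_sin_le (M : ℕ) (Δ : ℝ) :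
    ‖∑ k ∈ Finset.range M, Complex.exp (2 * k * Δ * Complex.I)‖ * |Real.sin Δ| ≤ 1 := by
  have h1 : ∑ k ∈ Finset.range M, Complex.exp (2 * k * Δ * Complex.I) =
      ∑ k ∈ Finset.range M, Complex.exp (2 * Δ * Complex.I) ^ k := by
    refine Finset.sum_congr rfl fun k _ => ?_
    rw [← Complex.exp_nat_mul]
    congr 1
    ring
  have h2 : Complex.exp (2 * Δ * Complex.I) - 1 =
      Complex.exp (Δ * Complex.I) * (2 * Real.sin Δ * Complex.I) := by
    rw [show (2 * Δ * Complex.I : ℂ) = Δ * Complex.I + Δ * Complex.I by ring, Complex.exp_add,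
      Complex.exp_mul_I, Complex.ofReal_sin]
    have := Complex.sin_sq_add_cos_sq Δ
    linear_combination this + (Complex.sin Δ ^ 2 - 2 * Complex.sin Δ ^ 2) * Complex.I_sq
  have h3 : ‖Complex.exp (2 * Δ * Complex.I) - 1‖ = 2 * |Real.sin Δ| := by
    rw [h2, norm_mul, Complex.norm_exp_ofReal_mul_I, norm_mul, norm_mul, Complex.norm_I,
      Complex.norm_real, Real.norm_eq_abs]
    simp
  have h4 : ‖∑ k ∈ Finset.range M, Complex.exp (2 * k * Δ * Complex.I)‖ *
      ‖Complex.exp (2 * Δ * Complex.I) - 1‖ ≤ 2 := by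
    rw [h1, ← norm_mul, geom_sum_mul]
    refine (norm_sub_le _ _).trans ?_
    rw [norm_pow, show (2 * Δ * Complex.I : ℂ) = ((2 * Δ : ℝ) : ℂ) * Complex.I by push_cast; ring,
      Complex.norm_exp_ofReal_mul_I]
    norm_num
  rw [h3] at h4
  linarith

theorem two_mul_abs_le_abs_sin {z : ℝ} (hz : |z| ≤ 1 / 2) : 2 * |z| ≤ |Real.sin (Real.pi * z)| := by
  have h : 2 / Real.pi * |Real.pi * z| ≤ |Real.sin (Real.pi * z)| := by
    refine Real.mul_abs_le_abs_sin ?_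
    rw [abs_mul, abs_of_pos Real.pi_pos]
    nlinarith [Real.pi_pos]
  rw [abs_mul, abs_of_pos Real.pi_pos] at h
  have : 2 / Real.pi * (Real.pi * |z|) = 2 * |z| := by
    field_simp
  linarith

/-- Phase estimation with `M` phases rarely misses the eigenphase `θ` by more than four grid
points; here stated for the estimate of `sin θ`. -/
theorem sum_fejer_tail_le (M : ℕ) (hM : 0 < M) (θ : ℝ) (hθ : 0 ≤ Real.sin θ) (σ : ℤ)
    (hσ : σ = 1 ∨ σ = -1) :
    ∑ y ∈ (Finset.range M).filter
        (fun y : ℕ => 4 * Real.pi / M < |Real.sin (Real.pi * y / M) - Real.sin θ|),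
      ‖∑ k ∈ Finset.range M, Complex.exp (2 * k * ((θ - σ * (Real.pi * y / M) : ℝ)) * Complex.I)‖ ^ 2
      / M ^ 2 ≤ 1 / 6 := by
  have hM' : (0 : ℝ) < M := by exact_mod_cast hM
  set x : ℝ := M * θ / Real.pi with hx
  -- In grid units the eigenphase is `x`; `n y` is the representative of `σ y` modulo `M` closest to
  -- `x`. Passing to it changes sines only by a sign.
  let n : ℕ → ℤ := fun y => σ * y - M * round ((σ * y - x) / M)
  have hn (y : ℕ) : |(n y : ℝ) - x| ≤ M / 2 := by
    have h := abs_sub_round ((σ * y - x) / M : ℝ)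
    have : ((n y : ℝ) - x) = M * ((σ * y - x) / M - round ((σ * y - x) / M : ℝ)) := by
      simp only [n]; push_cast; field_simp; ring
    rw [this, abs_mul, abs_of_pos hM']
    nlinarith
  have hsinσ (y : ℕ) (hy : y < M) : |Real.sin (Real.pi * (σ * y) / M)| = Real.sin (Real.pi * y / M) := by
    have h0 : 0 ≤ Real.sin (Real.pi * y / M) := by
      apply Real.sin_nonneg_of_nonneg_of_le_pi (by positivity)
      rw [div_le_iff₀ hM']
      have : (y : ℝ) ≤ M := by exact_mod_cast hy.le
      nlinarith [Real.pi_pos]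
    rcases hσ with rfl | rfl
    · rw [← abs_of_nonneg h0]; norm_num
    · rw [show Real.pi * (((-1 : ℤ) : ℝ) * y) / M = -(Real.pi * y / M) by push_cast; ring,
        Real.sin_neg, abs_neg, abs_of_nonneg h0]
  have hper (y : ℕ) (w : ℝ) : |Real.sin (Real.pi * (n y - w) / M)| =
      |Real.sin (Real.pi * (σ * y - w) / M)| := by
    rw [show Real.pi * (n y - w) / M = Real.pi * (σ * y - w) / M -
      (round ((σ * y - x) / M : ℝ) : ℝ) * Real.pi by
        simp only [n]; push_cast; field_simp; ring, Real.sin_sub_int_mul_pi, abs_mul]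
    rcases neg_one_pow_eq_or ℝ (round ((σ * y - x) / M : ℝ)).natAbs with h | h <;> simp
  have herr (y : ℕ) (hy : y < M) : |Real.sin (Real.pi * y / M) - Real.sin θ| ≤
      Real.pi / M * |n y - x| := by
    have h1 := hper y 0
    rw [sub_zero, sub_zero, hsinσ y hy] at h1
    rw [← h1]
    have h2 : θ = Real.pi * x / M := by
      rw [hx]; field_simp
    calc |(|Real.sin (Real.pi * n y / M)|) - Real.sin θ|
        = |(|Real.sin (Real.pi * n y / M)|) - (|Real.sin θ|)| := by rw [abs_of_nonneg hθ]
      _ ≤ |Real.sin (Real.pi * n y / M) - Real.sin θ| := abs_abs_sub_abs_le _ _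
      _ ≤ |Real.pi * n y / M - θ| := by
          have := Real.lipschitzWith_sin.dist_le_mul (Real.pi * n y / M) θ
          simpa [Real.dist_eq] using this
      _ = Real.pi / M * |n y - x| := by
          rw [h2, ← abs_of_pos (by positivity : 0 < Real.pi / M), ← abs_mul]
          congr 1
          ring
  set S := (Finset.range M).filter
        (fun y : ℕ => 4 * Real.pi / M < |Real.sin (Real.pi * y / M) - Real.sin θ|) with hS
  have hfar : ∀ y ∈ S, 4 < |n y - x| := by
    intro y hy
    rw [hS, Finset.mem_filter, Finset.mem_range] at hy
    have h := hy.2.trans_le (herr y hy.1)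
    have : 4 * Real.pi / M = Real.pi / M * 4 := by ring
    rw [this] at h
    exact lt_of_mul_lt_mul_left h (by positivity)
  -- Since `n y ≡ σ y` modulo `M` and `y < M`, distinct outcomes have distinct representatives, so
  -- the tail is a sum over distinct integers.
  have hinj : Set.InjOn n S := by
    intro y hy z hz hyz
    have hy' : y < M := Finset.mem_range.1 (Finset.mem_filter.1 hy).1
    have hz' : z < M := Finset.mem_range.1 (Finset.mem_filter.1 hz).1
    simp only [n] at hyz
    have hdvd : (M : ℤ) ∣ σ * ((y : ℤ) - z) := by
      refine ⟨round ((σ * y - x) / M : ℝ) - round ((σ * z - x) / M : ℝ), ?_⟩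
      linear_combination hyz
    have hdvd' : (M : ℤ) ∣ (y : ℤ) - z := by
      rcases hσ with rfl | rfl
      · simpa using hdvd
      · rwa [neg_one_mul, dvd_neg] at hdvd
    have := Int.eq_zero_of_abs_lt_dvd hdvd' (by rw [abs_lt]; constructor <;> omega)
    omega
  have hbound : ∀ y ∈ S, ‖∑ k ∈ Finset.range M,
      Complex.exp (2 * k * ((θ - σ * (Real.pi * y / M) : ℝ)) * Complex.I)‖ ^ 2 / M ^ 2 ≤
      1 / 4 * (1 / ((n y : ℝ) - x) ^ 2) := by
    intro y hy
    have hz : |((n y : ℝ) - x) / M| ≤ 1 / 2 := by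
      rw [abs_div, abs_of_pos hM', div_le_iff₀ hM']
      linarith [hn y]
    have h1 := two_mul_abs_le_abs_sin hz
    rw [← mul_div_assoc, hper] at h1
    have h2 : |Real.sin (Real.pi * (σ * y - x) / M)| = |Real.sin (θ - σ * (Real.pi * y / M))| := by
      rw [← abs_neg, ← Real.sin_neg]
      congr 2
      rw [hx]; field_simp; ring
    rw [h2] at h1
    have h3 := norm_geom_sum_mul_abs_sin_le M (θ - σ * (Real.pi * y / M))
    set F := ‖∑ k ∈ Finset.range M,
      Complex.exp (2 * k * ((θ - σ * (Real.pi * y / M) : ℝ)) * Complex.I)‖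
    have hpos : 0 < |(n y : ℝ) - x| := by linarith [hfar y hy]
    have h4 : F * (2 * |((n y : ℝ) - x) / M|) ≤ 1 :=
      (mul_le_mul_of_nonneg_left h1 (norm_nonneg _)).trans h3
    rw [abs_div, abs_of_pos hM'] at h4
    have h5 : F / M ≤ 1 / (2 * |(n y : ℝ) - x|) := by
      rw [le_div_iff₀ (by positivity)]
      calc _ = F * (2 * (|(n y : ℝ) - x| / M)) := by ring
        _ ≤ 1 := h4
    calc F ^ 2 / M ^ 2 = (F / M) ^ 2 := by rw [div_pow]
      _ ≤ (1 / (2 * |(n y : ℝ) - x|)) ^ 2 := by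
          have : 0 ≤ F / M := div_nonneg (norm_nonneg _) hM'.le
          gcongr
      _ = 1 / 4 * (1 / ((n y : ℝ) - x) ^ 2) := by
          rw [div_pow, mul_pow, sq_abs]; field_simp; norm_num
  refine (Finset.sum_le_sum hbound).trans ?_
  rw [← Finset.mul_sum, ← Finset.sum_image (f := fun m : ℤ => 1 / ((m : ℝ) - x) ^ 2) hinj]
  -- Distance above `4` yields `1/4 · 2 / (4 - 1) = 1/6`.
  have := sum_inv_sq_le (S.image n) x 4 (by norm_num) (by
    intro m hm
    obtain ⟨y, hy, rfl⟩ := Finset.mem_image.1 hm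
    exact hfar y hy)
  linarith

end FejerTail

/-! ### The plane spanned by the good and the bad part of a state -/

section Reflections

variable {ι : Type} [Fintype ι] [DecidableEq ι]

/-- A phase gate on a single basis state, conjugated by a unitary. -/
theorem conj_diagonal_mulVec {A : Matrix ι ι ℂ} (hA : A * Aᴴ = 1) (i₀ : ι) (z₀ z₁ : ℂ)
    (v : ι → ℂ) : A *ᵥ (diagonal (fun x => if x = i₀ then z₀ else z₁) *ᵥ (Aᴴ *ᵥ v)) =
      fun j => z₁ * v j + (z₀ - z₁) * (∑ i, star (A i i₀) * v i) * A j i₀ := by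
  have h1 : diagonal (fun x => if x = i₀ then z₀ else z₁) *ᵥ (Aᴴ *ᵥ v) =
      z₁ • (Aᴴ *ᵥ v) + ((z₀ - z₁) * (Aᴴ *ᵥ v) i₀) • Pi.single i₀ 1 := by
    funext x
    rw [mulVec_diagonal]
    by_cases h : x = i₀
    · subst h
      simp
      ring
    · simp [h]
  rw [h1, mulVec_add, mulVec_smul, mulVec_mulVec, hA, one_mulVec, mulVec_smul, mulVec_single_one]
  funext j
  simp only [Pi.add_apply, Pi.smul_apply, smul_eq_mul, mulVec, dotProduct, conjTranspose_apply,
    col_apply]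

/-- The squared norm of the projection of a vector onto the basis states in `good`. -/
noncomputable def goodWeight (good : ι → Prop) [DecidablePred good] (ψ : ι → ℂ) : ℝ :=
  ∑ j with good j, ‖ψ j‖ ^ 2

omit [DecidableEq ι] in
theorem goodWeight_nonneg (good : ι → Prop) [DecidablePred good] (ψ : ι → ℂ) :
    0 ≤ goodWeight good ψ :=
  Finset.sum_nonneg fun _ _ => sq_nonneg _

omit [DecidableEq ι] in
theorem goodWeight_compl {good : ι → Prop} [DecidablePred good] {ψ : ι → ℂ}
    (hψ : ∑ j, ‖ψ j‖ ^ 2 = 1) : ∑ j with ¬ good j, ‖ψ j‖ ^ 2 = 1 - goodWeight good ψ := by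
  rw [goodWeight, eq_sub_iff_add_eq', Finset.sum_filter_add_sum_filter_not, hψ]

omit [DecidableEq ι] in
theorem goodWeight_le_one {good : ι → Prop} [DecidablePred good] {ψ : ι → ℂ}
    (hψ : ∑ j, ‖ψ j‖ ^ 2 = 1) : goodWeight good ψ ≤ 1 := by
  have := goodWeight_compl (good := good) hψ
  have : 0 ≤ ∑ j with ¬ good j, ‖ψ j‖ ^ 2 := Finset.sum_nonneg fun _ _ => sq_nonneg _
  linarith

omit [DecidableEq ι] in
theorem sum_star_mul_ite {good : ι → Prop} [DecidablePred good] {ψ : ι → ℂ}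
    (hψ : ∑ j, ‖ψ j‖ ^ 2 = 1) (x y : ℂ) :
    ∑ j, star (ψ j) * ((if good j then x else y) * ψ j) =
      x * goodWeight good ψ + y * (1 - goodWeight good ψ) := by
  have h2 := goodWeight_compl (good := good) hψ
  rw [← Complex.ofReal_one, ← Complex.ofReal_sub, ← h2, goodWeight,
    ← Finset.sum_filter_add_sum_filter_not Finset.univ good]
  push_cast
  rw [Finset.mul_sum, Finset.mul_sum]
  congr 1
  · refine Finset.sum_congr rfl fun j hj => ?_
    rw [if_pos (Finset.mem_filter.1 hj).2, Complex.star_def, ← Complex.conj_mul']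
    ring
  · refine Finset.sum_congr rfl fun j hj => ?_
    rw [if_neg (Finset.mem_filter.1 hj).2, Complex.star_def, ← Complex.conj_mul']
    ring

omit [DecidableEq ι] in
theorem sum_norm_sq_ite {good : ι → Prop} [DecidablePred good] {ψ : ι → ℂ}
    (hψ : ∑ j, ‖ψ j‖ ^ 2 = 1) (x y : ℂ) :
    ∑ j, ‖(if good j then x else y) * ψ j‖ ^ 2 =
      ‖x‖ ^ 2 * goodWeight good ψ + ‖y‖ ^ 2 * (1 - goodWeight good ψ) := by
  rw [← goodWeight_compl (good := good) hψ, goodWeight,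
    ← Finset.sum_filter_add_sum_filter_not Finset.univ good, Finset.mul_sum, Finset.mul_sum]
  congr 1
  · refine Finset.sum_congr rfl fun j hj => ?_
    rw [if_pos (Finset.mem_filter.1 hj).2, norm_mul, mul_pow]
  · refine Finset.sum_congr rfl fun j hj => ?_
    rw [if_neg (Finset.mem_filter.1 hj).2, norm_mul, mul_pow]

end Reflections

/-! ### A single run of amplitude estimation -/

section AmplitudeEstimation

variable {N : ℕ} {U : Matrix (WalkReg N) (WalkReg N) ℂ} {ι : Type} [Fintype ι] [DecidableEq ι]
  (A : Circuit N ι) (i₀ : ι) (good : ι → Prop) [DecidablePred good]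

/-- The norm `‖Π A |i₀⟩‖`. -/
noncomputable def goodNorm (U : Matrix (WalkReg N) (WalkReg N) ℂ) : ℝ :=
  √(goodWeight good fun j => A.eval U j i₀)

omit [DecidableEq ι] in
theorem goodNorm_nonneg : 0 ≤ goodNorm A i₀ good U := Real.sqrt_nonneg _

variable {A i₀ good}

theorem goodNorm_le_one (hU : Uᴴ = U) (hU2 : U * U = 1) : goodNorm A i₀ good U ≤ 1 :=
  Real.sqrt_le_one.2 (goodWeight_le_one (A.sum_norm_sq_eval hU hU2 i₀))

/-- The plane of the good and the bad part of `A |i₀⟩` is invariant. The numbers `x` and `y` are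
coordinates relative to these parts, which are not normalized and may vanish. -/
theorem groverOp_eval_mulVec (hU : Uᴴ = U) (hU2 : U * U = 1) (x y : ℂ) :
    ((groverOp A i₀ good).eval U *ᵥ fun j => (if good j then x else y) * A.eval U j i₀) =
      fun j => (if good j then
        (1 - 2 * (goodWeight good fun j => A.eval U j i₀)) * x +
          2 * (1 - (goodWeight good fun j => A.eval U j i₀)) * y
        else -2 * (goodWeight good fun j => A.eval U j i₀) * x +
          (1 - 2 * (goodWeight good fun j => A.eval U j i₀)) * y) * A.eval U j i₀ := by
  have hψ := A.sum_norm_sq_eval hU hU2 i₀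
  rw [groverOp, Circuit.eval_seq_mulVec, Circuit.eval_seq_mulVec, Circuit.eval_seq_mulVec,
    Circuit.eval_inv hU]
  have h1 : ((Circuit.gate (phaseOn good Real.pi) : Circuit N ι).eval U *ᵥ
      fun j => (if good j then x else y) * A.eval U j i₀) =
      fun j => (if good j then -x else y) * A.eval U j i₀ := by
    funext j
    simp only [Circuit.eval, phaseOn, mulVec_diagonal, Complex.exp_pi_mul_I]
    split_ifs <;> ring
  have h2 : (Circuit.gate (phaseOn (fun x => x ≠ i₀) Real.pi) : Circuit N ι).eval U =
      diagonal (fun x => if x = i₀ then 1 else -1) := by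
    simp only [Circuit.eval, phaseOn, Complex.exp_pi_mul_I]
    congr 1
    funext j
    by_cases h : j = i₀ <;> simp [h]
  rw [h1, h2, conj_diagonal_mulVec (A.eval_mul_conjTranspose_self hU hU2),
    sum_star_mul_ite (good := good) hψ]
  funext j
  split_ifs <;> ring

/-- The Grover operator rotates by `2 θ` in the plane of the good and the bad part. -/
theorem groverOp_pow (hU : Uᴴ = U) (hU2 : U * U = 1) {θ : ℝ}
    (hθs : Real.sin θ = goodNorm A i₀ good U)
    (k : ℕ) : ∃ x y : ℝ,
      (((groverOp A i₀ good).eval U) ^ k *ᵥ fun j => A.eval U j i₀) =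
        (fun j => (if good j then (x : ℂ) else (y : ℂ)) * A.eval U j i₀) ∧
      Real.sin θ * x = Real.sin ((2 * k + 1) * θ) ∧
      Real.cos θ * y = Real.cos ((2 * k + 1) * θ) := by
  have hs : (goodWeight good fun j => A.eval U j i₀) = Real.sin θ ^ 2 := by
    rw [hθs, goodNorm, Real.sq_sqrt (goodWeight_nonneg _ _)]
  induction k with
  | zero => exact ⟨1, 1, by simp, by simp, by simp⟩
  | succ k ih =>
    obtain ⟨x, y, h1, h2, h3⟩ := ih
    -- The rotation acts on `(sin θ · x, cos θ · y)`. Stating it for these products avoids dividing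
    -- by a vanishing sine or cosine.
    refine ⟨(1 - 2 * Real.sin θ ^ 2) * x + 2 * (1 - Real.sin θ ^ 2) * y,
      -2 * Real.sin θ ^ 2 * x + (1 - 2 * Real.sin θ ^ 2) * y, ?_, ?_, ?_⟩
    · rw [pow_succ', ← mulVec_mulVec, h1, groverOp_eval_mulVec hU hU2, hs]
      push_cast
      rfl
    · rw [show (2 * ((k + 1 : ℕ) : ℝ) + 1) * θ = (2 * k + 1) * θ + 2 * θ by push_cast; ring,
        Real.sin_add, ← h2, ← h3, Real.cos_two_mul, Real.sin_two_mul]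
      have := Real.sin_sq_add_cos_sq θ
      linear_combination (-2 * Real.sin θ * x - 2 * Real.sin θ * y) * this
    · rw [show (2 * ((k + 1 : ℕ) : ℝ) + 1) * θ = (2 * k + 1) * θ + 2 * θ by push_cast; ring,
        Real.cos_add, ← h2, ← h3, Real.cos_two_mul, Real.sin_two_mul]
      have := Real.sin_sq_add_cos_sq θ
      linear_combination (-2 * Real.cos θ * y) * this

theorem stdAddChar_eq_exp (m : ℕ) (a b : ZMod (m + 1)) :
    (ZMod.stdAddChar (a * b) : ℂ) =
      Complex.exp (2 * (a.val : ℂ) * ((Real.pi * b.val / (m + 1 : ℕ) : ℝ)) * Complex.I) := by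
  have h : a * b = ((a.val * b.val : ℕ) : ℤ) := by
    push_cast
    rw [ZMod.natCast_zmod_val, ZMod.natCast_zmod_val]
  rw [h, ZMod.stdAddChar_coe]
  congr 1
  push_cast
  ring

/-- The counter starts in the uniform superposition and controls the power of the Grover operator,
so the amplitude of outcome `y` is a discrete Fourier transform of `k ↦ Q ^ k ψ`. -/
theorem phaseEstimation_eval (m : ℕ) (j : ι) (y : ZMod (m + 1)) :
    (phaseEstimation A i₀ good m).eval U (j, y) (i₀, 0) =
      ∑ k : ZMod (m + 1), star (ZMod.stdAddChar (k * y) : ℂ) / (m + 1 : ℕ) *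
        (((groverOp A i₀ good).eval U) ^ k.val *ᵥ fun j => A.eval U j i₀) j := by
  have e1 : (phaseEstimation A i₀ good m).eval U (j, y) (i₀, 0) =
      ((phaseEstimation A i₀ good m).eval U *ᵥ Pi.single (i₀, 0) 1) (j, y) := by
    rw [mulVec_single_one]; rfl
  have hM : (√((m + 1 : ℕ) : ℝ) : ℂ) * (√((m + 1 : ℕ) : ℝ) : ℂ) = (m + 1 : ℕ) := by
    rw [← Complex.ofReal_mul, Real.mul_self_sqrt (Nat.cast_nonneg _)]
    simp
  rw [e1, phaseEstimation, Circuit.eval_seq_mulVec, Circuit.eval_right_mulVec]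
  rw [Circuit.eval]
  rw [mulVec, dotProduct]
  refine Finset.sum_congr rfl fun k _ => ?_
  have hF : ((fourier (m + 1))⁻¹).1 y k =
      star (ZMod.stdAddChar (k * y) : ℂ) / (√((m + 1 : ℕ) : ℝ) : ℂ) := by
    have : ((fourier (m + 1))⁻¹).1 y k = star ((fourier (m + 1)).1 k y) := rfl
    rw [this]
    simp only [fourier, of_apply]
    rw [star_div₀]
    congr 1
    exact Complex.conj_ofReal _
  have hk : min m k.val = k.val := min_eq_right (Nat.lt_succ_iff.1 (ZMod.val_lt k))
  rw [hF, Circuit.eval_iter_ctrl_mulVec, hk]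
  have : (fun i' => ((Circuit.seq (Circuit.right (Circuit.gate (fourier (m + 1)))) (Circuit.left A)
      ).eval U *ᵥ Pi.single (i₀, 0) 1) (i', k)) =
      (√((m + 1 : ℕ) : ℝ) : ℂ)⁻¹ • fun j => A.eval U j i₀ := by
    funext i'
    rw [Circuit.eval_seq_mulVec, Circuit.eval_left_mulVec]
    have : (fun i' => ((Circuit.right (Circuit.gate (fourier (m + 1)))).eval U *ᵥ
        Pi.single (i₀, 0) 1) (i', k)) =
        (√((m + 1 : ℕ) : ℝ) : ℂ)⁻¹ • (Pi.single i₀ 1 : ι → ℂ) := by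
      funext l
      rw [Circuit.eval_right_mulVec, mulVec, dotProduct, Finset.sum_eq_single 0]
      · by_cases hl : l = i₀
        · subst hl
          simp [Circuit.eval, fourier]
        · simp [hl]
      · intro b _ hb
        simp [hb]
      · simp
    rw [this, mulVec_smul, mulVec_single_one]
    rfl
  rw [this, mulVec_smul, Pi.smul_apply, smul_eq_mul, ← hM]
  field_simp

/-- The good and the bad part carry the transforms of `sin ((2k+1)θ)` and `cos ((2k+1)θ)`. By the
parallelogram law the sum of their squared norms is the mean of those for `exp (± i (2k+1)θ)`, that
is, of two Fejér kernels centred at `θ` and `-θ`. -/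
theorem sum_norm_sq_phaseEstimation (hU : Uᴴ = U) (hU2 : U * U = 1) {θ : ℝ}
    (hθs : Real.sin θ = goodNorm A i₀ good U) (m : ℕ) (y : ZMod (m + 1)) :
    ∑ j, ‖(phaseEstimation A i₀ good m).eval U (j, y) (i₀, 0)‖ ^ 2 =
      (‖∑ k ∈ Finset.range (m + 1), Complex.exp (2 * k *
          ((θ - (1 : ℤ) * (Real.pi * y.val / (m + 1 : ℕ)) : ℝ)) * Complex.I)‖ ^ 2
          / ((m + 1 : ℕ) : ℝ) ^ 2 +
        ‖∑ k ∈ Finset.range (m + 1), Complex.exp (2 * k *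
          ((θ - (-1 : ℤ) * (Real.pi * y.val / (m + 1 : ℕ)) : ℝ)) * Complex.I)‖ ^ 2
          / ((m + 1 : ℕ) : ℝ) ^ 2) / 2 := by
  have hψ := A.sum_norm_sq_eval hU hU2 i₀
  choose X Y hQ hX hY using groverOp_pow (A := A) (i₀ := i₀) (good := good) hU hU2 hθs
  have hs : (goodWeight good fun j => A.eval U j i₀) = Real.sin θ ^ 2 := by
    rw [hθs, goodNorm, Real.sq_sqrt (goodWeight_nonneg _ _)]
  set φ : ℝ := Real.pi * y.val / (m + 1 : ℕ) with hφ
  have h1 (j : ι) : (phaseEstimation A i₀ good m).eval U (j, y) (i₀, 0) =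
      (if good j then ∑ k ∈ Finset.range (m + 1), Complex.exp (-(2 * k * φ * Complex.I)) / (m + 1 : ℕ) * X k
        else ∑ k ∈ Finset.range (m + 1), Complex.exp (-(2 * k * φ * Complex.I)) / (m + 1 : ℕ) * Y k) *
        A.eval U j i₀ := by
    have h2 : (if good j then
        ∑ k ∈ Finset.range (m + 1), Complex.exp (-(2 * k * φ * Complex.I)) / (m + 1 : ℕ) * (X k : ℂ)
        else ∑ k ∈ Finset.range (m + 1), Complex.exp (-(2 * k * φ * Complex.I)) / (m + 1 : ℕ) * (Y k : ℂ)) =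
        ∑ k ∈ Finset.range (m + 1), Complex.exp (-(2 * k * φ * Complex.I)) / (m + 1 : ℕ) *
          (if good j then (X k : ℂ) else (Y k : ℂ)) := by
      split_ifs <;> rfl
    rw [phaseEstimation_eval, h2, Finset.sum_mul, ← Fin.sum_univ_eq_sum_range
      (fun k : ℕ => Complex.exp (-(2 * k * φ * Complex.I)) / (m + 1 : ℕ) *
          (if good j then (X k : ℂ) else (Y k : ℂ)) * A.eval U j i₀) (m + 1)]
    refine Finset.sum_congr rfl fun k _ => ?_
    rw [hQ, stdAddChar_eq_exp, Complex.star_def, ← Complex.exp_conj]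
    simp only [map_mul, Complex.conj_ofReal, Complex.conj_I, map_ofNat, map_natCast]
    rw [mul_neg]
    exact (mul_assoc _ _ _).symm
  have h0 : ∑ j, ‖(phaseEstimation A i₀ good m).eval U (j, y) (i₀, 0)‖ ^ 2 = _ :=
    (Finset.sum_congr rfl fun j _ => by rw [h1 j]).trans (sum_norm_sq_ite hψ _ _)
  refine h0.trans ?_
  rw [hs]
  set X' := ∑ k ∈ Finset.range (m + 1), Complex.exp (-(2 * k * φ * Complex.I)) / (m + 1 : ℕ) * X k
  set Y' := ∑ k ∈ Finset.range (m + 1), Complex.exp (-(2 * k * φ * Complex.I)) / (m + 1 : ℕ) * Y k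
  have hE (σ : ℝ) (hσ : σ ^ 2 = 1) : Real.cos θ * Y' + σ * Complex.I * (Real.sin θ * X') =
      Complex.exp (σ * θ * Complex.I) / (m + 1 : ℕ) * ∑ k ∈ Finset.range (m + 1),
        Complex.exp (2 * k * ((σ * θ - φ : ℝ)) * Complex.I) := by
    rw [Finset.mul_sum, Finset.mul_sum, Finset.mul_sum, Finset.mul_sum, ← Finset.sum_add_distrib]
    refine Finset.sum_congr rfl fun k _ => ?_
    have hXk : (Real.sin θ : ℂ) * X k = Complex.sin ((2 * k + 1) * θ) := by
      rw [← Complex.ofReal_mul, hX]; push_cast; rfl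
    have hYk : (Real.cos θ : ℂ) * Y k = Complex.cos ((2 * k + 1) * θ) := by
      rw [← Complex.ofReal_mul, hY]; push_cast; rfl
    have hexp : Complex.exp (σ * ((2 * k + 1) * θ) * Complex.I) =
        Complex.cos ((2 * k + 1) * θ) + σ * Complex.I * Complex.sin ((2 * k + 1) * θ) := by
      rw [Complex.exp_mul_I]
      rcases sq_eq_one_iff.1 hσ with rfl | rfl
      · simp; ring
      · simp; ring
    calc _ = Complex.exp (-(2 * k * φ * Complex.I)) / (m + 1 : ℕ) *
          (Real.cos θ * Y k + σ * Complex.I * (Real.sin θ * X k)) := by ring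
      _ = Complex.exp (-(2 * k * φ * Complex.I)) / (m + 1 : ℕ) *
          Complex.exp (σ * ((2 * k + 1) * θ) * Complex.I) := by rw [hXk, hYk, hexp]
      _ = _ := by
          rw [div_mul_eq_mul_div, div_mul_eq_mul_div, ← Complex.exp_add, ← Complex.exp_add]
          congr 2
          push_cast
          ring
  have hp := hE 1 (by norm_num)
  have hm := hE (-1) (by norm_num)
  -- Complex conjugation brings the kernel at `-θ` to the form with `σ = -1` used in the tail bound.
  have hconj : ‖∑ k ∈ Finset.range (m + 1), Complex.exp (2 * k * ((-1 * θ - φ : ℝ)) * Complex.I)‖ =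
      ‖∑ k ∈ Finset.range (m + 1), Complex.exp (2 * k * ((θ - (-1 : ℤ) * φ : ℝ)) * Complex.I)‖ := by
    rw [← Complex.norm_conj, map_sum]
    congr 1
    refine Finset.sum_congr rfl fun k _ => ?_
    rw [← Complex.exp_conj]
    simp only [map_mul, Complex.conj_ofReal, Complex.conj_I, map_ofNat, map_natCast]
    congr 1
    push_cast
    ring
  have hnorm (σ : ℝ) (Z : ℂ) : ‖Complex.exp (σ * θ * Complex.I) / (m + 1 : ℕ) * Z‖ ^ 2 =
      ‖Z‖ ^ 2 / ((m + 1 : ℕ) : ℝ) ^ 2 := by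
    rw [← Complex.ofReal_mul, norm_mul, norm_div, Complex.norm_exp_ofReal_mul_I,
      Complex.norm_natCast]
    ring
  have hpar := parallelogram_law_with_norm ℝ (Real.cos θ * Y' : ℂ)
    (Complex.I * (Real.sin θ * X'))
  rw [show (Real.cos θ * Y' + Complex.I * (Real.sin θ * X') : ℂ) =
      Real.cos θ * Y' + (1 : ℝ) * Complex.I * (Real.sin θ * X') by push_cast; ring, hp,
    show (Real.cos θ * Y' - Complex.I * (Real.sin θ * X') : ℂ) =
      Real.cos θ * Y' + (-1 : ℝ) * Complex.I * (Real.sin θ * X') by push_cast; ring, hm,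
    hnorm, hnorm, hconj] at hpar
  simp only [norm_mul, Complex.norm_I, one_mul, Complex.norm_real, mul_pow, Real.norm_eq_abs,
    sq_abs] at hpar
  have h5 : θ - φ = θ - (1 : ℤ) * φ := by push_cast; ring
  rw [h5] at hpar
  rw [hpar, ← Real.cos_sq']
  ring

/-- One run of amplitude estimation succeeds with probability at least `5 / 6`. -/
theorem prob_amplitudeEstimationOnce (hU : Uᴴ = U) (hU2 : U * U = 1) (m : ℕ) :
    5 / 6 ≤ (amplitudeEstimationOnce A i₀ good m).prob U
      fun x => |x - goodNorm A i₀ good U| ≤ 4 * Real.pi / (m + 1 : ℕ) := by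
  classical
  set a := goodNorm A i₀ good U with ha
  obtain ⟨θ, hθ⟩ : ∃ θ, Real.sin θ = a := ⟨Real.arcsin a, Real.sin_arcsin
    (by linarith [goodNorm_nonneg (U := U) A i₀ good]) (goodNorm_le_one hU hU2)⟩
  have hθ0 : 0 ≤ Real.sin θ := by rw [hθ]; exact goodNorm_nonneg A i₀ good
  have h := Program.prob_not hU hU2 (amplitudeEstimationOnce A i₀ good m)
    fun x => |x - a| ≤ 4 * Real.pi / (m + 1 : ℕ)
  suffices (amplitudeEstimationOnce A i₀ good m).expect U (fun x =>
      if |x - a| ≤ 4 * Real.pi / (m + 1 : ℕ) then 0 else 1) ≤ 1 / 6 by linarith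
  have hF := sum_fejer_tail_le (m + 1) (by omega) θ hθ0
  set F : ℤ → ℕ → ℝ := fun σ y => ‖∑ k ∈ Finset.range (m + 1), Complex.exp (2 * k *
          ((θ - σ * (Real.pi * y / (m + 1 : ℕ)) : ℝ)) * Complex.I)‖ ^ 2
          / ((m + 1 : ℕ) : ℝ) ^ 2 with hFd
  have hF' (σ : ℤ) (hσ : σ = 1 ∨ σ = -1) :
      ∑ y ∈ (Finset.range (m + 1)).filter (fun y : ℕ => 4 * Real.pi / (m + 1 : ℕ) <
        |Real.sin (Real.pi * y / (m + 1 : ℕ)) - Real.sin θ|), F σ y ≤ 1 / 6 := hF σ hσ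
  have h1 : (amplitudeEstimationOnce A i₀ good m).expect U (fun x =>
      if |x - a| ≤ 4 * Real.pi / (m + 1 : ℕ) then 0 else 1) =
      ∑ y ∈ (Finset.range (m + 1)).filter (fun y : ℕ => 4 * Real.pi / (m + 1 : ℕ) <
        |Real.sin (Real.pi * y / (m + 1 : ℕ)) - Real.sin θ|), (F 1 y + F (-1) y) / 2 := by
    rw [amplitudeEstimationOnce, Program.expect, Fintype.sum_prod_type_right, Finset.sum_filter,
      ← Fin.sum_univ_eq_sum_range (fun y : ℕ => if 4 * Real.pi / (m + 1 : ℕ) <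
        |Real.sin (Real.pi * y / (m + 1 : ℕ)) - Real.sin θ| then (F 1 y + F (-1) y) / 2 else 0)]
    refine Finset.sum_congr rfl fun y _ => ?_
    simp only [Program.expect]
    have hc (c : ℝ) : ∑ x, ‖(phaseEstimation A i₀ good m).eval U (x, y) (i₀, 0)‖ ^ 2 * c =
        (F 1 (ZMod.val y) + F (-1) (ZMod.val y)) / 2 * c := by
      rw [← Finset.sum_mul]
      exact congrArg (fun z : ℝ => z * c) (sum_norm_sq_phaseEstimation hU hU2 (hθ.trans ha) m y)
    refine (hc (if |Real.sin (Real.pi * (ZMod.val y : ℝ) / ((m : ℝ) + 1)) - a| ≤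
      4 * Real.pi / (m + 1 : ℕ) then 0 else 1)).trans ?_
    have hv : (ZMod.val (n := m + 1) y : ℕ) = (Fin.val (n := m + 1) y) := rfl
    rw [← hθ, hv]
    push_cast
    by_cases hy : |Real.sin (Real.pi * (Fin.val (n := m + 1) y) / ((m : ℝ) + 1)) - Real.sin θ| ≤
        4 * Real.pi / ((m : ℝ) + 1)
    · rw [if_pos hy, if_neg (not_lt.2 hy), mul_zero]
    · rw [if_neg hy, if_pos (not_le.1 hy), mul_one, hFd]
  rw [h1, ← Finset.sum_div, Finset.sum_add_distrib]
  linarith [hF' 1 (Or.inl rfl), hF' (-1) (Or.inr rfl)]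

/-- This holds with certainty, not only with high probability; the cost analysis needs it for `λ`
and `μ` on the failure events. -/
theorem outputs_amplitudeEstimationOnce (m : ℕ) :
    (amplitudeEstimationOnce A i₀ good m).Outputs fun x => 0 ≤ x ∧ x ≤ 1 := by
  intro x
  refine ⟨Real.sin_nonneg_of_nonneg_of_le_pi (by positivity) ?_, Real.sin_le_one _⟩
  rw [div_le_iff₀ (by positivity)]
  have : (x.2.val : ℝ) ≤ m + 1 := by exact_mod_cast (ZMod.val_lt x.2).le
  nlinarith [Real.pi_pos]

theorem steps_groverOp : (groverOp A i₀ good).steps = 2 * A.steps := by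
  simp only [groverOp, Circuit.steps, Circuit.steps_inv]
  ring

theorem steps_phaseEstimation (m : ℕ) :
    (phaseEstimation A i₀ good m).steps = (2 * m + 1) * A.steps := by
  rw [phaseEstimation, Circuit.steps, Circuit.steps_iter _ _ (2 * A.steps)]
  · simp only [Circuit.steps, Circuit.right, Circuit.left]
    ring
  · exact fun _ => steps_groverOp

theorem expectedSteps_amplitudeEstimationOnce (m : ℕ) :
    (amplitudeEstimationOnce A i₀ good m).expectedSteps U = (2 * m + 1) * A.steps := by
  simp only [amplitudeEstimationOnce, Program.expectedSteps, steps_phaseEstimation, mul_zero,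
    Finset.sum_const_zero, add_zero]
  push_cast
  ring

end AmplitudeEstimation

/-! ### The cluster rule for combining repeated estimates -/

section Cluster

/-- Two subsets with at least two thirds of the entries each cannot be disjoint. -/
theorem exists_of_two_thirds {l : List ℝ} (hl : l ≠ []) {p q : ℝ → Bool}
    (hp : 2 * l.length ≤ 3 * l.countP p) (hq : 2 * l.length ≤ 3 * l.countP q) :
    ∃ x ∈ l, p x ∧ q x := by
  by_contra! h
  have h1 : l.countP p + l.countP q ≤ l.length := by
    rw [List.length_eq_countP_add_countP p, add_le_add_iff_left]
    refine List.countP_mono_left fun x hx hqx => ?_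
    have := h x hx
    simp_all
  have := List.length_pos_iff.2 hl
  omega

/-- If two thirds of the estimates are within `w` of `a`, the smallest of these satisfies the search
criterion, so the search succeeds. Whatever it finds, its cluster contains an estimate within `w` of
`a`, and the cluster has width `2 w`. -/
theorem abs_clusterPoint_sub_le {l : List ℝ} (hl : l ≠ []) {a w : ℝ}
    (h : 2 * l.length ≤ 3 * l.countP fun y => decide (|y - a| ≤ w)) :
    |clusterPoint l (2 * w) - a| ≤ 3 * w := by
  set P : ℝ → Bool := fun x =>
    decide (2 * l.length ≤ 3 * l.countP fun y => decide (x ≤ y ∧ y ≤ x + 2 * w)) with hP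
  have hex : ∃ x ∈ l, P x := by
    obtain ⟨y, hy, hya, -⟩ := exists_of_two_thirds hl h h
    obtain ⟨x, hx, hmin⟩ := Finset.exists_min_image (l.toFinset.filter fun y => |y - a| ≤ w) id
      ⟨y, by simpa [hy] using hya⟩
    simp only [Finset.mem_filter, List.mem_toFinset, id, and_imp] at hx hmin
    refine ⟨x, hx.1, ?_⟩
    rw [hP, decide_eq_true_eq]
    refine h.trans (Nat.mul_le_mul_left 3 (List.countP_mono_left fun z hz hza => ?_))
    rw [decide_eq_true_eq] at hza ⊢
    have h1 := abs_le.1 hx.2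
    have h2 := abs_le.1 hza
    exact ⟨hmin z hz hza, by linarith⟩
  obtain ⟨x, hx⟩ : ∃ x, l.find? P = some x := by
    rw [← Option.isSome_iff_exists, List.find?_isSome]
    exact hex
  have hc : clusterPoint l (2 * w) = x := by
    rw [clusterPoint, hx]
    rfl
  have hPx := List.find?_some hx
  rw [hP, decide_eq_true_eq] at hPx
  obtain ⟨y, -, hy1, hy2⟩ := exists_of_two_thirds hl h hPx
  rw [decide_eq_true_eq] at hy1 hy2
  rw [hc, abs_le]
  have := abs_le.1 hy1
  constructor <;> linarith

theorem clusterPoint_mem (l : List ℝ) (w : ℝ) : clusterPoint l w = 0 ∨ clusterPoint l w ∈ l := by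
  rw [clusterPoint]
  rcases h : l.find? _ with _ | x
  · exact Or.inl rfl
  · exact Or.inr (List.mem_of_find?_eq_some h)

/-- Since `25/16 = (5/4) ^ 2`, the product for `g` good entries among `n` is `(5/4) ^ (2n - 3g)`,
which is at least `1` when fewer than two thirds are good. -/
theorem one_le_prod_weights {l : List ℝ} {p : ℝ → Prop} [DecidablePred p]
    (h : 3 * l.countP (fun x => decide (p x)) < 2 * l.length) :
    (1 : ℝ) ≤ (l.map fun x => if p x then 4 / 5 else 25 / 16).prod := by
  have key (l : List ℝ) : (l.map fun x => if p x then (4 / 5 : ℝ) else 25 / 16).prod *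
      (5 / 4) ^ (3 * l.countP fun x => decide (p x)) = (5 / 4) ^ (2 * l.length) := by
    induction l with
    | nil => simp
    | cons x l ih =>
      rw [List.map_cons, List.prod_cons, List.countP_cons, List.length_cons]
      by_cases hx : p x
      · simp only [hx, if_true, decide_true, mul_add, pow_add]
        rw [← ih]
        ring
      · simp only [hx, if_false, decide_false, mul_add, pow_add]
        rw [← ih]
        ring_nf
        simp
  have h1 := key l
  have h2 : ((5 : ℝ) / 4) ^ (3 * l.countP fun x => decide (p x)) ≤ (5 / 4) ^ (2 * l.length) :=
    pow_le_pow_right₀ (by norm_num) h.le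
  have h3 : (0 : ℝ) < (5 / 4) ^ (3 * l.countP fun x => decide (p x)) := by positivity
  rw [← h1] at h2
  exact le_of_mul_le_mul_right (by linarith) h3

end Cluster

/-! ### Amplitude estimation with high confidence -/

section AmplitudeEstimation

variable {N : ℕ} {U : Matrix (WalkReg N) (WalkReg N) ℂ} {ι : Type} [Fintype ι] [DecidableEq ι]
  {A : Circuit N ι} {i₀ : ι} {good : ι → Prop} [DecidablePred good]

/-- Markov's inequality for the product weights: one run has mean weight at most `4/5 · 5/6 + 25/16
· 1/6 ≤ 17/18 ≤ exp (-1/18)`, so `n ≥ 18 log (1/δ)` runs have mean product at most `δ`. Each run has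
accuracy `ε / 3`, and the cluster rule triples the error. -/
theorem prob_amplitudeEstimation (hU : Uᴴ = U) (hU2 : U * U = 1) {ε δ : ℝ} (hε : 0 < ε)
    (hδ : 0 < δ) : 1 - δ ≤ (amplitudeEstimation A i₀ good ε δ).prob U
      fun x => |x - goodNorm A i₀ good U| ≤ ε := by
  classical
  set a := goodNorm A i₀ good U
  set n := ⌈18 * Real.log (1 / δ)⌉₊ with hn
  set m := ⌈12 * Real.pi / ε⌉₊ with hm
  have hnle : 18 * Real.log (1 / δ) ≤ n := Nat.le_ceil _
  -- Zero runs are made only if `δ ≥ 1`, when there is nothing to show.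
  rcases Nat.eq_zero_or_pos n with h0 | hnpos
  · rw [h0, Nat.cast_zero, one_div, Real.log_inv] at hnle
    have : 0 ≤ Real.log δ := by linarith
    have : 1 ≤ δ := by
      by_contra! h
      linarith [Real.log_neg hδ h]
    linarith [Program.prob_nonneg (U := U) (fun x => |x - a| ≤ ε)
      (amplitudeEstimation A i₀ good ε δ)]
  have hm1 : 4 * Real.pi / (m + 1 : ℕ) ≤ ε / 3 := by
    have h1 : 12 * Real.pi / ε ≤ m := Nat.le_ceil _
    rw [div_le_iff₀ hε] at h1
    rw [div_le_div_iff₀ (by positivity) (by norm_num)]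
    push_cast
    nlinarith
  have honce : 5 / 6 ≤ (amplitudeEstimationOnce A i₀ good m).prob U fun x => |x - a| ≤ ε / 3 :=
    (prob_amplitudeEstimationOnce hU hU2 m).trans
      (Program.prob_mono (fun x hx => hx.trans hm1) _)
  set W : ℝ → ℝ := fun x => if |x - a| ≤ ε / 3 then 4 / 5 else 25 / 16 with hW
  have hexp : (amplitudeEstimationOnce A i₀ good m).expect U W ≤ 17 / 18 := by
    have h1 : W = fun x => 4 / 5 + 61 / 80 * (if |x - a| ≤ ε / 3 then 0 else 1) := by
      funext x
      rw [hW]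
      simp only
      split_ifs <;> norm_num
    rw [h1, Program.expect_add, Program.expect_const hU hU2, Program.expect_mul,
      Program.prob_not hU hU2]
    linarith
  have hW0 : 0 ≤ (amplitudeEstimationOnce A i₀ good m).expect U W := by
    rw [← Program.expect_const hU hU2 (amplitudeEstimationOnce A i₀ good m) 0]
    refine Program.expect_le_expect _ fun x => ?_
    rw [hW]
    simp only
    split_ifs <;> norm_num
  have hbad : ((amplitudeEstimationOnce A i₀ good m).times n).expect U
      (fun l => (l.map W).prod) ≤ δ := by
    rw [Program.expect_times_prod]
    calc _ ≤ (17 / 18 : ℝ) ^ n := by gcongr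
      _ ≤ Real.exp (-(1 / 18)) ^ n := by
          gcongr
          linarith [Real.add_one_le_exp (-(1 / 18) : ℝ)]
      _ = Real.exp (-(n / 18)) := by
          rw [← Real.exp_nat_mul]
          congr 1
          ring
      _ ≤ Real.exp (Real.log δ) := by
          rw [Real.exp_le_exp]
          rw [one_div, Real.log_inv] at hnle
          linarith
      _ = δ := Real.exp_log hδ
  rw [amplitudeEstimation, Program.prob_bind]
  have h2 : ((amplitudeEstimationOnce A i₀ good m).times n).expect U
      (fun l => 1 + (-1) * (l.map W).prod) ≤
      ((amplitudeEstimationOnce A i₀ good m).times n).expect U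
      fun l => (pure (clusterPoint l (2 * (ε / 3))) : Program N ℝ).prob U fun x => |x - a| ≤ ε := by
    refine Program.expect_mono (Program.times_length _ n) fun l hl => ?_
    have hl0 : l ≠ [] := by
      rintro rfl
      simp at hl
      omega
    rw [Program.prob_eq_expect, Program.expect_pure]
    have hpos : 0 ≤ (l.map W).prod := by
      refine List.prod_nonneg fun x hx => ?_
      obtain ⟨y, -, rfl⟩ := List.mem_map.1 hx
      rw [hW]
      simp only
      split_ifs <;> norm_num
    by_cases h : 2 * l.length ≤ 3 * l.countP fun y => decide (|y - a| ≤ ε / 3)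
    · have := abs_clusterPoint_sub_le hl0 h
      rw [mul_div_cancel₀ _ (by norm_num : (3 : ℝ) ≠ 0)] at this
      rw [if_pos this]
      linarith
    · have h1 := one_le_prod_weights (p := fun x => |x - a| ≤ ε / 3) (not_le.1 h)
      have : (0 : ℝ) ≤ if |clusterPoint l (2 * (ε / 3)) - a| ≤ ε then 1 else 0 := by
        split_ifs <;> norm_num
      refine le_trans ?_ this
      have : (1 : ℝ) ≤ (l.map W).prod := h1
      linarith
  rw [Program.expect_add, Program.expect_const hU hU2, Program.expect_mul] at h2
  linarith

theorem outputs_amplitudeEstimation (ε δ : ℝ) :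
    (amplitudeEstimation A i₀ good ε δ).Outputs fun x => 0 ≤ x ∧ x ≤ 1 := by
  refine ((outputs_amplitudeEstimationOnce _).times _).bind fun l hl => ?_
  change 0 ≤ clusterPoint l _ ∧ clusterPoint l _ ≤ 1
  rcases clusterPoint_mem l (2 * (ε / 3)) with h | h
  · rw [h]; norm_num
  · exact hl _ h

theorem expectedSteps_amplitudeEstimation (hU : Uᴴ = U) (hU2 : U * U = 1) (ε δ : ℝ) :
    (amplitudeEstimation A i₀ good ε δ).expectedSteps U =
      ⌈18 * Real.log (1 / δ)⌉₊ * ((2 * ⌈12 * Real.pi / ε⌉₊ + 1) * A.steps) := by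
  rw [amplitudeEstimation, Program.expectedSteps_bind, Program.expectedSteps_times hU hU2,
    expectedSteps_amplitudeEstimationOnce]
  simp only [Program.expectedSteps_pure]
  rw [Program.expect_const hU hU2, add_zero]

end AmplitudeEstimation

/-! ### The additive and the multiplicative 2-norm estimator -/

section NormEstimators

variable {N : ℕ} {G : SimpleGraph (Fin N)} [DecidableRel G.Adj] {d : ℕ}
  {coin : Fin N → Matrix (Option (Fin N)) (Option (Fin N)) ℂ}

theorem sum_filter_isFlat {M : Type*} [AddCommMonoid M] {τ : ℕ} (f : FFReg N τ → M) :
    ∑ x with IsFlat x, f x = ∑ j, f ((j, none), 0) := by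
  rw [Finset.sum_filter, Fintype.sum_prod_type, Fintype.sum_prod_type]
  refine Finset.sum_congr rfl fun j _ => ?_
  rw [Fintype.sum_option, Finset.sum_eq_single 0, Finset.sum_eq_zero, add_zero, if_pos ⟨rfl, rfl⟩]
  · intro k _
    exact Finset.sum_eq_zero fun l _ => if_neg fun h => by simp [IsFlat] at h
  · intro l _ hl
    exact if_neg fun h => hl h.2
  · simp

theorem goodWeight_isFlat {τ : ℕ} (ψ : FFReg N τ → ℂ) :
    goodWeight IsFlat ψ = ∑ j, ‖ψ ((j, none), 0)‖ ^ 2 :=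
  sum_filter_isFlat _

theorem goodNorm_fastForward (hd : 1 ≤ d) (hdeg : ∀ i, G.degree i ≤ d)
    (h : IsCoin (lazyWalk G d) coin) {t τ : ℕ}
    (hS : 0 < ∑ l ∈ Finset.range (τ + 1), chebCoeff t l) (u : Fin N) :
    goodNorm (fastForward N t τ) ((u, none), 0) IsFlat (walkOp G coin) =
      ‖ffDist G d t τ u‖ := by
  rw [goodNorm, goodWeight_isFlat, EuclideanSpace.norm_eq]
  congr 1
  refine Finset.sum_congr rfl fun j _ => ?_
  rw [fastForward_eval hd hdeg h hS, Complex.norm_real]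

theorem one_le_sqrt_natCast (u : Fin N) : 1 ≤ √(N : ℝ) := by
  rw [Real.one_le_sqrt]
  exact_mod_cast u.pos

/-- The 2-norm estimator is correct. -/
theorem prob_normEstimator (hd : 1 ≤ d) (hdeg : ∀ i, G.degree i ≤ d)
    (h : IsCoin (lazyWalk G d) coin) (u : Fin N) (t : ℕ) {ε δ : ℝ} (hε : 0 < ε) (hε1 : ε ≤ 1)
    (hδ : 0 < δ) : 1 - δ ≤ (normEstimator N u t ε δ).prob (walkOp G coin)
      fun x => |x - ‖walkDist G d t u‖| ≤ ε := by
  have hN := one_le_sqrt_natCast u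
  have hx : 2 < 8 * √N / ε := by
    rw [lt_div_iff₀ hε]
    linarith
  obtain ⟨hS, herr⟩ := norm_ffDist_sub_le hd hdeg h (t := t) u hx (Nat.le_ceil _)
  rw [normEstimator]
  refine (prob_amplitudeEstimation (conjTranspose_walkOp G) (walkOp_mul_self h)
    (half_pos hε) hδ).trans (Program.prob_mono (fun x hx => ?_) _)
  rw [goodNorm_fastForward hd hdeg h hS] at hx
  -- Half of the error is spent on truncation, half on amplitude estimation.
  have h1 : 4 / (8 * √N / ε) ≤ ε / 2 := by
    rw [div_div_eq_mul_div, div_le_iff₀ (by positivity)]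
    nlinarith
  have h2 := (abs_norm_sub_norm_le _ _).trans (herr.trans h1)
  have h3 := abs_sub_le x ‖ffDist G d t ⌈√(2 * t * Real.log (8 * √N / ε))⌉₊ u‖
    ‖walkDist G d t u‖
  linarith

/-- The loop of the multiplicative estimator is correct if it may run long enough. -/
theorem prob_multNormLoop (hd : 1 ≤ d) (hdeg : ∀ i, G.degree i ≤ d)
    (h : IsCoin (lazyWalk G d) coin) (u : Fin N) (t : ℕ) {ε δ : ℝ} (hε : 0 < ε) (hε1 : ε ≤ 1)
    (hδ : 0 < δ) (n k : ℕ) (hnk : 1 ≤ ‖walkDist G d t u‖ * 2 ^ (k + n)) :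
    1 - (n + 1) * δ ≤ (multNormLoop N u t ε δ n k).prob (walkOp G coin)
      fun x => |x - ‖walkDist G d t u‖| ≤ ε / 4 * ‖walkDist G d t u‖ := by
  have hround (k : ℕ) := prob_normEstimator hd hdeg h u t (ε := ε / 2 ^ (k + 2)) (by positivity)
    ((div_le_self hε.le (one_le_pow₀ one_le_two)).trans hε1) hδ
  set a := ‖walkDist G d t u‖
  induction n generalizing k with
  | zero =>
    rw [multNormLoop]
    simp only [Nat.cast_zero, zero_add, one_mul]
    refine (hround k).trans (Program.prob_mono (fun x hx => hx.trans ?_) _)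
    rw [pow_add, div_le_iff₀ (by positivity)]
    rw [add_zero] at hnk
    nlinarith
  | succ n ih =>
    rw [multNormLoop]
    have := Program.prob_bind_ge (conjTranspose_walkOp G (coin := coin)) (walkOp_mul_self h)
      (E := fun x => |x - a| ≤ ε / 4 * a)
      (f := fun α => if (1 + ε) / 2 ^ k ≤ α then return α else multNormLoop N u t ε δ n (k + 1))
      (b := (n + 1) * δ) (by positivity) (hround k) ?_
    · refine le_trans (le_of_eq ?_) this
      push_cast
      ring
    · intro x hx
      split_ifs with hlarge
      · rw [Program.prob_eq_expect, Program.expect_pure, if_pos]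
        · have : 0 ≤ (n + 1) * δ := by positivity
          linarith
        · refine hx.trans ?_
          rw [div_le_iff₀ (by positivity)] at hlarge
          rw [pow_add, le_div_iff₀ (by positivity)] at hx
          have h2 : (0 : ℝ) < 2 ^ k := by positivity
          have h3 := le_abs_self (x - a)
          have h4 : 1 ≤ a * 2 ^ k := by nlinarith
          rw [pow_add, div_le_iff₀ (by positivity)]
          nlinarith
      · exact ih (k + 1) (by rwa [show k + 1 + n = k + (n + 1) by ring])

/-- The number of rounds of the multiplicative estimator. -/
theorem rounds_spec (hN : 2 ≤ N) : 1 ≤ ⌈Real.logb 2 N / 2⌉₊ ∧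
    √(N : ℝ) ≤ 2 ^ ⌈Real.logb 2 N / 2⌉₊ ∧ (2 : ℝ) ^ ⌈Real.logb 2 N / 2⌉₊ ≤ 2 * √N := by
  have hN' : (2 : ℝ) ≤ N := by exact_mod_cast hN
  have hpos : 0 < Real.logb 2 N := Real.logb_pos (by norm_num) (by linarith)
  have hs : √(N : ℝ) = 2 ^ (Real.logb 2 N / 2) := by
    rw [Real.sqrt_eq_rpow, div_eq_mul_one_div (Real.logb 2 N), Real.rpow_mul (by norm_num),
      Real.rpow_logb (by norm_num) (by norm_num) (by linarith)]
  refine ⟨Nat.one_le_ceil_iff.2 (by positivity), ?_, ?_⟩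
  · rw [hs, ← Real.rpow_natCast]
    exact Real.rpow_le_rpow_of_exponent_le one_le_two (Nat.le_ceil _)
  · have h1 : (2 : ℝ) * √N = 2 ^ (Real.logb 2 N / 2 + 1) := by
      rw [hs, Real.rpow_add (by norm_num), Real.rpow_one, mul_comm]
    rw [h1, ← Real.rpow_natCast]
    exact Real.rpow_le_rpow_of_exponent_le one_le_two (Nat.ceil_lt_add_one (by positivity)).le

/-- The last round satisfies `2 ^ T ≥ √N ≥ 1 / a`, and the `T` rounds share the failure probability.
The relative error achieved is a quarter of the nominal one. -/
theorem prob_multNormEstimator (hN : 2 ≤ N) (hd : 1 ≤ d) (hdeg : ∀ i, G.degree i ≤ d)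
    (h : IsCoin (lazyWalk G d) coin) (u : Fin N) (t : ℕ) {ε δ : ℝ} (hε : 0 < ε) (hε1 : ε ≤ 1)
    (hδ : 0 < δ) : 1 - δ ≤ (multNormEstimator N u t ε δ).prob (walkOp G coin)
      fun x => |x - ‖walkDist G d t u‖| ≤ ε / 4 * ‖walkDist G d t u‖ := by
  obtain ⟨hT, hT2, -⟩ := rounds_spec hN
  rw [multNormEstimator]
  set T := ⌈Real.logb 2 N / 2⌉₊
  have hT' : (0 : ℝ) < T := by exact_mod_cast hT
  have hs := one_le_sqrt_natCast u
  have := prob_multNormLoop hd hdeg h u t hε hε1 (div_pos hδ hT') (T - 1) 1 ?_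
  · refine le_trans (le_of_eq ?_) this
    rw [Nat.cast_sub hT]
    field_simp
    ring
  · rw [Nat.add_sub_cancel' hT]
    have h1 := one_div_sqrt_le_norm_walkDist (G := G) (d := d) t u
    rw [div_le_iff₀ (by linarith)] at h1
    exact h1.trans (mul_le_mul_of_nonneg_left hT2 (norm_nonneg _))

theorem outputs_normEstimator (u : Fin N) (t : ℕ) (ε δ : ℝ) :
    (normEstimator N u t ε δ).Outputs fun x => 0 ≤ x ∧ x ≤ 1 :=
  outputs_amplitudeEstimation _ _

theorem outputs_multNormLoop (u : Fin N) (t : ℕ) (ε δ : ℝ) (n k : ℕ) :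
    (multNormLoop N u t ε δ n k).Outputs fun x => 0 ≤ x ∧ x ≤ 1 := by
  induction n generalizing k with
  | zero => exact outputs_normEstimator _ _ _ _
  | succ n ih =>
    refine (outputs_normEstimator _ _ _ _).bind fun x hx => ?_
    split_ifs
    · exact hx
    · exact ih _

theorem outputs_multNormEstimator (u : Fin N) (t : ℕ) (ε δ : ℝ) :
    (multNormEstimator N u t ε δ).Outputs fun x => 0 ≤ x ∧ x ≤ 1 :=
  outputs_multNormLoop _ _ _ _ _ _

theorem expectedSteps_normEstimator (h : IsCoin (lazyWalk G d) coin) (u : Fin N) (t : ℕ)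
    (ε δ : ℝ) : (normEstimator N u t ε δ).expectedSteps (walkOp G coin) =
      ⌈18 * Real.log (1 / δ)⌉₊ * ((2 * ⌈12 * Real.pi / (ε / 2)⌉₊ + 1) *
        ⌈√(2 * t * Real.log (8 * √N / ε))⌉₊) := by
  rw [normEstimator, expectedSteps_amplitudeEstimation (conjTranspose_walkOp G)
    (walkOp_mul_self h), steps_fastForward]

/-- Worst case without early stopping: the costs of the rounds double, and the bound is their
geometric sum. -/
theorem expectedSteps_multNormLoop_le (h : IsCoin (lazyWalk G d) coin) (u : Fin N) (t : ℕ)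
    (ε δ : ℝ) {B : ℝ} {K : ℕ}
    (hB : ∀ j ≤ K, (normEstimator N u t (ε / 2 ^ (j + 2)) δ).expectedSteps (walkOp G coin) ≤
      B * 2 ^ j) (n k : ℕ) (hnk : k + n ≤ K) :
    (multNormLoop N u t ε δ n k).expectedSteps (walkOp G coin) ≤ B * (2 ^ (k + n + 1) - 2 ^ k) := by
  induction n generalizing k with
  | zero =>
    rw [multNormLoop]
    refine (hB k (by omega)).trans (le_of_eq ?_)
    rw [add_zero, pow_succ]
    ring
  | succ n ih =>
    rw [multNormLoop, Program.expectedSteps_bind]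
    have h1 := ih (k + 1) (by omega)
    have h2 : ((normEstimator N u t (ε / 2 ^ (k + 2)) δ).expect (walkOp G coin) fun α =>
        Program.expectedSteps (walkOp G coin) (if (1 + ε) / 2 ^ k ≤ α then return α
          else multNormLoop N u t ε δ n (k + 1))) ≤ B * (2 ^ (k + 1 + n + 1) - 2 ^ (k + 1)) := by
      rw [← Program.expect_const (conjTranspose_walkOp G (coin := coin)) (walkOp_mul_self h)
        (normEstimator N u t (ε / 2 ^ (k + 2)) δ) (B * _)]
      refine Program.expect_le_expect _ fun x => ?_
      split_ifs
      · rw [Program.expectedSteps_pure]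
        exact (Program.expectedSteps_nonneg _).trans h1
      · exact h1
    have h3 := hB k (by omega)
    have e1 : (2 : ℝ) ^ (k + (n + 1) + 1) = 2 ^ (k + 1 + n + 1) := by congr 1; ring
    have e2 : (2 : ℝ) ^ (k + 1) = 2 * 2 ^ k := by ring
    rw [e1]
    rw [e2] at h2
    linarith

/-- A successful round `k` stops as soon as `2 ^ k a ≥ 1 + 5ε/4`, in particular when `2 ^ (k+1) a ≥
9/2`. Up to then the geometric sum is of order `B / a`; continuing beyond this round has probability
at most `δ` and is charged the worst case. -/
theorem expectedSteps_multNormLoop_le_of_norm (hd : 1 ≤ d) (hdeg : ∀ i, G.degree i ≤ d)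
    (h : IsCoin (lazyWalk G d) coin) (u : Fin N) (t : ℕ) {ε δ : ℝ} (hε : 0 < ε) (hε1 : ε ≤ 1)
    (hδ : 0 < δ) {B : ℝ} (hB0 : 0 ≤ B) {K : ℕ}
    (hB : ∀ j ≤ K, (normEstimator N u t (ε / 2 ^ (j + 2)) δ).expectedSteps (walkOp G coin) ≤
      B * 2 ^ j) (n k : ℕ) (hnk : k + n ≤ K) (hk : 2 ^ k * ‖walkDist G d t u‖ ≤ 9 / 2)
    (ha : 0 < ‖walkDist G d t u‖) :
    (multNormLoop N u t ε δ n k).expectedSteps (walkOp G coin) ≤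
      B * (9 / ‖walkDist G d t u‖ - 2 ^ k) + δ * (B * 2 ^ (k + n + 1)) := by
  have hround (k : ℕ) := prob_normEstimator hd hdeg h u t (ε := ε / 2 ^ (k + 2)) (by positivity)
    ((div_le_self hε.le (one_le_pow₀ one_le_two)).trans hε1) hδ
  set a := ‖walkDist G d t u‖
  have hka {k : ℕ} (hk : 2 ^ k * a ≤ 9 / 2) : B * 2 ^ k ≤ B * (9 / a - 2 ^ k) := by
    refine mul_le_mul_of_nonneg_left ?_ hB0
    rw [le_sub_iff_add_le, le_div_iff₀ ha]
    linarith
  induction n generalizing k with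
  | zero =>
    rw [multNormLoop]
    have h1 := (hB k (by omega)).trans (hka hk)
    have : 0 ≤ δ * (B * 2 ^ (k + 0 + 1)) := by positivity
    linarith
  | succ n ih =>
    rw [multNormLoop, Program.expectedSteps_bind]
    have h3 := hB k (by omega)
    have e1 : (2 : ℝ) ^ (k + (n + 1) + 1) = 2 ^ (k + 1 + n + 1) := by congr 1; ring
    have e2 : (2 : ℝ) ^ (k + 1) = 2 * 2 ^ k := by ring
    rw [e1]
    rcases le_total (2 ^ (k + 1) * a) (9 / 2) with hk1 | hk1
    · have h1 := ih (k + 1) (by omega) hk1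
      have h2 : ((normEstimator N u t (ε / 2 ^ (k + 2)) δ).expect (walkOp G coin) fun α =>
          Program.expectedSteps (walkOp G coin) (if (1 + ε) / 2 ^ k ≤ α then return α
            else multNormLoop N u t ε δ n (k + 1))) ≤
            B * (9 / a - 2 ^ (k + 1)) + δ * (B * 2 ^ (k + 1 + n + 1)) := by
        rw [← Program.expect_const (conjTranspose_walkOp G (coin := coin)) (walkOp_mul_self h)
          (normEstimator N u t (ε / 2 ^ (k + 2)) δ) (B * _ + _)]
        refine Program.expect_le_expect _ fun x => ?_
        split_ifs
        · rw [Program.expectedSteps_pure]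
          exact (Program.expectedSteps_nonneg _).trans h1
        · exact h1
      rw [e2] at h2
      linarith
    · have h1 := expectedSteps_multNormLoop_le h u t ε δ hB n (k + 1) (by omega)
      have h2 := Program.expect_le_of_prob (conjTranspose_walkOp G (coin := coin))
        (walkOp_mul_self h) (Program.outputs_true _) (hround k) (a := 0)
        (b := B * 2 ^ (k + 1 + n + 1)) (g := fun α =>
          Program.expectedSteps (walkOp G coin) (if (1 + ε) / 2 ^ k ≤ α then return α
            else multNormLoop N u t ε δ n (k + 1))) le_rfl (by positivity) ?_ ?_
      · have := hka hk
        linarith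
      · intro x _ hx
        rw [if_pos, Program.expectedSteps_pure]
        rw [pow_add, le_div_iff₀ (by positivity)] at hx
        rw [div_le_iff₀ (by positivity)]
        have h2 : (0 : ℝ) < 2 ^ k := by positivity
        have h4 := neg_abs_le (x - a)
        have h5 : -ε / 4 ≤ (x - a) * 2 ^ k := by nlinarith
        rw [e2] at hk1
        nlinarith
      · intro x _
        split_ifs
        · rw [Program.expectedSteps_pure]
          positivity
        · refine h1.trans ?_
          have : 0 ≤ B * 2 ^ (k + 1) := by positivity
          linarith

/-- Rounding costs a factor and no summand: the cost bound is proportional to `√t` and must vanish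
for `t = 0`. -/
theorem natCeil_sqrt_le (t : ℕ) {x : ℝ} (hx : 1 / 2 ≤ x) :
    (⌈√(2 * t * x)⌉₊ : ℝ) ≤ 2 * √(2 * t * x) := by
  rcases Nat.eq_zero_or_pos t with rfl | ht
  · simp
  · have ht' : (1 : ℝ) ≤ t := by exact_mod_cast ht
    have h1 : 1 ≤ √(2 * t * x) := by
      rw [Real.one_le_sqrt]
      nlinarith
    have := (Nat.ceil_lt_add_one (Real.sqrt_nonneg (2 * t * x))).le
    linarith

/-- The number of phases grows like `2 ^ j`. The walk length depends on `j` only through a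
logarithm, which is made uniform in `j` by `2 ^ j ≤ 2 √N`. -/
theorem expectedSteps_normEstimator_le (hN : 2 ≤ N) (h : IsCoin (lazyWalk G d) coin)
    (u : Fin N) (t : ℕ) {ε : ℝ} (δ : ℝ) (hε : 0 < ε) (hε1 : ε ≤ 1) (j : ℕ)
    (hj : j ≤ ⌈Real.logb 2 N / 2⌉₊) :
    (normEstimator N u t (ε / 2 ^ (j + 2)) δ).expectedSteps (walkOp G coin) ≤
      (⌈18 * Real.log (1 / δ)⌉₊ * (1220 / ε * √(2 * t * Real.log (64 * N / ε)))) * 2 ^ j := by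
  obtain ⟨-, -, hT⟩ := rounds_spec hN
  have hs := one_le_sqrt_natCast u
  have h2j : (2 : ℝ) ^ j ≤ 2 * √N := (pow_le_pow_right₀ one_le_two hj).trans hT
  have hj1 : (1 : ℝ) ≤ 2 ^ j := one_le_pow₀ one_le_two
  have hNN : √(N : ℝ) * √N = N := Real.mul_self_sqrt (Nat.cast_nonneg N)
  rw [expectedSteps_normEstimator h]
  have h1 : (2 * ⌈12 * Real.pi / (ε / 2 ^ (j + 2) / 2)⌉₊ + 1 : ℝ) ≤ 610 / ε * 2 ^ j := by
    have e : 12 * Real.pi / (ε / 2 ^ (j + 2) / 2) = 96 * Real.pi * 2 ^ j / ε := by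
      rw [pow_add]; field_simp; ring
    rw [e]
    have h3 := (Nat.ceil_lt_add_one (by positivity : 0 ≤ 96 * Real.pi * 2 ^ j / ε)).le
    have h4 : 96 * Real.pi * 2 ^ j / ε ≤ 303 * (2 ^ j / ε) := by
      rw [mul_div_assoc]
      have : 96 * Real.pi ≤ 303 := by linarith [Real.pi_lt_d4]
      gcongr
    have h5 : 1 ≤ 2 ^ j / ε := by
      rw [le_div_iff₀ hε]; linarith
    calc _ ≤ 610 * (2 ^ j / ε) := by linarith
      _ = _ := by ring
  have h2 : (⌈√(2 * t * Real.log (8 * √N / (ε / 2 ^ (j + 2))))⌉₊ : ℝ) ≤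
      2 * √(2 * t * Real.log (64 * N / ε)) := by
    have e : 8 * √N / (ε / 2 ^ (j + 2)) = 32 * 2 ^ j * √N / ε := by
      rw [pow_add]; field_simp; ring
    have h3 : 32 * 2 ^ j * √N / ε ≤ 64 * N / ε := by
      refine div_le_div_of_nonneg_right ?_ hε.le
      nlinarith
    have h4 : 2 ≤ 32 * 2 ^ j * √N / ε := by
      rw [le_div_iff₀ hε]
      nlinarith
    have h5 : 1 / 2 ≤ Real.log (32 * 2 ^ j * √N / ε) := by
      have := Real.log_le_log (by norm_num) h4
      linarith [Real.log_two_gt_d9]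
    rw [e]
    refine (natCeil_sqrt_le t h5).trans ?_
    gcongr
  calc _ ≤ (⌈18 * Real.log (1 / δ)⌉₊ : ℝ) * ((610 / ε * 2 ^ j) *
        (2 * √(2 * t * Real.log (64 * N / ε)))) := by gcongr
    _ = _ := by ring

/-- Expected cost of the multiplicative estimator. -/
theorem expectedSteps_multNormEstimator_le (hN : 2 ≤ N) (hd : 1 ≤ d)
    (hdeg : ∀ i, G.degree i ≤ d) (h : IsCoin (lazyWalk G d) coin) (u : Fin N) (t : ℕ) {ε δ : ℝ}
    (hε : 0 < ε) (hε1 : ε ≤ 1) (hδ : 0 < δ) (hδN : δ * (4 * √N) ≤ 1) :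
    (multNormEstimator N u t ε δ).expectedSteps (walkOp G coin) ≤
      ⌈18 * Real.log (1 / (δ / ⌈Real.logb 2 N / 2⌉₊))⌉₊ *
        (1220 / ε * √(2 * t * Real.log (64 * N / ε))) * (10 / ‖walkDist G d t u‖) := by
  obtain ⟨hT1, -, hT⟩ := rounds_spec hN
  have hs := one_le_sqrt_natCast u
  have ha1 := norm_walkDist_le_one hd hdeg t u
  have ha : 0 < ‖walkDist G d t u‖ :=
    (by positivity : 0 < 1 / √(N : ℝ)).trans_le (one_div_sqrt_le_norm_walkDist t u)
  have hT' : (1 : ℝ) ≤ ⌈Real.logb 2 N / 2⌉₊ := by exact_mod_cast hT1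
  have hB := expectedSteps_normEstimator_le hN h u t (δ / ⌈Real.logb 2 N / 2⌉₊) hε hε1
  rw [multNormEstimator]
  set T := ⌈Real.logb 2 N / 2⌉₊
  set B := ⌈18 * Real.log (1 / (δ / T))⌉₊ * (1220 / ε * √(2 * t * Real.log (64 * N / ε)))
  have hB0 : 0 ≤ B := by positivity
  refine (expectedSteps_multNormLoop_le_of_norm hd hdeg h u t hε hε1 (by positivity) hB0 hB (T - 1)
    1 (by omega) (by linarith) ha).trans ?_
  rw [Nat.add_sub_cancel' hT1, pow_one, pow_succ]
  -- The worst case costs at most `4 √N B`, and `hδN` makes its contribution smaller than a single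
  -- `B`.
  have h1 : δ / T * (B * (2 ^ T * 2)) ≤ B * 1 := by
    calc δ / T * (B * (2 ^ T * 2)) ≤ δ * (B * (2 * √N * 2)) := by
          gcongr
          exact div_le_self hδ.le hT'
      _ = B * (δ * (4 * √N)) := by ring
      _ ≤ B * 1 := by gcongr
  have h2 : 9 / ‖walkDist G d t u‖ - 2 + 1 ≤ 10 / ‖walkDist G d t u‖ := by
    have : 10 / ‖walkDist G d t u‖ = 9 / ‖walkDist G d t u‖ + 1 / ‖walkDist G d t u‖ := by ring
    rw [this]
    have : 0 < 1 / ‖walkDist G d t u‖ := by positivity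
    linarith
  calc _ ≤ B * (9 / ‖walkDist G d t u‖ - 2) + B * 1 := by gcongr
    _ = B * (9 / ‖walkDist G d t u‖ - 2 + 1) := by ring
    _ ≤ _ := by gcongr

/-- Accuracy `0` is requested when both coarse estimates are `0`, for then `ε / 0 = 0`. The argument
of the logarithm is `x / 0 = 0`, so `τ = 0` and no walk step is made. -/
theorem expectedSteps_multNormEstimator_zero (hN : 2 ≤ N) (h : IsCoin (lazyWalk G d) coin)
    (u : Fin N) (t : ℕ) (δ : ℝ) :
    (multNormEstimator N u t 0 δ).expectedSteps (walkOp G coin) ≤ 0 := by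
  obtain ⟨hT1, -, -⟩ := rounds_spec hN
  rw [multNormEstimator]
  have := expectedSteps_multNormLoop_le h u t 0 (δ / ⌈Real.logb 2 N / 2⌉₊) (B := 0)
    (K := ⌈Real.logb 2 N / 2⌉₊) (fun j _ => by rw [expectedSteps_normEstimator h]; simp)
    (⌈Real.logb 2 N / 2⌉₊ - 1) 1 (by omega)
  rwa [zero_mul] at this

end NormEstimators

/-! ### Fixed-point amplitude amplification by nested three-fold sequences -/

section FixedPoint

/-- The pairs of phases in `S_ψ(b) w⁻¹ S_Π(a)`, for the product `w` of reflections with the given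
pairs of phases. -/
def invPhases : List (ℝ × ℝ) → ℝ → ℝ → List (ℝ × ℝ)
  | [], a, b => [(a, b)]
  | (φ, χ) :: l, a, b => invPhases l a (-χ) ++ [(-φ, b)]

/-- The angle `a` for which one pair of reflections with phases `(a, a)` acts on the bad amplitude
as the cubic Chebyshev polynomial rescaled from `[-1, 1]` to `[-1 / cosh w, 1 / cosh w]`. -/
noncomputable def fixedPointAngle (w : ℝ) : ℝ :=
  Real.arccos (1 - 2 * Real.cosh w ^ 2 / (4 * Real.cosh w ^ 2 - 3))

/-- Phases of the fixed-point amplification of depth `k`, obtained by nesting `k` three-fold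
sequences. -/
noncomputable def nestedPhases (η : ℝ) : ℕ → List (ℝ × ℝ)
  | 0 => []
  | k + 1 => nestedPhases η k ++
      (invPhases (nestedPhases η k) (fixedPointAngle (3 ^ k * η)) (fixedPointAngle (3 ^ k * η)) ++
        nestedPhases η k)

theorem length_invPhases (l : List (ℝ × ℝ)) (a b : ℝ) :
    (invPhases l a b).length = l.length + 1 := by
  induction l generalizing a b with
  | nil => rfl
  | cons x l ih => simp [invPhases, ih]

/-- With `n` pairs of reflections the state preparation is used `2 n + 1` times; each nesting level
uses the previous sequence three times. -/
theorem length_nestedPhases (η : ℝ) (k : ℕ) : 2 * (nestedPhases η k).length + 1 = 3 ^ k := by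
  induction k with
  | zero => rfl
  | succ k ih =>
    simp only [nestedPhases, List.length_append, length_invPhases]
    rw [pow_succ, ← ih]
    ring

/-- The argument of `arccos` lies in `[-1, 1]` because `1 ≤ cosh w`. -/
theorem cos_fixedPointAngle (w : ℝ) : 2 * (1 - Real.cos (fixedPointAngle w)) =
    4 * Real.cosh w ^ 2 / (4 * Real.cosh w ^ 2 - 3) := by
  have hC := Real.one_le_cosh w
  have hD : 0 < 4 * Real.cosh w ^ 2 - 3 := by nlinarith
  rw [fixedPointAngle, Real.cos_arccos]
  · ring
  · have : 2 * Real.cosh w ^ 2 / (4 * Real.cosh w ^ 2 - 3) ≤ 2 := by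
      rw [div_le_iff₀ hD]; nlinarith
    linarith
  · have : 0 ≤ 2 * Real.cosh w ^ 2 / (4 * Real.cosh w ^ 2 - 3) := by positivity
    linarith

variable {ι : Type} [Fintype ι] [DecidableEq ι] (good : ι → Prop) [DecidablePred good] (i₀ : ι)

/-- Product of generalized reflections around `good` and around `A |i₀⟩`; the head of the list is
applied first. -/
noncomputable def reflections (A : Matrix ι ι ℂ) : List (ℝ × ℝ) → Matrix ι ι ℂ
  | [] => 1
  | (φ, χ) :: l => reflections A l * (A * (phaseOn (fun x => x = i₀) χ).1 * Aᴴ) *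
      (phaseOn good φ).1

theorem phaseOn_val (p : ι → Prop) [DecidablePred p] (φ : ℝ) :
    (phaseOn p φ).1 = diagonal fun x => if p x then Complex.exp (φ * Complex.I) else 1 := rfl

theorem phaseOn_zero (p : ι → Prop) [DecidablePred p] : (phaseOn p 0).1 = 1 := by
  rw [phaseOn_val, ← diagonal_one]
  congr 1
  funext x
  simp

theorem reflections_append (A : Matrix ι ι ℂ) (l l' : List (ℝ × ℝ)) :
    reflections good i₀ A (l ++ l') = reflections good i₀ A l' * reflections good i₀ A l := by
  induction l with
  | nil => simp [reflections]
  | cons x l ih => simp only [List.cons_append, reflections, ih, Matrix.mul_assoc]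

theorem conjTranspose_phaseOn (p : ι → Prop) [DecidablePred p] (φ : ℝ) :
    (phaseOn p φ).1ᴴ = (phaseOn p (-φ)).1 := by
  rw [phaseOn_val, phaseOn_val, diagonal_conjTranspose]
  congr 1
  funext x
  simp only [Pi.star_apply]
  split_ifs
  · rw [Complex.star_def, ← Complex.exp_conj]
    simp
  · simp

/-- Inversion reverses the order and negates the phases, so the reflections have to be paired anew;
the two new reflections `a` and `b` complete the pairs at the ends. -/
theorem reflections_invPhases (A : Matrix ι ι ℂ) (l : List (ℝ × ℝ)) (a b : ℝ) :
    reflections good i₀ A (invPhases l a b) =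
      A * (phaseOn (fun x => x = i₀) b).1 * Aᴴ * (reflections good i₀ A l)ᴴ *
        (phaseOn good a).1 := by
  induction l generalizing a b with
  | nil => simp [invPhases, reflections]
  | cons x l ih =>
    simp only [invPhases, reflections_append, ih, reflections, conjTranspose_mul,
      conjTranspose_phaseOn, conjTranspose_conjTranspose, Matrix.mul_assoc, Matrix.one_mul]

/-- With `B = w A`, where `w` is the product of reflections so far, `w S_ψ w⁻¹ S_Π w A = B S_(i₀) B†
S_Π B`. So each level is one pair of reflections with `B` in place of `A`. -/
theorem reflections_nestedPhases_succ (A : Matrix ι ι ℂ) (η : ℝ) (k : ℕ) :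
    reflections good i₀ A (nestedPhases η (k + 1)) * A =
      (reflections good i₀ A (nestedPhases η k) * A) *
        ((phaseOn (fun x => x = i₀) (fixedPointAngle (3 ^ k * η))).1 *
          ((reflections good i₀ A (nestedPhases η k) * A)ᴴ *
            ((phaseOn good (fixedPointAngle (3 ^ k * η))).1 *
              (reflections good i₀ A (nestedPhases η k) * A)))) := by
  simp only [nestedPhases, reflections_append, reflections_invPhases, conjTranspose_mul,
    Matrix.mul_assoc]

variable {good i₀}

/-- One pair of generalized reflections with equal phases. -/
theorem amplify_once {B : Matrix ι ι ℂ} (hB : B ∈ unitaryGroup ι ℂ) (a : ℝ) :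
    ∃ x y : ℂ, (∀ j, (B * ((phaseOn (fun x => x = i₀) a).1 * (Bᴴ * ((phaseOn good a).1 * B)))) j i₀ =
      (if good j then x else y) * B j i₀) ∧
      ‖y‖ = |1 - 2 * (1 - Real.cos a) * goodWeight good fun j => B j i₀| := by
  set z := Complex.exp (a * Complex.I) with hz
  set w := goodWeight good fun j => B j i₀ with hw
  have hBB : Bᴴ * B = 1 := mem_unitaryGroup_iff'.1 hB
  have hBB' : B * Bᴴ = 1 := mem_unitaryGroup_iff.1 hB
  have hψ : ∑ j, ‖B j i₀‖ ^ 2 = 1 := by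
    have := norm_sq_mulVec_single hBB i₀
    rwa [mulVec_single_one] at this
  refine ⟨z + (z - 1) * (z * w + 1 * (1 - w)), 1 + (z - 1) * (z * w + 1 * (1 - w)), fun j => ?_, ?_⟩
  · have e1 : (B * ((phaseOn (fun x => x = i₀) a).1 * (Bᴴ * ((phaseOn good a).1 * B)))) j i₀ =
        (B *ᵥ (diagonal (fun x => if x = i₀ then z else 1) *ᵥ (Bᴴ *ᵥ
          fun j => (if good j then z else 1) * B j i₀))) j := by
      have e2 : (fun j => (if good j then z else 1) * B j i₀) =
          (phaseOn good a).1 *ᵥ (B *ᵥ Pi.single i₀ 1) := by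
        funext j
        rw [phaseOn_val, mulVec_diagonal, mulVec_single_one]
        rfl
      rw [e2, phaseOn_val, phaseOn_val, mulVec_mulVec, mulVec_mulVec, mulVec_mulVec, mulVec_mulVec,
        mulVec_single_one]
      simp only [← Matrix.mul_assoc]
      rfl
    rw [e1, conj_diagonal_mulVec hBB', sum_star_mul_ite hψ]
    simp only
    split_ifs <;> ring
  · have hz2 : z * z = 2 * Real.cos a * z - 1 := by
      rw [hz, Complex.exp_mul_I, Complex.ofReal_cos]
      have h1 := Complex.sin_sq_add_cos_sq a
      linear_combination Complex.sin a ^ 2 * Complex.I_sq - h1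
    -- The left side is `z + w (z - 1) ^ 2`, and `(z - 1) ^ 2 = -2 (1 - cos a) z` on the unit
    -- circle. Equal phases thus make the factor real up to a phase.
    have hy : 1 + (z - 1) * (z * w + 1 * (1 - w)) =
        z * ((1 - 2 * (1 - Real.cos a) * w : ℝ) : ℂ) := by
      push_cast
      push_cast at hz2
      linear_combination w * hz2
    rw [hy, norm_mul, hz, Complex.norm_exp_ofReal_mul_I, one_mul, Complex.norm_real,
      Real.norm_eq_abs]

/-- With bad amplitude `b = |cos ψ| / cosh w` and `C = cosh w`, one level maps `b` to `|T_3(C b)| /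
T_3(C)`; the triple-angle formulas for `cos` and `cosh` identify this with the same shape at `3 ψ`
and `3 w`, so the levels compose. -/
theorem cos_three_mul_div (w ψ : ℝ) : |Real.cos ψ| / Real.cosh w *
    |1 - 4 * Real.cosh w ^ 2 / (4 * Real.cosh w ^ 2 - 3) *
      (1 - (|Real.cos ψ| / Real.cosh w) ^ 2)| = |Real.cos (3 * ψ)| / Real.cosh (3 * w) := by
  have hC := Real.one_le_cosh w
  have hD : 0 < 4 * Real.cosh w ^ 2 - 3 := by nlinarith
  have hC0 : 0 < Real.cosh w := by linarith
  have hD3 : Real.cosh (3 * w) = Real.cosh w * (4 * Real.cosh w ^ 2 - 3) := by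
    rw [Real.cosh_three_mul]; ring
  have e : 1 - 4 * Real.cosh w ^ 2 / (4 * Real.cosh w ^ 2 - 3) *
      (1 - (|Real.cos ψ| / Real.cosh w) ^ 2) =
      (4 * Real.cos ψ ^ 2 - 3) / (4 * Real.cosh w ^ 2 - 3) := by
    rw [div_pow, sq_abs]
    field_simp
    ring
  rw [e, hD3, Real.cos_three_mul, abs_div, abs_of_pos hD, div_mul_div_comm, ← abs_mul]
  congr 2
  ring

/-- Nested three-fold sequences act on the bad amplitude as a rescaled Chebyshev polynomial of
degree `3 ^ k`. -/
theorem nested_amplify {A : Matrix ι ι ℂ} (hA : A ∈ unitaryGroup ι ℂ) {η φ : ℝ}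
    (hφ : Real.cos φ = √(1 - goodWeight good fun j => A j i₀) * Real.cosh η) (k : ℕ) :
    reflections good i₀ A (nestedPhases η k) * A ∈ unitaryGroup ι ℂ ∧ ∃ x y : ℂ,
      (∀ j, (reflections good i₀ A (nestedPhases η k) * A) j i₀ =
        (if good j then x else y) * A j i₀) ∧
      ‖y‖ * √(1 - goodWeight good fun j => A j i₀) =
        |Real.cos (3 ^ k * φ)| / Real.cosh (3 ^ k * η) := by
  have hψ : ∑ j, ‖A j i₀‖ ^ 2 = 1 := by
    have := norm_sq_mulVec_single (mem_unitaryGroup_iff'.1 hA : Aᴴ * A = 1) i₀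
    rwa [mulVec_single_one] at this
  have hw1 := goodWeight_le_one (good := good) hψ
  set w := goodWeight good fun j => A j i₀ with hw
  induction k with
  | zero =>
    refine ⟨by simpa [nestedPhases, reflections] using hA, 1, 1,
      by simp [nestedPhases, reflections], ?_⟩
    have := Real.cosh_pos η
    rw [pow_zero, one_mul, one_mul, hφ, abs_of_nonneg (by positivity), norm_one, one_mul]
    field_simp
  | succ k ih =>
    obtain ⟨hB, x, y, hxy, hy⟩ := ih
    rw [reflections_nestedPhases_succ]
    set B := reflections good i₀ A (nestedPhases η k) * A with hBd
    refine ⟨?_, ?_⟩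
    · refine mul_mem hB (mul_mem (SetLike.coe_mem _) (mul_mem ?_ (mul_mem (SetLike.coe_mem _) hB)))
      exact Unitary.star_mem hB
    · obtain ⟨x', y', h1, h2⟩ := amplify_once (good := good) (i₀ := i₀) hB
        (fixedPointAngle (3 ^ k * η))
      refine ⟨x' * x, y' * y, fun j => ?_, ?_⟩
      · rw [h1, hxy]
        split_ifs <;> ring
      · have hψB : ∑ j, ‖B j i₀‖ ^ 2 = 1 := by
          have := norm_sq_mulVec_single (mem_unitaryGroup_iff'.1 hB : Bᴴ * B = 1) i₀
          rwa [mulVec_single_one] at this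
        -- The good weight of the state reached so far is one minus its squared bad amplitude, to
        -- which the induction hypothesis applies.
        have hwB : (goodWeight good fun j => B j i₀) = 1 - (‖y‖ * √(1 - w)) ^ 2 := by
          rw [mul_pow, Real.sq_sqrt (by linarith)]
          have h3 := goodWeight_compl (good := good) hψB
          have h4 : ∑ j with ¬ good j, ‖B j i₀‖ ^ 2 = ‖y‖ ^ 2 * (1 - w) := by
            rw [hw, ← goodWeight_compl (good := good) hψ, Finset.mul_sum]
            refine Finset.sum_congr rfl fun j hj => ?_
            rw [hxy, if_neg (Finset.mem_filter.1 hj).2, norm_mul, mul_pow]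
          linarith
        rw [norm_mul, h2, cos_fixedPointAngle, hwB, mul_assoc, hy, mul_comm, cos_three_mul_div,
          pow_succ, mul_comm _ (3 : ℝ), mul_assoc, mul_assoc]

/-- Phases of the fixed-point amplification with `L` pairs of reflections and accuracy `ν`. -/
noncomputable def amplifyPhase (L : ℕ) (ν : ℝ) (j : ℕ) : ℝ × ℝ :=
  (nestedPhases (Real.log (2 / ν) / 3 ^ Nat.log 3 (2 * L + 1)) (Nat.log 3 (2 * L + 1))).getD j (0, 0)

variable {N : ℕ} {U : Matrix (WalkReg N) (WalkReg N) ℂ}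

/-- Positions beyond the list have phases `(0, 0)`, whose reflections are the identity. This fills
up any `L` that is not of the form `(3 ^ k - 1) / 2`. -/
theorem fixedPointAmplify_eval (hU : Uᴴ = U) (hU2 : U * U = 1) (A : Circuit N ι)
    (l : List (ℝ × ℝ)) (L : ℕ) :
    (fixedPointAmplify A i₀ good (fun j => l.getD j (0, 0)) L).eval U =
      reflections good i₀ (A.eval U) (l.take L) * A.eval U := by
  rw [fixedPointAmplify]
  induction L with
  | zero => simp [Circuit.iter, reflections]
  | succ L ih =>
    rw [Circuit.iter, Circuit.eval, ih, List.take_add_one, reflections_append]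
    simp only [Circuit.eval, Circuit.eval_inv hU]
    rcases lt_or_ge L l.length with hL | hL
    · rw [List.getElem?_eq_getElem hL]
      simp only [Option.toList_some, reflections, List.getD_eq_getElem _ _ hL, Matrix.mul_assoc,
        Matrix.one_mul]
    · rw [List.getElem?_eq_none hL]
      simp only [Option.toList_none, reflections, List.getD_eq_default _ _ hL, phaseOn_zero,
        Matrix.mul_one, Matrix.one_mul, A.eval_mul_conjTranspose_self hU hU2]

/-- Fixed-point amplitude amplification. -/
theorem fixedPointAmplify_spec (hU : Uᴴ = U) (hU2 : U * U = 1) (A : Circuit N ι) {L : ℕ} {ν : ℝ}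
    (hν : 0 < ν) (hν1 : ν ≤ 1)
    (hL : 3 * Real.log (2 / ν) ≤ (2 * L + 1) * goodNorm A i₀ good U) :
    ∃ x y : ℂ, (∀ j, (fixedPointAmplify A i₀ good (amplifyPhase L ν) L).eval U j i₀ =
      (if good j then x else y) * A.eval U j i₀) ∧
      ‖y‖ ^ 2 * (1 - goodWeight good fun j => A.eval U j i₀) ≤ ν ^ 2 := by
  set k := Nat.log 3 (2 * L + 1) with hk
  set η := Real.log (2 / ν) / 3 ^ k with hη
  have hlog : 0 < Real.log (2 / ν) := Real.log_pos (by rw [lt_div_iff₀ hν]; linarith)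
  have hη0 : 0 < η := by positivity
  have hA : A.eval U ∈ unitaryGroup ι ℂ :=
    mem_unitaryGroup_iff'.2 (A.eval_conjTranspose_mul_self hU hU2)
  have hw0 := goodWeight_nonneg good fun j => A.eval U j i₀
  have hw1 := goodWeight_le_one (good := good) (A.sum_norm_sq_eval hU hU2 i₀)
  rw [goodNorm] at hL
  set w := goodWeight good fun j => A.eval U j i₀ with hw
  have hlen : (nestedPhases η k).length ≤ L := by
    have h1 := length_nestedPhases η k
    have h2 : 3 ^ k ≤ 2 * L + 1 := Nat.pow_log_le_self 3 (by omega)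
    omega
  have h3k : (2 * L + 1 : ℝ) ≤ 3 * 3 ^ k := by
    have : 2 * L + 1 < 3 ^ (k + 1) := Nat.lt_pow_succ_log_self (by norm_num) _
    rw [pow_succ'] at this
    exact_mod_cast this.le
  -- The depth is the largest with `3 ^ k ≤ 2 L + 1`, so at most a factor `3` is lost, which the `3`
  -- in `hL` covers.
  have hηw : η ≤ √w := by
    rw [hη, div_le_iff₀ (by positivity)]
    have := Real.sqrt_nonneg w
    nlinarith
  -- The initial bad amplitude must lie in the range where the rescaled Chebyshev polynomial is
  -- small, so that `φ` is a real angle. It does, since `√(1 - w) ≤ exp (-w/2)` and `cosh η ≤ exp (η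
  -- ^ 2 / 2)`.
  have hcos : √(1 - w) * Real.cosh η ≤ 1 := by
    have h1 : Real.cosh η ≤ Real.exp (η ^ 2 / 2) := Real.cosh_le_exp_half_sq η
    have h2 : √(1 - w) ≤ Real.exp (-(η ^ 2 / 2)) := by
      rw [Real.sqrt_le_left (Real.exp_pos _).le, ← Real.exp_nat_mul]
      have h3 : η ^ 2 ≤ w := by
        rw [← Real.sq_sqrt hw0]
        gcongr
      have := Real.add_one_le_exp (-(η ^ 2))
      rw [show ((2 : ℕ) : ℝ) * -(η ^ 2 / 2) = -(η ^ 2) by push_cast; ring]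
      linarith
    calc _ ≤ Real.exp (-(η ^ 2 / 2)) * Real.exp (η ^ 2 / 2) := by
          have := Real.cosh_pos η
          gcongr
      _ = 1 := by rw [← Real.exp_add]; simp
  have hcosφ : Real.cos (Real.arccos (√(1 - w) * Real.cosh η)) = √(1 - w) * Real.cosh η := by
    refine Real.cos_arccos ?_ hcos
    have := Real.cosh_pos η
    have : 0 ≤ √(1 - w) * Real.cosh η := by positivity
    linarith
  obtain ⟨-, x, y, hxy, hy⟩ := nested_amplify (good := good) (i₀ := i₀) hA hcosφ k
  refine ⟨x, y, fun j => ?_, ?_⟩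
  · have : (fixedPointAmplify A i₀ good (amplifyPhase L ν) L).eval U = _ :=
      fixedPointAmplify_eval hU hU2 A (nestedPhases η k) L
    rw [this, List.take_of_length_le hlen, hxy]
  · have h1 : ‖y‖ * √(1 - w) ≤ ν := by
      rw [hy]
      -- The final bad amplitude is at most `1 / cosh (log (2/ν)) ≤ ν`.
      have h3 : (3 : ℝ) ^ k * η = Real.log (2 / ν) := by
        rw [hη]; field_simp
      rw [h3, div_le_iff₀ (Real.cosh_pos _)]
      refine (Real.abs_cos_le_one _).trans ?_
      rw [Real.cosh_eq, Real.exp_log (by positivity)]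
      have := Real.exp_pos (-Real.log (2 / ν))
      have h4 : ν * ((2 / ν + Real.exp (-Real.log (2 / ν))) / 2) =
          1 + ν * Real.exp (-Real.log (2 / ν)) / 2 := by field_simp
      rw [h4]
      have : 0 ≤ ν * Real.exp (-Real.log (2 / ν)) / 2 := by positivity
      linarith
    calc _ = (‖y‖ * √(1 - w)) ^ 2 := by rw [mul_pow, Real.sq_sqrt (by linarith)]
      _ ≤ ν ^ 2 := by
        have : 0 ≤ ‖y‖ * √(1 - w) := by positivity
        gcongr

theorem steps_fixedPointAmplify (A : Circuit N ι) (phase : ℕ → ℝ × ℝ) (L : ℕ) :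
    (fixedPointAmplify A i₀ good phase L).steps = (2 * L + 1) * A.steps := by
  rw [fixedPointAmplify, Circuit.steps_iter _ _ (2 * A.steps)]
  · ring
  · intro j
    simp only [Circuit.steps, Circuit.steps_inv]
    ring

end FixedPoint

/-! ### The SWAP test -/

section SwapTest

variable {N : ℕ} {U : Matrix (WalkReg N) (WalkReg N) ℂ} {ι : Type} [Fintype ι] [DecidableEq ι]
  (A B : Circuit N ι) (i j : ι)

/-- Outcome `1` projects onto the antisymmetric part of the product state. -/
theorem swapTest_eval (x y : ι) :
    (swapTest A B).eval U ((x, y), true) ((i, j), false) =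
      (A.eval U x i * B.eval U y j - A.eval U y i * B.eval U x j) / 2 := by
  have hs2 : (√2 : ℂ) * (√2 : ℂ) = 2 := by
    rw [← Complex.ofReal_mul, Real.mul_self_sqrt (by norm_num)]; norm_num
  have hs0 : (√2 : ℂ) ≠ 0 := by
    intro h; rw [h] at hs2; norm_num at hs2
  have e1 : (swapTest A B).eval U ((x, y), true) ((i, j), false) =
      ((swapTest A B).eval U *ᵥ Pi.single ((i, j), false) 1) ((x, y), true) := by
    rw [mulVec_single_one]; rfl
  have hprep (a b : ι) (c : Bool) : ((Circuit.left (κ := Bool)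
      (.seq (.left A) (.right B) : Circuit N (ι × ι))).eval U *ᵥ
      Pi.single ((i, j), false) 1) ((a, b), c) =
      if c = false then A.eval U a i * B.eval U b j else 0 := by
    rw [Circuit.eval_left_mulVec]
    cases c
    · have h1 : (fun i' => (Pi.single ((i, j), false) 1 : (ι × ι) × Bool → ℂ) (i', false)) =
          Pi.single (i, j) 1 := by
        funext z
        simp [Pi.single_apply]
      rw [h1, Circuit.eval_seq_mulVec, Circuit.eval_right_mulVec]
      have h2 : (fun k' => ((Circuit.left A).eval U *ᵥ (Pi.single (i, j) 1 : ι × ι → ℂ)) (a, k')) =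
          A.eval U a i • Pi.single j 1 := by
        funext k'
        rw [Circuit.eval_left_mulVec]
        by_cases hk : k' = j
        · subst hk
          have : (fun i' => (Pi.single (i, k') 1 : ι × ι → ℂ) (i', k')) = Pi.single i 1 := by
            funext z
            simp [Pi.single_apply]
          rw [this, mulVec_single_one]
          simp
        · have : (fun i' => (Pi.single (i, j) 1 : ι × ι → ℂ) (i', k')) = 0 := by
            funext z
            simp [hk]
          rw [this, mulVec_zero]
          simp [hk]
      rw [h2, mulVec_smul, mulVec_single_one]
      simp
    · have h1 : (fun i' => (Pi.single ((i, j), false) 1 : (ι × ι) × Bool → ℂ) (i', true)) = 0 := by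
        funext z
        simp
      rw [h1, mulVec_zero]
      simp
  have hH (v : (ι × ι) × Bool → ℂ) (z : ι × ι) (c : Bool) :
      ((Circuit.right (Circuit.gate hadamard)).eval U *ᵥ v) (z, c) =
        (v (z, false) + (if c then -1 else 1) * v (z, true)) / (√2 : ℂ) := by
    rw [Circuit.eval_right_mulVec]
    simp only [Circuit.eval, hadamard, mulVec, dotProduct, Fintype.sum_bool]
    cases c
    · simp; ring
    · simp; ring
  have hS (v : (ι × ι) × Bool → ℂ) (z : (ι × ι) × Bool) :
      ((Circuit.gate (permGate (condSwap ι)) : Circuit N ((ι × ι) × Bool)).eval U *ᵥ v) z =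
        v ((condSwap ι).symm z) := by
    simp only [Circuit.eval, permGate, mulVec, dotProduct]
    rw [Finset.sum_eq_single ((condSwap ι).symm z)]
    · simp
    · intro b _ hb
      have : z ≠ condSwap ι b := fun h => hb (by rw [h, Equiv.symm_apply_apply])
      simp [this]
    · simp
  rw [e1, swapTest, Circuit.eval_seq_mulVec, Circuit.eval_seq_mulVec, Circuit.eval_seq_mulVec, hH,
    hS, hS]
  have hc1 : (condSwap ι).symm ((x, y), false) = ((x, y), false) := rfl
  have hc2 : (condSwap ι).symm ((x, y), true) = ((y, x), true) := rfl
  rw [hc1, hc2, hH, hH]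
  simp only [hprep]
  simp only [if_true, Bool.true_eq_false, Bool.false_eq_true, if_false]
  field_simp
  rw [sq, hs2]
  ring

/-- The SWAP test measures the overlap of two states. -/
theorem goodNorm_swapTest (hU : Uᴴ = U) (hU2 : U * U = 1) :
    2 * goodNorm (swapTest A B) ((i, j), false) (fun x => x.2 = true) U ^ 2 =
      1 - ‖∑ x, star (A.eval U x i) * B.eval U x j‖ ^ 2 := by
  have hA := A.sum_norm_sq_eval hU hU2 i
  have hB := B.sum_norm_sq_eval hU hU2 j
  rw [goodNorm, Real.sq_sqrt (goodWeight_nonneg _ _), goodWeight, Finset.sum_filter,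
    Fintype.sum_prod_type]
  have h1 (z : ι × ι) : (∑ c : Bool, if ((z, c) : (ι × ι) × Bool).2 = true then
      ‖(swapTest A B).eval U (z, c) ((i, j), false)‖ ^ 2 else 0) =
      ‖(A.eval U z.1 i * B.eval U z.2 j - A.eval U z.2 i * B.eval U z.1 j) / 2‖ ^ 2 := by
    rw [Fintype.sum_bool]
    simp only [if_true, Bool.false_eq_true, if_false, add_zero]
    rw [← swapTest_eval]
  simp only [h1, Fintype.sum_prod_type]
  set f := fun x => A.eval U x i with hf
  set g := fun x => B.eval U x j with hg
  have key : ((2 * ∑ x, ∑ y, ‖(f x * g y - f y * g x) / 2‖ ^ 2 : ℝ) : ℂ) =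
      ((1 - ‖∑ x, star (f x) * g x‖ ^ 2 : ℝ) : ℂ) := by
    have hA' : ∑ x, star (f x) * f x = 1 := by
      have : ((∑ x, ‖f x‖ ^ 2 : ℝ) : ℂ) = 1 := by exact_mod_cast hA
      rw [← this]
      push_cast
      exact Finset.sum_congr rfl fun x _ => by rw [Complex.star_def, Complex.conj_mul']
    have hB' : ∑ x, star (g x) * g x = 1 := by
      have : ((∑ x, ‖g x‖ ^ 2 : ℝ) : ℂ) = 1 := by exact_mod_cast hB
      rw [← this]
      push_cast
      exact Finset.sum_congr rfl fun x _ => by rw [Complex.star_def, Complex.conj_mul']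
    have hz : ∑ x, star (g x) * f x = star (∑ x, star (f x) * g x) := by
      rw [star_sum]
      exact Finset.sum_congr rfl fun x _ => by rw [star_mul, star_star]
    set z := ∑ x, star (f x) * g x
    have hzz : (‖z‖ : ℂ) ^ 2 = star z * z := by rw [Complex.star_def, Complex.conj_mul']
    push_cast
    rw [hzz]
    have hterm (x y : ι) : (‖(f x * g y - f y * g x) / 2‖ : ℂ) ^ 2 =
        ((star (f x) * f x) * (star (g y) * g y) + (star (g x) * g x) * (star (f y) * f y) -
          (star (f x) * g x) * (star (g y) * f y) - (star (g x) * f x) * (star (f y) * g y)) / 4 := by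
      rw [← Complex.conj_mul', ← Complex.star_def, star_div₀, star_sub, star_mul, star_mul]
      simp only [star_ofNat]
      ring
    simp only [hterm, ← Finset.sum_div, Finset.sum_sub_distrib, Finset.sum_add_distrib,
      ← Finset.mul_sum, ← Finset.sum_mul, hA', hB', hz]
    ring
  exact_mod_cast key

theorem steps_swapTest : (swapTest A B).steps = A.steps + B.steps := by
  simp [swapTest, Circuit.steps, Circuit.left, Circuit.right]

end SwapTest

/-! ### Overlap of the amplified states -/

section Overlap

theorem norm_normalize_sub_le {E : Type*} [NormedAddCommGroup E] [NormedSpace ℝ E] {x y : E}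
    (hx : x ≠ 0) (hy : y ≠ 0) :
    ‖(‖x‖⁻¹ • x - ‖y‖⁻¹ • y : E)‖ ≤ 2 * ‖x - y‖ / ‖y‖ := by
  have hx' : 0 < ‖x‖ := norm_pos_iff.2 hx
  have hy' : 0 < ‖y‖ := norm_pos_iff.2 hy
  have e : ‖x‖⁻¹ • x - ‖y‖⁻¹ • y = (‖x‖⁻¹ - ‖y‖⁻¹) • x + ‖y‖⁻¹ • (x - y) := by
    rw [sub_smul, smul_sub]; abel
  have h1 : ‖(‖x‖⁻¹ - ‖y‖⁻¹) • x‖ ≤ ‖x - y‖ / ‖y‖ := by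
    have e2 : ‖x‖⁻¹ - ‖y‖⁻¹ = (‖y‖ - ‖x‖) / ‖y‖ / ‖x‖ := by field_simp
    rw [norm_smul, e2, norm_div, norm_norm, div_mul_cancel₀ _ hx'.ne', norm_div, norm_norm,
      Real.norm_eq_abs, norm_sub_rev x y]
    gcongr
    exact abs_norm_sub_norm_le _ _
  have h2 : ‖(‖y‖⁻¹ • (x - y) : E)‖ = ‖x - y‖ / ‖y‖ := by
    rw [norm_smul, norm_inv, norm_norm]; ring
  rw [e]
  refine (norm_add_le _ _).trans ?_
  rw [h2]
  calc _ ≤ ‖x - y‖ / ‖y‖ + ‖x - y‖ / ‖y‖ := by gcongr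
    _ = _ := by ring

theorem abs_inner_sub_inner_le {E : Type*} [NormedAddCommGroup E] [InnerProductSpace ℝ E]
    {x x' y y' : E} {e : ℝ} (hx : ‖x‖ ≤ 1) (hy' : ‖y'‖ ≤ 1) (hxx : ‖x - x'‖ ≤ e)
    (hyy : ‖y - y'‖ ≤ e) : |inner ℝ x y - inner ℝ x' y'| ≤ 2 * e := by
  have e1 : inner ℝ x y - inner ℝ x' y' = inner ℝ x (y - y') + inner ℝ (x - x') y' := by
    rw [inner_sub_right, inner_sub_left]; ring
  rw [e1]
  refine (abs_add_le _ _).trans ?_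
  have h1 := (abs_real_inner_le_norm x (y - y')).trans
    (mul_le_mul hx hyy (norm_nonneg _) zero_le_one)
  have h2 := (abs_real_inner_le_norm (x - x') y').trans
    (mul_le_mul hxx hy' (norm_nonneg _) ((norm_nonneg _).trans hxx))
  linarith

variable {N : ℕ} {G : SimpleGraph (Fin N)} [DecidableRel G.Adj] {d : ℕ}
  {coin : Fin N → Matrix (Option (Fin N)) (Option (Fin N)) ℂ}

/-- Overlap of the amplified states of two nodes. -/
theorem overlap_amplified (hd : 1 ≤ d) (hdeg : ∀ i, G.degree i ≤ d)
    (h : IsCoin (lazyWalk G d) coin) {t τ L : ℕ} {ν : ℝ} (hν : 0 < ν) (hν1 : ν ≤ 1)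
    (hS : 0 < ∑ l ∈ Finset.range (τ + 1), chebCoeff t l) (u v : Fin N)
    (hu : 3 * Real.log (2 / ν) ≤ (2 * L + 1) * ‖ffDist G d t τ u‖)
    (hv : 3 * Real.log (2 / ν) ≤ (2 * L + 1) * ‖ffDist G d t τ v‖) :
    ∃ r : ℝ, 1 - 2 * ν ^ 2 ≤ r ∧ r ≤ 1 ∧
      |‖∑ x, star ((fixedPointAmplify (fastForward N t τ) ((u, none), 0) IsFlat
          (amplifyPhase L ν) L).eval (walkOp G coin) x ((u, none), 0)) *
        (fixedPointAmplify (fastForward N t τ) ((v, none), 0) IsFlat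
          (amplifyPhase L ν) L).eval (walkOp G coin) x ((v, none), 0)‖ -
        r * (|inner ℝ (‖ffDist G d t τ u‖⁻¹ • ffDist G d t τ u)
          (‖ffDist G d t τ v‖⁻¹ • ffDist G d t τ v)|)| ≤ ν ^ 2 := by
  have hU := conjTranspose_walkOp G (coin := coin)
  have hU2 := walkOp_mul_self h
  -- Amplification multiplies the flat part by a scalar `x`, whose phase is immaterial, and leaves
  -- weight at most `ν ^ 2` elsewhere.
  have key (u : Fin N) (hu : 3 * Real.log (2 / ν) ≤ (2 * L + 1) * ‖ffDist G d t τ u‖) :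
      ∃ x : ℂ, (∀ j, (fixedPointAmplify (fastForward N t τ) ((u, none), 0) IsFlat
          (amplifyPhase L ν) L).eval (walkOp G coin) ((j, none), 0) ((u, none), 0) =
            x * (ffDist G d t τ u j : ℂ)) ∧
        (∑ z with ¬ IsFlat z, ‖(fixedPointAmplify (fastForward N t τ) ((u, none), 0) IsFlat
          (amplifyPhase L ν) L).eval (walkOp G coin) z ((u, none), 0)‖ ^ 2 ≤ ν ^ 2) ∧
        1 - ν ^ 2 ≤ ‖x‖ * ‖ffDist G d t τ u‖ ∧ ‖x‖ * ‖ffDist G d t τ u‖ ≤ 1 := by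
    rw [← goodNorm_fastForward hd hdeg h hS u] at hu
    obtain ⟨x, y, hxy, hy⟩ := fixedPointAmplify_spec hU hU2 _ hν hν1 hu
    have hψ := (fastForward N t τ).sum_norm_sq_eval hU hU2 ((u, none), 0)
    have hψ' := (fixedPointAmplify (fastForward N t τ) ((u, none), 0) IsFlat
          (amplifyPhase L ν) L).sum_norm_sq_eval hU hU2 ((u, none), 0)
    have hw : (goodWeight IsFlat fun j => (fastForward N t τ).eval (walkOp G coin) j
        ((u, none), 0)) = ‖ffDist G d t τ u‖ ^ 2 := by
      rw [← goodNorm_fastForward hd hdeg h hS u, goodNorm, Real.sq_sqrt (goodWeight_nonneg _ _)]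
    have hsum := sum_norm_sq_ite (good := IsFlat) hψ x y
    simp only [← hxy] at hsum
    rw [hψ'] at hsum
    rw [hw] at hsum hy
    refine ⟨x, fun j => ?_, ?_, ?_, ?_⟩
    · rw [hxy, if_pos ⟨rfl, rfl⟩, fastForward_eval hd hdeg h hS]
    · refine le_trans (le_of_eq ?_) hy
      rw [← hw, ← goodWeight_compl (good := IsFlat) hψ, Finset.mul_sum]
      refine Finset.sum_congr rfl fun j hj => ?_
      rw [hxy, if_neg (Finset.mem_filter.1 hj).2, norm_mul, mul_pow]
    · have h0 : 0 ≤ ‖x‖ * ‖ffDist G d t τ u‖ := by positivity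
      by_contra! hlt
      have : ν ^ 2 ≤ 1 := pow_le_one₀ hν.le hν1
      have h1 : 1 - ν ^ 2 ≤ (‖x‖ * ‖ffDist G d t τ u‖) ^ 2 := by
        rw [mul_pow]; linarith
      nlinarith
    · rw [← sq_le_one_iff₀ (by positivity), mul_pow]
      have hw1 := goodWeight_le_one (good := IsFlat) hψ
      rw [hw] at hw1
      have : 0 ≤ ‖y‖ ^ 2 * (1 - ‖ffDist G d t τ u‖ ^ 2) :=
        mul_nonneg (sq_nonneg _) (by linarith)
      linarith
  obtain ⟨x, hx1, hx2, hx3, hx4⟩ := key u hu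
  obtain ⟨y, hy1, hy2, hy3, hy4⟩ := key v hv
  set ψ := fun z => (fixedPointAmplify (fastForward N t τ) ((u, none), 0) IsFlat
          (amplifyPhase L ν) L).eval (walkOp G coin) z ((u, none), 0)
  set χ := fun z => (fixedPointAmplify (fastForward N t τ) ((v, none), 0) IsFlat
          (amplifyPhase L ν) L).eval (walkOp G coin) z ((v, none), 0)
  have hlog : 0 < Real.log (2 / ν) := Real.log_pos (by rw [lt_div_iff₀ hν]; linarith)
  have hfu : 0 < ‖ffDist G d t τ u‖ := by
    by_contra! h0
    have := mul_nonpos_of_nonneg_of_nonpos (by positivity : (0 : ℝ) ≤ 2 * L + 1) h0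
    linarith
  have hfv : 0 < ‖ffDist G d t τ v‖ := by
    by_contra! h0
    have := mul_nonpos_of_nonneg_of_nonpos (by positivity : (0 : ℝ) ≤ 2 * L + 1) h0
    linarith
  set f := ffDist G d t τ u
  set g := ffDist G d t τ v
  -- The factor `r` is the product of the norms of the two flat parts; by Cauchy–Schwarz the
  -- remaining parts contribute at most `ν · ν`.
  refine ⟨(‖x‖ * ‖f‖) * (‖y‖ * ‖g‖), ?_, ?_, ?_⟩
  · have : ν ^ 2 ≤ 1 := pow_le_one₀ hν.le hν1
    nlinarith
  · exact mul_le_one₀ hx4 (by positivity) hy4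
  · have hflat : ∑ z with IsFlat z, star (ψ z) * χ z = star x * y * ((inner ℝ f g : ℝ) : ℂ) := by
      rw [sum_filter_isFlat, PiLp.inner_apply]
      push_cast
      rw [Finset.mul_sum]
      refine Finset.sum_congr rfl fun j _ => ?_
      simp only [ψ, χ, hx1, hy1, star_mul, Complex.star_def, Complex.conj_ofReal]
      simp
      ring
    have hr : ‖x‖ * ‖f‖ * (‖y‖ * ‖g‖) * |inner ℝ (‖f‖⁻¹ • f) (‖g‖⁻¹ • g)| =
        ‖∑ z with IsFlat z, star (ψ z) * χ z‖ := by
      rw [hflat, inner_smul_left, inner_smul_right, norm_mul, norm_mul, norm_star,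
        Complex.norm_real, Real.norm_eq_abs, abs_mul, abs_mul]
      simp only [conj_trivial, abs_inv, abs_norm]
      field_simp
    rw [hr, ← Finset.sum_filter_add_sum_filter_not Finset.univ IsFlat]
    refine (abs_norm_sub_norm_le _ _).trans ?_
    rw [add_sub_cancel_left]
    calc _ ≤ ∑ z with ¬ IsFlat z, ‖ψ z‖ * ‖χ z‖ := by
          refine norm_sum_le_of_le _ fun z _ => ?_
          rw [norm_mul, norm_star]
      _ ≤ √(∑ z with ¬ IsFlat z, ‖ψ z‖ ^ 2) * √(∑ z with ¬ IsFlat z, ‖χ z‖ ^ 2) :=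
          Real.sum_mul_le_sqrt_mul_sqrt _ _ _
      _ ≤ √(ν ^ 2) * √(ν ^ 2) := by gcongr
      _ = ν ^ 2 := by rw [Real.sqrt_sq hν.le]; ring

end Overlap

/-! ### Propagation of errors -/

section Accuracy

/-- Negative `x` is allowed: there `√x = 0`, which is the convention of the algorithm when `γ ^ 2 >
2`. -/
theorem abs_sqrt_sub_sqrt_le (x : ℝ) {y : ℝ} (hy : 0 ≤ y) : |√x - √y| ≤ √|x - y| := by
  rcases le_total x 0 with hx | hx
  · rw [Real.sqrt_eq_zero_of_nonpos hx, zero_sub, abs_neg, abs_of_nonneg (Real.sqrt_nonneg _)]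
    apply Real.sqrt_le_sqrt
    rw [abs_of_nonpos (by linarith)]
    linarith
  · apply Real.le_sqrt_of_sq_le
    rw [sq_abs]
    have h1 := Real.sq_sqrt hx
    have h2 := Real.sq_sqrt hy
    have h3 := Real.sqrt_nonneg x
    have h4 := Real.sqrt_nonneg y
    rcases le_total x y with h | h
    · have := Real.sqrt_le_sqrt h
      rw [abs_of_nonpos (by linarith)]
      nlinarith
    · have := Real.sqrt_le_sqrt h
      rw [abs_of_nonneg (by linarith)]
      nlinarith

/-- Propagation of the estimation errors to the estimate of the squared distance. -/
theorem abs_dist_sq_sub_estimate_le {a b c α β s μ M : ℝ} (ha : 0 ≤ a) (hb : 0 ≤ b)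
    (haM : a ≤ M) (hbM : b ≤ M) (hμ : 0 ≤ μ) (hμ1 : μ ≤ 1 / 10)
    (hα : |α - a| ≤ μ / 4 * a) (hβ : |β - b| ≤ μ / 4 * b) (hs0 : 0 ≤ s) (hs1 : s ≤ 1)
    (hsc : |s - c| ≤ μ) :
    |a ^ 2 + b ^ 2 - 2 * a * b * c - (α ^ 2 + β ^ 2 - 2 * α * β * s)| ≤ 5 * μ * M ^ 2 := by
  have sq_err {a α : ℝ} (ha : 0 ≤ a) (haM : a ≤ M) (hα : |α - a| ≤ μ / 4 * a) :
      |a ^ 2 - α ^ 2| ≤ μ * M ^ 2 * (6 / 10) := by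
    have h1 : |α + a| ≤ 21 / 10 * a := by
      rw [abs_le] at hα ⊢
      constructor <;> nlinarith
    rw [abs_sub_comm, show α ^ 2 - a ^ 2 = (α - a) * (α + a) by ring, abs_mul]
    calc _ ≤ (μ / 4 * a) * (21 / 10 * a) := by gcongr
      _ = μ * a ^ 2 * (21 / 40) := by ring
      _ ≤ μ * M ^ 2 * (6 / 10) := by
          have h2 : μ * a ^ 2 ≤ μ * M ^ 2 := by gcongr
          have h3 : 0 ≤ μ * M ^ 2 := by positivity
          linarith
  have h1 := sq_err ha haM hα
  have h2 := sq_err hb hbM hβ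
  have hab : a * b ≤ M ^ 2 := by rw [sq]; gcongr; exact ha.trans haM
  have h3 : |a * b - α * β| ≤ μ * M ^ 2 * (6 / 10) := by
    have e : a * b - α * β = -((α - a) * b) - a * (β - b) - (α - a) * (β - b) := by ring
    have e1 : |(α - a) * b| ≤ μ / 4 * (a * b) := by
      rw [abs_mul, abs_of_nonneg hb]; nlinarith
    have e2 : |a * (β - b)| ≤ μ / 4 * (a * b) := by
      rw [abs_mul, abs_of_nonneg ha]; nlinarith
    have e3 : |(α - a) * (β - b)| ≤ μ / 40 * (a * b) := by
      rw [abs_mul]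
      calc _ ≤ (μ / 4 * a) * (μ / 4 * b) := by gcongr
        _ = μ * μ / 16 * (a * b) := by ring
        _ ≤ μ / 40 * (a * b) := by
          have : μ * μ / 16 ≤ μ / 40 := by nlinarith
          gcongr
    rw [e]
    have h4 := abs_sub (-((α - a) * b) - a * (β - b)) ((α - a) * (β - b))
    have h5 := abs_sub (-((α - a) * b)) (a * (β - b))
    rw [abs_neg] at h5
    have : μ * (a * b) ≤ μ * M ^ 2 := by gcongr
    nlinarith
  have h4 : |(a * b - α * β) * s| ≤ μ * M ^ 2 * (6 / 10) := by
    rw [abs_mul, abs_of_nonneg hs0]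
    exact (mul_le_of_le_one_right (abs_nonneg _) hs1).trans h3
  have h5 : |a * b * (s - c)| ≤ μ * M ^ 2 := by
    rw [abs_mul, abs_of_nonneg (mul_nonneg ha hb)]
    calc _ ≤ M ^ 2 * μ := by gcongr
      _ = _ := by ring
  have e : a ^ 2 + b ^ 2 - 2 * a * b * c - (α ^ 2 + β ^ 2 - 2 * α * β * s) =
      (a ^ 2 - α ^ 2) + (b ^ 2 - β ^ 2) + (2 * (a * b * (s - c)) - 2 * ((a * b - α * β) * s)) := by
    ring
  rw [e]
  rw [abs_le] at h1 h2 h4 h5 ⊢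
  constructor <;> linarith

end Accuracy

/-! ### Correctness of the 2-distance estimator -/

section Correctness

variable {N : ℕ} {G : SimpleGraph (Fin N)} [DecidableRel G.Adj] {d : ℕ}
  {coin : Fin N → Matrix (Option (Fin N)) (Option (Fin N)) ℂ}

/-- Parameters of the 2-distance estimator. -/
noncomputable def estimatorConstants : EstimatorConstants where
  cμ := 1 / 10
  cν := 1 / 100
  cL := 3
  cτ := 100
  cμ_pos := by norm_num
  cν_pos := by norm_num
  cL_pos := by norm_num
  cτ_pos := by norm_num
  k := 3
  phase := amplifyPhase

/-- The amplified state of a node has nearly the direction of the walk distribution. -/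
theorem norm_ffDist_bounds (hd : 1 ≤ d) (hdeg : ∀ i, G.degree i ≤ d)
    (h : IsCoin (lazyWalk G d) coin) (u : Fin N) (t : ℕ) {ν lam : ℝ} (hν : 0 < ν)
    (hν1 : ν ≤ 1 / 1000) (hlam : 0 < lam) (hlama : lam ≤ 21 / 20 * ‖walkDist G d t u‖) :
    0 < ∑ l ∈ Finset.range (⌈√(2 * t * Real.log (100 / (lam * ν)))⌉₊ + 1), chebCoeff t l ∧
    3 * Real.log (2 / ν) ≤ (2 * ⌈3 / lam * Real.log (2 / ν)⌉₊ + 1) *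
      ‖ffDist G d t ⌈√(2 * t * Real.log (100 / (lam * ν)))⌉₊ u‖ ∧
    ‖(‖ffDist G d t ⌈√(2 * t * Real.log (100 / (lam * ν)))⌉₊ u‖⁻¹ •
        ffDist G d t ⌈√(2 * t * Real.log (100 / (lam * ν)))⌉₊ u -
      ‖walkDist G d t u‖⁻¹ • walkDist G d t u : EuclideanSpace ℝ (Fin N))‖ ≤ ν / 10 := by
  have ha1 := norm_walkDist_le_one hd hdeg t u
  have hx : 2 < 100 / (lam * ν) := by
    rw [lt_div_iff₀ (by positivity)]
    nlinarith
  obtain ⟨hS, herr⟩ := norm_ffDist_sub_le hd hdeg h (t := t) u hx (Nat.le_ceil _)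
  set f := ffDist G d t ⌈√(2 * t * Real.log (100 / (lam * ν)))⌉₊ u
  set p := walkDist G d t u
  have herr' : ‖f - p‖ ≤ 42 / 1000 * ν * ‖p‖ := by
    refine herr.trans ?_
    rw [div_div_eq_mul_div]
    nlinarith
  have hp : 0 < ‖p‖ := by nlinarith
  have hf : lam / 2 ≤ ‖f‖ := by
    have h1 := (abs_le.1 (abs_norm_sub_norm_le f p)).1
    nlinarith
  refine ⟨hS, ?_, ?_⟩
  · have hlog : 0 ≤ Real.log (2 / ν) := Real.log_nonneg (by rw [le_div_iff₀ hν]; linarith)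
    have h1 : 3 / lam * Real.log (2 / ν) ≤ ⌈3 / lam * Real.log (2 / ν)⌉₊ := Nat.le_ceil _
    calc 3 * Real.log (2 / ν) = 2 * (3 / lam * Real.log (2 / ν)) * (lam / 2) := by
          field_simp
      _ ≤ (2 * ⌈3 / lam * Real.log (2 / ν)⌉₊ + 1) * ‖f‖ := by
          gcongr
          linarith
  · refine (norm_normalize_sub_le (norm_pos_iff.1 (by linarith)) (norm_pos_iff.1 hp)).trans ?_
    rw [div_le_iff₀ hp]
    nlinarith

theorem norm_normalize_le_one {E : Type*} [NormedAddCommGroup E] [NormedSpace ℝ E] (x : E) :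
    ‖‖x‖⁻¹ • x‖ ≤ 1 := by
  rw [norm_smul, norm_inv, norm_norm]
  exact inv_mul_le_one

/-- Stability of the overlap read off from the outcome `γ` of the SWAP test. -/
theorem abs_sqrt_sub_overlap_le {g z γ r c c₀ μ ν : ℝ} (hμ : 0 < μ) (hμ1 : μ ≤ 1 / 10)
    (hν : ν = 1 / 100 * μ ^ 2) (hg : 0 ≤ g) (hz : 0 ≤ z) (hgz : 2 * g ^ 2 = 1 - z ^ 2)
    (hγ : |γ - g| ≤ ν) (hr0 : 1 - 2 * ν ^ 2 ≤ r) (hr1 : r ≤ 1) (hr : |z - r * (|c|)| ≤ ν ^ 2)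
    (hc₀ : 0 ≤ c₀) (hc : |c - c₀| ≤ ν / 5) (hc1 : |c| ≤ 1) :
    |√(1 - (2 * γ) ^ 2 / 2) - c₀| ≤ μ := by
  have hν0 : 0 < ν := by rw [hν]; positivity
  have hνμ : ν ≤ μ / 1000 := by rw [hν]; nlinarith
  have hg1 : g ≤ 1 := by nlinarith [sq_nonneg z]
  -- The square root is only Hölder continuous: an error `ν` in `γ` may become `√(5 ν)`. With `ν = μ
  -- ^ 2 / 100` this is below `μ / 2`.
  have h1 : |√(1 - (2 * γ) ^ 2 / 2) - z| ≤ μ / 2 := by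
    have h2 := abs_sqrt_sub_sqrt_le (1 - (2 * γ) ^ 2 / 2) (sq_nonneg z)
    rw [Real.sqrt_sq hz] at h2
    refine h2.trans (Real.sqrt_le_iff.2 ⟨by positivity, ?_⟩)
    have h3 : 1 - (2 * γ) ^ 2 / 2 - z ^ 2 = (g - γ) * (2 * (g + γ)) := by
      rw [show z ^ 2 = 1 - 2 * g ^ 2 by linarith]; ring
    rw [h3, abs_mul, abs_sub_comm]
    have h4 := abs_le.1 hγ
    have h5 : |2 * (g + γ)| ≤ 5 := by
      rw [abs_le]; constructor <;> linarith
    calc _ ≤ ν * 5 := by gcongr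
      _ ≤ (μ / 2) ^ 2 := by rw [hν]; nlinarith
  have h6 : |(|c| - c₀)| ≤ ν / 5 := by
    have := abs_abs_sub_abs_le_abs_sub c c₀
    rw [abs_of_nonneg hc₀] at this
    exact this.trans hc
  have h7 : |(r * |c| - |c| : ℝ)| ≤ 2 * ν ^ 2 := by
    rw [show r * |c| - |c| = -((1 - r) * |c|) by ring, abs_neg, abs_mul, abs_abs,
      abs_of_nonneg (by linarith)]
    nlinarith [abs_nonneg c]
  have hν2 : ν ^ 2 ≤ ν / 10 := by nlinarith
  rw [abs_le] at *
  constructor <;> linarith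

/-- The final amplitude estimation yields a good estimate of the squared distance if the norms are
known up to a factor `1 ± μ / 4`. -/
theorem prob_finalEstimate (hd : 1 ≤ d) (hdeg : ∀ i, G.degree i ≤ d)
    (h : IsCoin (lazyWalk G d) coin) (u v : Fin N) (t : ℕ) {α β μ ν lam δ : ℝ} (hδ : 0 < δ)
    (hμ : 0 < μ) (hμ1 : μ ≤ 1 / 10) (hν : ν = 1 / 100 * μ ^ 2)
    (hlam : lam = max (min α β) (1 / √N))
    (hα : |α - ‖walkDist G d t u‖| ≤ μ / 4 * ‖walkDist G d t u‖)
    (hβ : |β - ‖walkDist G d t v‖| ≤ μ / 4 * ‖walkDist G d t v‖) :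
    1 - δ ≤ (amplitudeEstimation
      (swapTest
        (fixedPointAmplify (fastForward N t ⌈√(2 * t * Real.log (100 / (lam * ν)))⌉₊)
          ((u, none), 0) IsFlat (amplifyPhase ⌈3 / lam * Real.log (2 / ν)⌉₊ ν)
          ⌈3 / lam * Real.log (2 / ν)⌉₊)
        (fixedPointAmplify (fastForward N t ⌈√(2 * t * Real.log (100 / (lam * ν)))⌉₊)
          ((v, none), 0) IsFlat (amplifyPhase ⌈3 / lam * Real.log (2 / ν)⌉₊ ν)
          ⌈3 / lam * Real.log (2 / ν)⌉₊))
      ((((u, none), 0), ((v, none), 0)), false) (fun x => x.2 = true) ν δ).prob (walkOp G coin)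
      fun γ => |‖walkDist G d t u - walkDist G d t v‖ ^ 2 -
        (α ^ 2 + β ^ 2 - 2 * α * β * √(1 - (2 * γ) ^ 2 / 2))| ≤
          5 * μ * max ‖walkDist G d t u‖ ‖walkDist G d t v‖ ^ 2 := by
  have hU := conjTranspose_walkOp G (coin := coin)
  have hU2 := walkOp_mul_self h
  have hν0 : 0 < ν := by rw [hν]; positivity
  have hν1 : ν ≤ 1 / 1000 := by rw [hν]; nlinarith
  have hsN : 0 < √(N : ℝ) := by linarith [one_le_sqrt_natCast u]
  have hp1 := one_div_sqrt_le_norm_walkDist (G := G) (d := d) t u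
  have hq1 := one_div_sqrt_le_norm_walkDist (G := G) (d := d) t v
  have hsN' : 0 < 1 / √(N : ℝ) := by positivity
  have hlam0 : 0 < lam := by rw [hlam]; exact lt_max_of_lt_right hsN'
  have hlu : lam ≤ 21 / 20 * ‖walkDist G d t u‖ := by
    rw [hlam]
    refine max_le ((min_le_left _ _).trans ?_) (by linarith)
    have := (abs_le.1 hα).2
    nlinarith
  have hlv : lam ≤ 21 / 20 * ‖walkDist G d t v‖ := by
    rw [hlam]
    refine max_le ((min_le_right _ _).trans ?_) (by linarith)
    have := (abs_le.1 hβ).2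
    nlinarith
  obtain ⟨hS, hu1, hu2⟩ := norm_ffDist_bounds hd hdeg h u t hν0 hν1 hlam0 hlu
  obtain ⟨-, hv1, hv2⟩ := norm_ffDist_bounds hd hdeg h v t hν0 hν1 hlam0 hlv
  obtain ⟨r, hr0, hr1, hr⟩ := overlap_amplified hd hdeg h hν0 (by linarith) hS u v hu1 hv1
  -- Probability vectors have nonnegative overlap, so its absolute value determines it.
  have hpq0 : 0 ≤ inner ℝ (walkDist G d t u) (walkDist G d t v) := by
    rw [PiLp.inner_apply]
    exact Finset.sum_nonneg fun j _ => mul_nonneg (walkDist_nonneg hd hdeg t v j)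
      (walkDist_nonneg hd hdeg t u j)
  have hp0 : 0 < ‖walkDist G d t u‖ := by linarith
  have hq0 : 0 < ‖walkDist G d t v‖ := by linarith
  refine (prob_amplitudeEstimation hU hU2 hν0 hδ).trans (Program.prob_mono (fun γ hγ => ?_) _)
  have hswap := goodNorm_swapTest
    (fixedPointAmplify (fastForward N t ⌈√(2 * t * Real.log (100 / (lam * ν)))⌉₊)
          ((u, none), 0) IsFlat (amplifyPhase ⌈3 / lam * Real.log (2 / ν)⌉₊ ν)
          ⌈3 / lam * Real.log (2 / ν)⌉₊)
    (fixedPointAmplify (fastForward N t ⌈√(2 * t * Real.log (100 / (lam * ν)))⌉₊)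
          ((v, none), 0) IsFlat (amplifyPhase ⌈3 / lam * Real.log (2 / ν)⌉₊ ν)
          ⌈3 / lam * Real.log (2 / ν)⌉₊) ((u, none), 0) ((v, none), 0) hU hU2
  have hov := abs_inner_sub_inner_le (norm_normalize_le_one _) (norm_normalize_le_one _) hu2 hv2
  have hc1 := (abs_real_inner_le_norm _ _).trans (mul_le_one₀
    (norm_normalize_le_one (ffDist G d t ⌈√(2 * t * Real.log (100 / (lam * ν)))⌉₊ u))
    (norm_nonneg _)
    (norm_normalize_le_one (ffDist G d t ⌈√(2 * t * Real.log (100 / (lam * ν)))⌉₊ v)))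
  have hc0 : 0 ≤ inner ℝ (‖walkDist G d t u‖⁻¹ • walkDist G d t u)
      (‖walkDist G d t v‖⁻¹ • walkDist G d t v) := by
    rw [real_inner_smul_left, real_inner_smul_right]
    positivity
  have hs := abs_sqrt_sub_overlap_le hμ hμ1 hν (goodNorm_nonneg _ _ _) (norm_nonneg _) hswap hγ
    hr0 hr1 hr hc0 (hov.trans (by linarith : _ ≤ ν / 5)) hc1
  have hdist : ‖walkDist G d t u - walkDist G d t v‖ ^ 2 = ‖walkDist G d t u‖ ^ 2 +
      ‖walkDist G d t v‖ ^ 2 - 2 * ‖walkDist G d t u‖ * ‖walkDist G d t v‖ *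
        inner ℝ (‖walkDist G d t u‖⁻¹ • walkDist G d t u)
          (‖walkDist G d t v‖⁻¹ • walkDist G d t v) := by
    rw [norm_sub_sq_real, real_inner_smul_left, real_inner_smul_right]
    field_simp
    ring
  rw [hdist]
  refine abs_dist_sq_sub_estimate_le hp0.le hq0.le (le_max_left _ _) (le_max_right _ _) hμ.le hμ1
    hα hβ (Real.sqrt_nonneg _) ?_ hs
  rw [Real.sqrt_le_one]
  nlinarith [sq_nonneg γ]

/-- Correctness of the 2-distance estimator. -/
theorem prob_distanceEstimator (hN : 2 ≤ N) (hd : 1 ≤ d) (hdeg : ∀ i, G.degree i ≤ d)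
    (h : IsCoin (lazyWalk G d) coin) (u v : Fin N) (t : ℕ) {ε δ : ℝ} (hε : 0 < ε) (hδ : 0 < δ) :
    1 - δ ≤ (distanceEstimator estimatorConstants N u v t ε δ).prob (walkOp G coin) fun a =>
      |‖walkDist G d t u - walkDist G d t v‖ ^ 2 - a| ≤ ε := by
  have hU := conjTranspose_walkOp G (coin := coin)
  have hU2 := walkOp_mul_self h
  have hN1 : (1 : ℝ) ≤ (N : ℝ) ^ 3 := one_le_pow₀ (by exact_mod_cast (by omega : 1 ≤ N))
  have hδ' : 0 < δ / (8 * (N : ℝ) ^ 3) := by positivity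
  have hδ8 : δ / (8 * (N : ℝ) ^ 3) ≤ δ / 8 := by gcongr; linarith
  have hsN' : 0 < 1 / √(N : ℝ) := by have := one_le_sqrt_natCast u; positivity
  have hp0 := hsN'.trans_le (one_div_sqrt_le_norm_walkDist (G := G) (d := d) t u)
  have hq0 := hsN'.trans_le (one_div_sqrt_le_norm_walkDist (G := G) (d := d) t v)
  -- Four norm estimates fail with probability at most `δ / 8` each, the final estimate with `δ /
  -- 2`.
  refine le_trans (by linarith : 1 - δ ≤ 1 - (δ / (8 * (N : ℝ) ^ 3) + (δ / (8 * (N : ℝ) ^ 3) +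
    (δ / (8 * (N : ℝ) ^ 3) + (δ / (8 * (N : ℝ) ^ 3) + (δ / 2 + 0)))))) ?_
  rw [distanceEstimator]
  refine Program.prob_bind_ge hU hU2 (by positivity)
    (prob_multNormEstimator hN hd hdeg h u t (by norm_num) (by norm_num) hδ') fun α₀ hα₀ => ?_
  refine Program.prob_bind_ge hU hU2 (by positivity)
    (prob_multNormEstimator hN hd hdeg h v t (by norm_num) (by norm_num) hδ') fun β₀ hβ₀ => ?_
  have hmax : 15 / 16 * max ‖walkDist G d t u‖ ‖walkDist G d t v‖ ≤ max α₀ β₀ := by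
    rw [mul_max_of_nonneg _ _ (by norm_num)]
    exact max_le_max (by linarith [(abs_le.1 hα₀).1]) (by linarith [(abs_le.1 hβ₀).1])
  have hM : 0 < max ‖walkDist G d t u‖ ‖walkDist G d t v‖ := lt_max_of_lt_left hp0
  have hm : 0 < max α₀ β₀ := lt_of_lt_of_le (by positivity) hmax
  -- The coarse maximum is at least `15/16` of the true one, and `1/2 · (16/15) ^ 2 ≤ 1`.
  have hμε : 5 * (1 / 10 * min 1 (ε / max α₀ β₀ ^ 2)) *
      max ‖walkDist G d t u‖ ‖walkDist G d t v‖ ^ 2 ≤ ε := by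
    have h1 : (15 / 16 * max ‖walkDist G d t u‖ ‖walkDist G d t v‖) ^ 2 ≤ max α₀ β₀ ^ 2 := by
      gcongr
    have h2 : min 1 (ε / max α₀ β₀ ^ 2) * max α₀ β₀ ^ 2 ≤ ε := by
      rw [← le_div_iff₀ (by positivity)]
      exact min_le_right _ _
    have h3 : 0 < min 1 (ε / max α₀ β₀ ^ 2) := lt_min one_pos (by positivity)
    nlinarith
  have hμ : 0 < 1 / 10 * min 1 (ε / max α₀ β₀ ^ 2) :=
    mul_pos (by norm_num) (lt_min one_pos (by positivity))
  have hμ1 : 1 / 10 * min 1 (ε / max α₀ β₀ ^ 2) ≤ 1 / 10 := by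
    linarith [min_le_left 1 (ε / max α₀ β₀ ^ 2)]
  refine Program.prob_bind_ge hU hU2 (by positivity)
    (prob_multNormEstimator hN hd hdeg h u t hμ (hμ1.trans (by norm_num)) hδ') fun α hα => ?_
  refine Program.prob_bind_ge hU hU2 (by positivity)
    (prob_multNormEstimator hN hd hdeg h v t hμ (hμ1.trans (by norm_num)) hδ') fun β hβ => ?_
  refine Program.prob_bind_ge hU hU2 le_rfl (prob_finalEstimate hd hdeg h u v t (half_pos hδ) hμ
    hμ1 rfl rfl hα hβ) fun γ hγ => ?_
  rw [sub_zero]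
  exact (if_pos (hγ.trans hμε)).ge

end Correctness

/-! ### Expected number of walk steps -/

section Cost

/-- For `N = 2` the term `log (log N)` is negative, but above `-0.45`; the hypothesis `δ ≤ 1/2`
makes `log (1/δ) ≥ log 2` large enough to absorb it. -/
theorem loglog_bounds {N : ℕ} (hN : 2 ≤ N) {δ : ℝ} (hδ : 0 < δ) (hδ2 : δ ≤ 1 / 2) :
    1 / 2 ≤ Real.log (1 / δ) ∧ Real.log (1 / δ) ≤ 3 * Real.log (Real.log N / δ) := by
  have hl2 := Real.log_two_gt_d9
  have hlN : Real.log 2 ≤ Real.log N := Real.log_le_log (by norm_num) (by exact_mod_cast hN)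
  have h1 : Real.log 2 ≤ Real.log (1 / δ) := by
    apply Real.log_le_log (by norm_num)
    rw [le_div_iff₀ hδ]
    linarith
  have h2 : -(1 / 2 : ℝ) + 1 / 20 ≤ Real.log (Real.log N) := by
    refine le_trans ?_ ((Real.one_sub_inv_le_log_of_pos (by linarith)).trans
      (Real.log_le_log (by linarith) hlN))
    have : (Real.log 2)⁻¹ ≤ (0.69 : ℝ)⁻¹ := inv_anti₀ (by norm_num) (by linarith)
    norm_num at this ⊢
    linarith
  have h3 : Real.log (Real.log N / δ) = Real.log (Real.log N) + Real.log (1 / δ) := by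
    rw [Real.log_div (by linarith) hδ.ne', one_div, Real.log_inv]
    ring
  rw [h3]
  constructor <;> linarith

/-- The scale `√t · log (log N / δ) · log (N / e) ^ (3 / 2)` of the number of steps. -/
noncomputable def stepScale (N t : ℕ) (e δ : ℝ) : ℝ :=
  √t * (Real.log (N / e) * √(Real.log (N / e))) * Real.log (Real.log N / δ)

variable {N : ℕ} {e : ℝ}

theorem log_natCast_div (hN : 2 ≤ N) (he : 0 < e) (he1 : e ≤ 1) :
    1 / 2 ≤ Real.log N ∧ 0 ≤ Real.log (1 / e) ∧
      Real.log (N / e) = Real.log N + Real.log (1 / e) := by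
  have hl2 := Real.log_two_gt_d9
  have hlN : Real.log 2 ≤ Real.log N := Real.log_le_log (by norm_num) (by exact_mod_cast hN)
  have hN0 : (N : ℝ) ≠ 0 := by positivity
  refine ⟨by linarith, Real.log_nonneg (by rwa [le_div_iff₀ he, one_mul]), ?_⟩
  rw [Real.log_div hN0 he.ne', one_div, Real.log_inv]
  ring

theorem stepScale_nonneg (hN : 2 ≤ N) (t : ℕ) (he : 0 < e) (he1 : e ≤ 1) {δ : ℝ} (hδ : 0 < δ)
    (hδ2 : δ ≤ 1 / 2) : 0 ≤ stepScale N t e δ := by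
  obtain ⟨h1, h2, h3⟩ := log_natCast_div hN he he1
  obtain ⟨h4, h5⟩ := loglog_bounds hN hδ hδ2
  have h6 : 0 ≤ Real.log (N / e) := by linarith
  have h7 : 0 ≤ Real.log (Real.log N / δ) := by linarith
  unfold stepScale
  positivity

/-- Logarithms of `2 ^ k · N ^ i / e ^ j` are of the order of `log (N / e)`. -/
theorem log_le_of_le_two_pow_mul (hN : 2 ≤ N) (he : 0 < e) {x : ℝ} (hx : 0 < x)
    (k i j : ℕ) (h : x ≤ 2 ^ k * (N : ℝ) ^ i * (1 / e) ^ j) :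
    Real.log x ≤ (k + i) * Real.log N + j * Real.log (1 / e) := by
  have hN0 : (N : ℝ) ≠ 0 := by positivity
  have hlN : Real.log 2 ≤ Real.log N := Real.log_le_log (by norm_num) (by exact_mod_cast hN)
  refine (Real.log_le_log hx h).trans ?_
  rw [Real.log_mul (by positivity) (by positivity), Real.log_mul (by positivity) (by positivity),
    Real.log_pow, Real.log_pow, Real.log_pow]
  have : (k : ℝ) * Real.log 2 ≤ k * Real.log N := by gcongr
  linarith

theorem natCeil_logb_half_le (hN : 2 ≤ N) : (⌈Real.logb 2 N / 2⌉₊ : ℝ) ≤ N := by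
  have : ⌈Real.logb 2 N / 2⌉₊ ≤ N := by
    rw [Nat.ceil_le]
    have hN0 : (0 : ℝ) < N := by positivity
    have h1 : Real.logb 2 N ≤ N := by
      rw [Real.logb_le_iff_le_rpow (by norm_num) hN0, Real.rpow_natCast]
      exact_mod_cast Nat.lt_two_pow_self.le
    linarith
  exact_mod_cast this

variable {G : SimpleGraph (Fin N)} [DecidableRel G.Adj] {d : ℕ}
  {coin : Fin N → Matrix (Option (Fin N)) (Option (Fin N)) ℂ}

/-- Since `log (N/e)` and `log (log N / δ)` are bounded below, their product dominates the sum of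
logarithms in the number of runs; the walk length adds `√t` and half a power of `log (N/e)`. For `η
= 0` both sides are `0`. -/
theorem expectedSteps_multNormEstimator_le_stepScale (hN : 2 ≤ N) (hd : 1 ≤ d)
    (hdeg : ∀ i, G.degree i ≤ d) (h : IsCoin (lazyWalk G d) coin) (u : Fin N) (t : ℕ)
    {η δ : ℝ} (he : 0 < e) (he1 : e ≤ 1) (hδ : 0 < δ) (hδ2 : δ ≤ 1 / 2)
    (hη : η = 0 ∨ e / 10 ≤ η ∧ η ≤ 1) :
    (multNormEstimator N u t η (δ / (8 * N ^ 3))).expectedSteps (walkOp G coin) ≤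
      10 ^ 8 * (stepScale N t e δ / (η * ‖walkDist G d t u‖)) := by
  rcases hη with rfl | ⟨hη, hη1⟩
  · rw [zero_mul, div_zero, mul_zero]
    exact expectedSteps_multNormEstimator_zero hN h u t _
  have hη0 : 0 < η := by linarith
  have hN2 : (2 : ℝ) ≤ N := by exact_mod_cast hN
  have hsN := one_le_sqrt_natCast u
  have ha : 0 < ‖walkDist G d t u‖ :=
    (by positivity : 0 < 1 / √(N : ℝ)).trans_le (one_div_sqrt_le_norm_walkDist t u)
  obtain ⟨h1, h2, h3⟩ := log_natCast_div hN he he1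
  obtain ⟨h4, h5⟩ := loglog_bounds hN hδ hδ2
  obtain ⟨hT1, -, -⟩ := rounds_spec hN
  have hT : (1 : ℝ) ≤ ⌈Real.logb 2 N / 2⌉₊ := by exact_mod_cast hT1
  have hTN := natCeil_logb_half_le hN
  refine (expectedSteps_multNormEstimator_le hN hd hdeg h u t hη0 hη1 (by positivity) ?_).trans ?_
  · have h6 : √(N : ℝ) ≤ N := Real.sqrt_le_iff.2 ⟨by linarith, by nlinarith⟩
    have h7 : (N : ℝ) ≤ N ^ 3 := le_self_pow₀ (by linarith) (by norm_num)
    rw [div_mul_eq_mul_div, div_le_one (by positivity)]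
    nlinarith
  set T := ⌈Real.logb 2 N / 2⌉₊
  set a := ‖walkDist G d t u‖
  rw [stepScale]
  set Λ := Real.log (N / e) with hΛ
  set l := Real.log (Real.log N / δ)
  have hruns : (⌈18 * Real.log (1 / (δ / (8 * (N : ℝ) ^ 3) / T))⌉₊ : ℝ) ≤ 900 * (Λ * l) := by
    have e1 : 1 / (δ / (8 * (N : ℝ) ^ 3) / T) = (8 * N ^ 3 * T) * (1 / δ) := by field_simp
    have e2 : Real.log (8 * N ^ 3 * T) ≤ 7 * Real.log N := by
      have := log_le_of_le_two_pow_mul hN he (x := 8 * N ^ 3 * T) (by positivity) 3 4 0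
        (by rw [pow_zero, mul_one]
            calc (8 * N ^ 3 * T : ℝ) ≤ 8 * N ^ 3 * N := by gcongr
              _ = _ := by ring)
      norm_num at this
      linarith
    have e3 : 0 ≤ Real.log (8 * N ^ 3 * T) := by
      apply Real.log_nonneg
      have : (1 : ℝ) ≤ N ^ 3 := one_le_pow₀ (by linarith)
      nlinarith
    rw [e1, Real.log_mul (by positivity) (by positivity)]
    refine (Nat.ceil_lt_add_one (by positivity)).le.trans ?_
    nlinarith
  have hroot : √(2 * t * Real.log (64 * N / η)) ≤ 5 * (√t * √Λ) := by
    have e1 : Real.log (64 * N / η) ≤ 11 * Λ := by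
      have := log_le_of_le_two_pow_mul hN he (x := 64 * N / η) (by positivity) 10 1 1 (by
        rw [div_le_iff₀ hη0, pow_one, pow_one]
        calc (64 * N : ℝ) ≤ 2 ^ 10 * N * (1 / e) * (e / 10) := by
              have : (2 ^ 10 * N * (1 / e) * (e / 10) : ℝ) = 102.4 * N := by field_simp; norm_num
              rw [this]; linarith
          _ ≤ _ := by gcongr)
      norm_num at this
      norm_num at h3 h2
      rw [h3]
      linarith
    rw [← Real.sqrt_mul (Nat.cast_nonneg t)]
    apply Real.sqrt_le_iff.2 ⟨by positivity, ?_⟩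
    rw [mul_pow, Real.sq_sqrt (mul_nonneg (Nat.cast_nonneg t) (by linarith))]
    have := mul_le_mul_of_nonneg_left e1 (Nat.cast_nonneg t : (0 : ℝ) ≤ t)
    have := mul_nonneg (Nat.cast_nonneg t : (0 : ℝ) ≤ t) (by linarith : 0 ≤ Λ)
    linarith
  have hΛ0 : 0 ≤ Λ := by linarith
  have hl0 : 0 ≤ l := by linarith
  calc _ ≤ 900 * (Λ * l) * (1220 / η * (5 * (√t * √Λ))) * (10 / a) := by gcongr
    _ = 54900000 * (√t * (Λ * √Λ) * l / (η * a)) := by field_simp; ring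
    _ ≤ _ := by gcongr; norm_num

/-- The cost is a product: `log (1/δ)` runs, `1 / μ ^ 2` phases, `log (N/e) / λ` reflections, and
walks of length `√(t log (N/e))`, up to constants. For `μ = 0` the walk length is `0`. -/
theorem expectedSteps_finalEstimate_le (hN : 2 ≤ N)
    (h : IsCoin (lazyWalk G d) coin) (u v : Fin N) (t : ℕ)
    {μ ν lam δ : ℝ} (he : 0 < e) (he1 : e ≤ 1) (hδ : 0 < δ) (hδ2 : δ ≤ 1 / 2)
    (hμ : μ = 0 ∨ e / 10 ≤ μ ∧ μ ≤ 1 / 10) (hν : ν = 1 / 100 * μ ^ 2)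
    (hlam : 1 / √N ≤ lam) (hlam1 : lam ≤ 1) (phase : ℕ → ℝ × ℝ) :
    (amplitudeEstimation
      (swapTest
        (fixedPointAmplify (fastForward N t ⌈√(2 * t * Real.log (100 / (lam * ν)))⌉₊)
          ((u, none), 0) IsFlat phase ⌈3 / lam * Real.log (2 / ν)⌉₊)
        (fixedPointAmplify (fastForward N t ⌈√(2 * t * Real.log (100 / (lam * ν)))⌉₊)
          ((v, none), 0) IsFlat phase ⌈3 / lam * Real.log (2 / ν)⌉₊))
      ((((u, none), 0), ((v, none), 0)), false) (fun x => x.2 = true) ν (δ / 2)).expectedSteps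
        (walkOp G coin) ≤ 5 * 10 ^ 9 * (stepScale N t e δ / (μ ^ 2 * lam)) := by
  rw [expectedSteps_amplitudeEstimation (conjTranspose_walkOp G) (walkOp_mul_self h),
    steps_swapTest, steps_fixedPointAmplify, steps_fixedPointAmplify, steps_fastForward]
  rcases hμ with rfl | ⟨hμ, hμ1⟩
  · simp [hν]
  have hμ0 : 0 < μ := by linarith
  have hν0 : 0 < ν := by rw [hν]; positivity
  have hν1 : ν ≤ 1 / 1000 := by rw [hν]; nlinarith
  have hN2 : (2 : ℝ) ≤ N := by exact_mod_cast hN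
  have hsN := one_le_sqrt_natCast u
  have hlam0 : 0 < lam := lt_of_lt_of_le (by positivity) hlam
  obtain ⟨h1, h2, h3⟩ := log_natCast_div hN he he1
  obtain ⟨h4, h5⟩ := loglog_bounds hN hδ hδ2
  rw [stepScale]
  set Λ := Real.log (N / e) with hΛ
  set l := Real.log (Real.log N / δ)
  have hΛ0 : 0 ≤ Λ := by linarith
  have hl0 : 0 ≤ l := by linarith
  have hruns : (⌈18 * Real.log (1 / (δ / 2))⌉₊ : ℝ) ≤ 200 * l := by
    have e1 : 1 / (δ / 2) = 2 * (1 / δ) := by field_simp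
    have e2 := Real.log_two_lt_d9
    have e3 := Real.log_two_gt_d9
    rw [e1, Real.log_mul (by norm_num) (by positivity)]
    refine (Nat.ceil_lt_add_one (by linarith)).le.trans ?_
    linarith
  have hphases : (2 * ⌈12 * Real.pi / ν⌉₊ + 1 : ℝ) ≤ 8000 / μ ^ 2 := by
    have e1 := (Nat.ceil_lt_add_one (by positivity : 0 ≤ 12 * Real.pi / ν)).le
    have e2 : 12 * Real.pi / ν ≤ 38 / ν := by
      gcongr
      linarith [Real.pi_lt_d2]
    have e3 : 3 ≤ 3 / 1000 / ν := by rw [le_div_iff₀ hν0]; linarith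
    calc _ ≤ 2 * (38 / ν) + 3 / 1000 / ν := by linarith
      _ ≤ 80 / ν := by rw [← mul_div_assoc, ← add_div]; gcongr; norm_num
      _ = _ := by rw [hν]; field_simp; norm_num
  have hμe : 1 / μ ≤ 10 * (1 / e) := by
    rw [div_le_iff₀ hμ0]
    calc (1 : ℝ) = 10 * (1 / e) * (e / 10) := by field_simp
      _ ≤ _ := by gcongr
  have hν' : 1 / ν ≤ 10000 * (1 / e) ^ 2 := by
    calc 1 / ν = 100 * (1 / μ) ^ 2 := by rw [hν]; field_simp
      _ ≤ 100 * (10 * (1 / e)) ^ 2 := by gcongr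
      _ = _ := by ring
  have hL : (2 * ⌈3 / lam * Real.log (2 / ν)⌉₊ + 1 : ℝ) ≤ 110 * Λ / lam := by
    have e1 : Real.log (2 / ν) ≤ 17 * Λ := by
      have := log_le_of_le_two_pow_mul hN he (x := 2 / ν) (by positivity) 15 0 2 (by
        rw [pow_zero, mul_one, ← mul_one_div]
        nlinarith [sq_nonneg (1 / e)])
      norm_num at this
      norm_num at h3 h2
      linarith
    have e2 : 0 ≤ Real.log (2 / ν) := Real.log_nonneg (by rw [le_div_iff₀ hν0]; linarith)
    have e3 := (Nat.ceil_lt_add_one (by positivity : 0 ≤ 3 / lam * Real.log (2 / ν))).le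
    have e4 : 3 / lam * Real.log (2 / ν) ≤ 51 * (Λ / lam) := by
      calc _ ≤ 3 / lam * (17 * Λ) := by gcongr
        _ = _ := by ring
    have e5 : 1 ≤ 2 * (Λ / lam) := by
      rw [← mul_div_assoc, le_div_iff₀ hlam0]
      linarith
    rw [mul_div_assoc]
    linarith
  have hτ : (⌈√(2 * t * Real.log (100 / (lam * ν)))⌉₊ : ℝ) ≤ 14 * (√t * √Λ) := by
    have e0 : 1 / lam ≤ N := by
      calc 1 / lam ≤ 1 / (1 / √(N : ℝ)) := by gcongr
        _ = √(N : ℝ) := one_div_one_div _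
        _ ≤ N := Real.sqrt_le_iff.2 ⟨by linarith, by nlinarith⟩
    have e1 : Real.log (100 / (lam * ν)) ≤ 22 * Λ := by
      have := log_le_of_le_two_pow_mul hN he (x := 100 / (lam * ν)) (by positivity) 20 1 2 (by
        calc 100 / (lam * ν) = 100 * (1 / lam) * (1 / ν) := by field_simp
          _ ≤ 100 * N * (10000 * (1 / e) ^ 2) := by gcongr
          _ = 1000000 * (N * (1 / e) ^ 2) := by ring
          _ ≤ 2 ^ 20 * (N * (1 / e) ^ 2) := by gcongr; norm_num
          _ = _ := by ring)
      norm_num at this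
      norm_num at h3 h2
      linarith
    have e2 : 1 / 2 ≤ Real.log (100 / (lam * ν)) := by
      have e3 : Real.log 2 ≤ Real.log (100 / (lam * ν)) := by
        apply Real.log_le_log (by norm_num)
        rw [le_div_iff₀ (by positivity)]
        nlinarith
      linarith [Real.log_two_gt_d9]
    refine (natCeil_sqrt_le t e2).trans ?_
    have : √(2 * t * Real.log (100 / (lam * ν))) ≤ 7 * (√t * √Λ) := by
      rw [← Real.sqrt_mul (Nat.cast_nonneg t)]
      apply Real.sqrt_le_iff.2 ⟨by positivity, ?_⟩
      rw [mul_pow, Real.sq_sqrt (mul_nonneg (Nat.cast_nonneg t) hΛ0)]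
      have := mul_le_mul_of_nonneg_left e1 (Nat.cast_nonneg t : (0 : ℝ) ≤ t)
      have := mul_nonneg (Nat.cast_nonneg t : (0 : ℝ) ≤ t) hΛ0
      linarith
    linarith
  push_cast
  calc _ = (⌈18 * Real.log (1 / (δ / 2))⌉₊ : ℝ) * ((2 * ⌈12 * Real.pi / ν⌉₊ + 1) *
        (2 * ((2 * ⌈3 / lam * Real.log (2 / ν)⌉₊ + 1) *
          ⌈√(2 * t * Real.log (100 / (lam * ν)))⌉₊))) := by ring
    _ ≤ 200 * l * (8000 / μ ^ 2 * (2 * (110 * Λ / lam * (14 * (√t * √Λ))))) := by gcongr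
    _ = 4928000000 * (√t * (Λ * √Λ) * l / (μ ^ 2 * lam)) := by field_simp; ring
    _ ≤ _ := by gcongr; norm_num

/-- The last amplitude estimation of the 2-distance estimator, for accuracy `μ` and estimates `α`
and `β` of the norms. -/
noncomputable def overlapEstimate (c : EstimatorConstants) (N : ℕ) (u v : Fin N) (t : ℕ)
    (δ μ α β : ℝ) : Program N ℝ := do
  let ν : ℝ := c.cν * μ ^ 2
  let lam : ℝ := max (min α β) (1 / Real.sqrt N)
  let L : ℕ := ⌈c.cL / lam * Real.log (2 / ν)⌉₊
  let τ : ℕ := ⌈Real.sqrt (2 * t * Real.log (c.cτ / (lam * ν)))⌉₊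
  let W := fastForward N t τ
  let ψu := fixedPointAmplify W ((u, none), 0) IsFlat (c.phase L ν) L
  let ψv := fixedPointAmplify W ((v, none), 0) IsFlat (c.phase L ν) L
  let γ₁ ← amplitudeEstimation (swapTest ψu ψv) ((((u, none), 0), ((v, none), 0)), false)
    (fun x => x.2 = true) ν (δ / 2)
  let γ : ℝ := 2 * γ₁
  return α ^ 2 + β ^ 2 - 2 * α * β * Real.sqrt (1 - γ ^ 2 / 2)

/-- The part of the 2-distance estimator after the choice of the accuracy `μ`. -/
noncomputable def refinedEstimate (c : EstimatorConstants) (N : ℕ) (u v : Fin N) (t : ℕ)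
    (δ μ : ℝ) : Program N ℝ := do
  let α ← multNormEstimator N u t μ (δ / (8 * N ^ c.k))
  let β ← multNormEstimator N v t μ (δ / (8 * N ^ c.k))
  overlapEstimate c N u v t δ μ α β

theorem distanceEstimator_eq (c : EstimatorConstants) (N : ℕ) (u v : Fin N) (t : ℕ) (ε δ : ℝ) :
    distanceEstimator c N u v t ε δ = (do
      let α₀ ← multNormEstimator N u t (1 / 4) (δ / (8 * N ^ c.k))
      let β₀ ← multNormEstimator N v t (1 / 4) (δ / (8 * N ^ c.k))
      refinedEstimate c N u v t δ (c.cμ * min 1 (ε / max α₀ β₀ ^ 2))) := rfl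

/-- The bound by `N ^ (-2)` compensates a failed coarse estimate, where a factor `amax ^ 4 ≥ N ^
(-2)` is lost; the product with `√N` compensates a failed fine estimate, where `λ` may drop to `N ^
(-1/2)`. -/
theorem failure_bounds (hN : 2 ≤ N) {δ : ℝ} (hδ : 0 < δ) (hδ2 : δ ≤ 1 / 2) :
    0 < δ / (8 * (N : ℝ) ^ 3) ∧ δ / (8 * (N : ℝ) ^ 3) ≤ 1 / 16 / N ^ 2 ∧
      δ / (8 * (N : ℝ) ^ 3) ≤ 1 ∧ δ / (8 * (N : ℝ) ^ 3) * √N ≤ 1 := by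
  have hN2 : (2 : ℝ) ≤ N := by exact_mod_cast hN
  have h0 : (1 : ℝ) ≤ N ^ 2 := one_le_pow₀ (by linarith)
  have h1 : δ / (8 * (N : ℝ) ^ 3) ≤ 1 / 16 / N ^ 2 := by
    rw [div_div, div_le_div_iff₀ (by positivity) (by positivity), pow_succ]
    nlinarith
  have h2 : 1 / 16 / (N : ℝ) ^ 2 ≤ 1 := by
    rw [div_le_one (by positivity)]
    linarith
  refine ⟨by positivity, h1, h1.trans h2, ?_⟩
  have h6 : √(N : ℝ) ≤ N := Real.sqrt_le_iff.2 ⟨by linarith, by nlinarith⟩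
  calc _ ≤ 1 / 16 / (N : ℝ) ^ 2 * N := by gcongr
    _ = 1 / 16 / N := by field_simp
    _ ≤ 1 := by rw [div_le_one (by positivity)]; linarith

/-- If both fine estimates are good, `λ` is at least half the smaller norm. Otherwise `λ ≥ 1 / √N`,
and the extra factor `√N` is cancelled by the failure probability. -/
theorem expectedSteps_refinedEstimate_le (hN : 2 ≤ N) (hd : 1 ≤ d)
    (hdeg : ∀ i, G.degree i ≤ d) (h : IsCoin (lazyWalk G d) coin) (u v : Fin N) (t : ℕ)
    {μ δ : ℝ} (he : 0 < e) (he1 : e ≤ 1) (hδ : 0 < δ) (hδ2 : δ ≤ 1 / 2)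
    (hμ : μ = 0 ∨ e / 10 ≤ μ ∧ μ ≤ 1 / 10) :
    (refinedEstimate estimatorConstants N u v t δ μ).expectedSteps (walkOp G coin) ≤
      3 * 10 ^ 10 * (stepScale N t e δ /
        (μ ^ 2 * min ‖walkDist G d t u‖ ‖walkDist G d t v‖)) := by
  have hU := conjTranspose_walkOp G (coin := coin)
  have hU2 := walkOp_mul_self h
  have hsN := one_le_sqrt_natCast u
  have hsN' : 0 < 1 / √(N : ℝ) := by positivity
  obtain ⟨hD0, -, hD1, hDs⟩ := failure_bounds hN hδ hδ2
  have hB := stepScale_nonneg hN t he he1 hδ hδ2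
  have hmult (w : Fin N) := expectedSteps_multNormEstimator_le_stepScale hN hd hdeg h w t he he1 hδ
    hδ2 (hμ.imp_right fun hμ => ⟨hμ.1, hμ.2.trans (by norm_num)⟩)
  have hp0 := hsN'.trans_le (one_div_sqrt_le_norm_walkDist (G := G) (d := d) t u)
  have hq0 := hsN'.trans_le (one_div_sqrt_le_norm_walkDist (G := G) (d := d) t v)
  have hm0 : 0 < min ‖walkDist G d t u‖ ‖walkDist G d t v‖ := lt_min hp0 hq0
  have hm1 : min ‖walkDist G d t u‖ ‖walkDist G d t v‖ ≤ 1 :=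
    (min_le_left _ _).trans (norm_walkDist_le_one hd hdeg t u)
  have hμ0 : 0 ≤ μ := by rcases hμ with hμ | hμ <;> linarith
  set B := stepScale N t e δ
  set m := min ‖walkDist G d t u‖ ‖walkDist G d t v‖ with hm
  set D := δ / (8 * (N : ℝ) ^ 3) with hD
  have hZ0 : 0 ≤ B / (μ ^ 2 * m) := by positivity
  have hmult' {w : Fin N} (hw : m ≤ ‖walkDist G d t w‖) :
      (multNormEstimator N w t μ D).expectedSteps (walkOp G coin) ≤
        10 ^ 8 * (B / (μ ^ 2 * m)) := by
    refine (hmult w).trans (mul_le_mul_of_nonneg_left ?_ (by norm_num))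
    rcases hμ with rfl | ⟨hμ, hμ1⟩
    · simp
    · have : 0 < μ := by linarith
      gcongr
      nlinarith
  have hlam0 {α β : ℝ} : 0 < max (min α β) (1 / √(N : ℝ)) := lt_max_of_lt_right hsN'
  have hfinal {α β : ℝ} (hα : 0 ≤ α ∧ α ≤ 1) :
      (overlapEstimate estimatorConstants N u v t δ μ α β).expectedSteps (walkOp G coin) ≤
        5 * 10 ^ 9 * (B / (μ ^ 2 * max (min α β) (1 / √(N : ℝ)))) := by
    rw [overlapEstimate, Program.expectedSteps_bind]
    simp only [Program.expectedSteps_pure]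
    rw [Program.expect_const hU hU2, add_zero]
    exact expectedSteps_finalEstimate_le hN h u v t he he1 hδ hδ2 hμ rfl (le_max_right _ _)
      (max_le ((min_le_left _ _).trans hα.2) (by rw [div_le_one (by linarith)]; exact hsN)) _
  have hbad {α β : ℝ} : 5 * 10 ^ 9 * (B / (μ ^ 2 * max (min α β) (1 / √(N : ℝ)))) ≤
      5 * 10 ^ 9 * (B / μ ^ 2 * √N) := by
    gcongr
    rw [← div_div, div_eq_mul_one_div (B / μ ^ 2)]
    gcongr
    rw [one_div_le hlam0 (by linarith)]
    exact le_max_right _ _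
  have hDbad : D * (5 * 10 ^ 9 * (B / μ ^ 2 * √N)) ≤ 5 * 10 ^ 9 * (B / (μ ^ 2 * m)) := by
    calc _ = 5 * 10 ^ 9 * (B / μ ^ 2) * (D * √N) := by ring
      _ ≤ 5 * 10 ^ 9 * (B / μ ^ 2) * (1 / m) := by
        gcongr
        exact hDs.trans (by rwa [le_div_iff₀ hm0, one_mul])
      _ = _ := by rw [← div_div]; ring
  have hbad0 : 0 ≤ 5 * 10 ^ 9 * (B / μ ^ 2 * √N) := by positivity
  have hprob (w : Fin N) (hμ : 0 < μ) (hμ1 : μ ≤ 1) :=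
    prob_multNormEstimator hN hd hdeg h w t hμ hμ1 hD0
  have hSu := hmult' (w := u) (min_le_left _ _)
  have hSv := hmult' (w := v) (min_le_right _ _)
  have hinner (α : ℝ) (hα : 0 ≤ α ∧ α ≤ 1) :
      (multNormEstimator N v t μ D >>=
        overlapEstimate estimatorConstants N u v t δ μ α).expectedSteps (walkOp G coin) ≤
      10 ^ 8 * (B / (μ ^ 2 * m)) + 5 * 10 ^ 9 * (B / μ ^ 2 * √N) := by
    rw [Program.expectedSteps_bind]
    exact add_le_add hSv ((Program.expect_mono (outputs_multNormEstimator v t μ D)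
      fun β hβ => (hfinal hα).trans hbad).trans_eq (Program.expect_const hU hU2 _ _))
  rw [refinedEstimate, Program.expectedSteps_bind]
  -- Correctness of the estimates needs `μ > 0`. For `μ = 0` all bounds are `0` already, as they are
  -- divided by `μ ^ 2`.
  rcases hμ with hμ | ⟨hμ, hμ1⟩
  · refine (add_le_add hSu ((Program.expect_mono (outputs_multNormEstimator u t μ D)
      fun α hα => hinner α hα).trans_eq (Program.expect_const hU hU2 _ _))).trans ?_
    simp [hμ]
  have hμp : 0 < μ := by linarith
  have hgood {α β : ℝ} (hα : |α - ‖walkDist G d t u‖| ≤ μ / 4 * ‖walkDist G d t u‖)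
      (hβ : |β - ‖walkDist G d t v‖| ≤ μ / 4 * ‖walkDist G d t v‖) :
      5 * 10 ^ 9 * (B / (μ ^ 2 * max (min α β) (1 / √(N : ℝ)))) ≤
        10 ^ 10 * (B / (μ ^ 2 * m)) := by
    have h1 : m / 2 ≤ max (min α β) (1 / √(N : ℝ)) := by
      refine le_max_of_le_left (le_min ?_ ?_)
      · have := (abs_le.1 hα).1
        have := min_le_left ‖walkDist G d t u‖ ‖walkDist G d t v‖
        nlinarith
      · have := (abs_le.1 hβ).1
        have := min_le_right ‖walkDist G d t u‖ ‖walkDist G d t v‖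
        nlinarith
    calc _ ≤ 5 * 10 ^ 9 * (B / (μ ^ 2 * (m / 2))) := by gcongr
      _ = _ := by field_simp; ring
  have hexp := Program.expect_le_of_prob hU hU2 (outputs_multNormEstimator u t μ D)
    (g := fun α => (multNormEstimator N v t μ D >>=
      overlapEstimate estimatorConstants N u v t δ μ α).expectedSteps (walkOp G coin))
    (a := 10 ^ 8 * (B / (μ ^ 2 * m)) + 15 * 10 ^ 9 * (B / (μ ^ 2 * m)))
    (hprob u hμp (by linarith)) (by positivity) (by positivity) (fun α hα hα' => ?_) hinner
  · refine (add_le_add hSu hexp).trans ?_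
    have : D * (10 ^ 8 * (B / (μ ^ 2 * m))) ≤ 1 * (10 ^ 8 * (B / (μ ^ 2 * m))) := by gcongr
    rw [mul_add]
    linarith
  · rw [Program.expectedSteps_bind]
    refine add_le_add hSv ((Program.expect_le_of_prob hU hU2 (outputs_multNormEstimator v t μ D)
      (hprob v hμp (by linarith)) (by positivity : 0 ≤ 10 ^ 10 * (B / (μ ^ 2 * m))) hbad0
      (fun β hβ hβ' => (hfinal hα).trans (hgood hα' hβ'))
      (fun β hβ => (hfinal hα).trans hbad)).trans ?_)
    linarith

/-- The expected number of quantum walk steps of the 2-distance estimator. -/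
theorem expectedSteps_distanceEstimator_le (hN : 2 ≤ N) (hd : 1 ≤ d)
    (hdeg : ∀ i, G.degree i ≤ d) (h : IsCoin (lazyWalk G d) coin) (u v : Fin N) (t : ℕ)
    {ε δ : ℝ} (hε : 0 < ε) (hδ : 0 < δ) (hδ2 : δ ≤ 1 / 2)
    (he' : e = min ε (max ‖walkDist G d t u‖ ‖walkDist G d t v‖ ^ 2)) :
    (distanceEstimator estimatorConstants N u v t ε δ).expectedSteps (walkOp G coin) ≤
      10 ^ 13 * (stepScale N t e δ * (max ‖walkDist G d t u‖ ‖walkDist G d t v‖ ^ 4 /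
        (min ‖walkDist G d t u‖ ‖walkDist G d t v‖ * e ^ 2))) := by
  have hU := conjTranspose_walkOp G (coin := coin)
  have hU2 := walkOp_mul_self h
  have hN2 : (2 : ℝ) ≤ N := by exact_mod_cast hN
  have hsN := one_le_sqrt_natCast u
  have hsN' : 0 < 1 / √(N : ℝ) := by positivity
  obtain ⟨hD0, hDN, hD1, -⟩ := failure_bounds hN hδ hδ2
  have hp0 := hsN'.trans_le (one_div_sqrt_le_norm_walkDist (G := G) (d := d) t u)
  have hq0 := hsN'.trans_le (one_div_sqrt_le_norm_walkDist (G := G) (d := d) t v)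
  have hm0 : 0 < min ‖walkDist G d t u‖ ‖walkDist G d t v‖ := lt_min hp0 hq0
  have hM0 : 0 < max ‖walkDist G d t u‖ ‖walkDist G d t v‖ := lt_max_of_lt_left hp0
  have hM1 : max ‖walkDist G d t u‖ ‖walkDist G d t v‖ ≤ 1 :=
    max_le (norm_walkDist_le_one hd hdeg t u) (norm_walkDist_le_one hd hdeg t v)
  have hMN : 1 / (N : ℝ) ^ 2 ≤ max ‖walkDist G d t u‖ ‖walkDist G d t v‖ ^ 4 := by
    calc 1 / (N : ℝ) ^ 2 = (1 / √(N : ℝ)) ^ 4 := by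
          rw [div_pow, one_pow, show √(N : ℝ) ^ 4 = (√(N : ℝ) ^ 2) ^ 2 by ring,
            Real.sq_sqrt (Nat.cast_nonneg N)]
      _ ≤ _ := by
          gcongr
          exact (one_div_sqrt_le_norm_walkDist t u).trans (le_max_left _ _)
  have he : 0 < e := by rw [he']; exact lt_min hε (by positivity)
  have heM : e ≤ max ‖walkDist G d t u‖ ‖walkDist G d t v‖ ^ 2 := he'.trans_le (min_le_right _ _)
  have heε : e ≤ ε := he'.trans_le (min_le_left _ _)
  have he1 : e ≤ 1 := heM.trans (pow_le_one₀ hM0.le hM1)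
  have hB := stepScale_nonneg hN t he he1 hδ hδ2
  have hcoarse {w : Fin N} (hw : min ‖walkDist G d t u‖ ‖walkDist G d t v‖ ≤ ‖walkDist G d t w‖) :
      (multNormEstimator N w t (1 / 4) (δ / (8 * (N : ℝ) ^ 3))).expectedSteps (walkOp G coin) ≤
      4 * 10 ^ 8 * (stepScale N t e δ / min ‖walkDist G d t u‖ ‖walkDist G d t v‖) := by
    refine (expectedSteps_multNormEstimator_le_stepScale hN hd hdeg h w t he he1 hδ hδ2
      (Or.inr ⟨by linarith, by norm_num⟩)).trans ?_
    calc _ ≤ 10 ^ 8 * (stepScale N t e δ /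
          (1 / 4 * min ‖walkDist G d t u‖ ‖walkDist G d t v‖)) := by gcongr
      _ = _ := by field_simp
  have hcu := hcoarse (w := u) (min_le_left _ _)
  have hcv := hcoarse (w := v) (min_le_right _ _)
  have hprob (w : Fin N) :=
    prob_multNormEstimator hN hd hdeg h w t (by norm_num : (0 : ℝ) < 1 / 4) (by norm_num) hD0
  have hfine {μ : ℝ} (hμ : μ = 0 ∨ e / 10 ≤ μ ∧ μ ≤ 1 / 10) :=
    expectedSteps_refinedEstimate_le hN hd hdeg h u v t he he1 hδ hδ2 hμ
  set a := ‖walkDist G d t u‖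
  set b := ‖walkDist G d t v‖
  set M := max a b with hM
  set m := min a b with hm
  set B := stepScale N t e δ
  set D := δ / (8 * (N : ℝ) ^ 3)
  have hDM : D ≤ 1 / 16 * M ^ 4 := by
    calc D ≤ 1 / 16 / (N : ℝ) ^ 2 := hDN
      _ = 1 / 16 * (1 / (N : ℝ) ^ 2) := by ring
      _ ≤ _ := by gcongr
  -- As the estimates are at most `1` with certainty, `μ` never falls below `e / 10` unless both
  -- estimates vanish and `μ = 0`.
  have hμ {α₀ β₀ : ℝ} (hα₀ : 0 ≤ α₀ ∧ α₀ ≤ 1) (hβ₀ : 0 ≤ β₀ ∧ β₀ ≤ 1) :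
      1 / 10 * min 1 (ε / max α₀ β₀ ^ 2) = 0 ∨
        e / 10 ≤ 1 / 10 * min 1 (ε / max α₀ β₀ ^ 2) ∧
          1 / 10 * min 1 (ε / max α₀ β₀ ^ 2) ≤ 1 / 10 := by
    have h0 : 0 ≤ max α₀ β₀ := le_max_of_le_left hα₀.1
    have h1 : max α₀ β₀ ≤ 1 := max_le hα₀.2 hβ₀.2
    rcases h0.eq_or_lt with h0 | h0
    · left
      simp [← h0]
    · right
      have h2 : e ≤ ε / max α₀ β₀ ^ 2 := by
        rw [le_div_iff₀ (by positivity)]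
        exact (mul_le_of_le_one_right he.le (pow_le_one₀ h0.le h1)).trans heε
      have h3 := le_min he1 h2
      have h4 := min_le_left 1 (ε / max α₀ β₀ ^ 2)
      constructor <;> linarith
  have hbad {α₀ β₀ : ℝ} (hα₀ : 0 ≤ α₀ ∧ α₀ ≤ 1) (hβ₀ : 0 ≤ β₀ ∧ β₀ ≤ 1) :
      (refinedEstimate estimatorConstants N u v t δ
        (1 / 10 * min 1 (ε / max α₀ β₀ ^ 2))).expectedSteps (walkOp G coin) ≤
          3 * 10 ^ 12 * (B / (m * e ^ 2)) := by
    refine (hfine (hμ hα₀ hβ₀)).trans ?_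
    rcases hμ hα₀ hβ₀ with h0 | ⟨h0, -⟩
    · rw [h0]
      norm_num
      positivity
    · calc _ ≤ 3 * 10 ^ 10 * (B / ((e / 10) ^ 2 * m)) := by gcongr
        _ = _ := by field_simp
  have hgood {α₀ β₀ : ℝ} (hα₀ : 0 ≤ α₀ ∧ α₀ ≤ 1) (hβ₀ : 0 ≤ β₀ ∧ β₀ ≤ 1)
      (hα : |α₀ - a| ≤ 1 / 4 / 4 * a) (hβ : |β₀ - b| ≤ 1 / 4 / 4 * b) :
      (refinedEstimate estimatorConstants N u v t δ
        (1 / 10 * min 1 (ε / max α₀ β₀ ^ 2))).expectedSteps (walkOp G coin) ≤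
          5 * 10 ^ 12 * (B * (M ^ 4 / (m * e ^ 2))) := by
    refine (hfine (hμ hα₀ hβ₀)).trans ?_
    have h1 : max α₀ β₀ ≤ 17 / 16 * M := by
      rw [hM, mul_max_of_nonneg _ _ (by norm_num)]
      exact max_le_max (by linarith [(abs_le.1 hα).2]) (by linarith [(abs_le.1 hβ).2])
    have h0 : 0 < max α₀ β₀ := lt_max_of_lt_left (by linarith [(abs_le.1 hα).1])
    -- Good coarse estimates gain the factor `M ^ (-2)` in `μ`, which becomes `M ^ 4` in the cost.
    have h2 : e / (12 * M ^ 2) ≤ 1 / 10 * min 1 (ε / max α₀ β₀ ^ 2) := by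
      rw [mul_min_of_nonneg _ _ (by norm_num)]
      refine le_min ?_ ?_
      · rw [div_le_iff₀ (by positivity)]
        nlinarith
      · have h3 : max α₀ β₀ ^ 2 ≤ (17 / 16 * M) ^ 2 := by gcongr
        rw [div_le_iff₀ (by positivity), ← mul_div_assoc, div_mul_eq_mul_div,
          le_div_iff₀ (by positivity)]
        calc e * max α₀ β₀ ^ 2 ≤ ε * (17 / 16 * M) ^ 2 := by gcongr
          _ ≤ 1 / 10 * ε * (12 * M ^ 2) := by
              have : 0 ≤ ε * M ^ 2 := by positivity
              nlinarith
    calc _ ≤ 3 * 10 ^ 10 * (B / ((e / (12 * M ^ 2)) ^ 2 * m)) := by gcongr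
      _ = 4320000000000 * (B * (M ^ 4 / (m * e ^ 2))) := by field_simp; norm_num; ring
      _ ≤ _ := by gcongr; norm_num
  have hDbad : D * (3 * 10 ^ 12 * (B / (m * e ^ 2))) ≤
      2 * 10 ^ 11 * (B * (M ^ 4 / (m * e ^ 2))) := by
    calc _ ≤ 1 / 16 * M ^ 4 * (3 * 10 ^ 12 * (B / (m * e ^ 2))) := by gcongr
      _ = 187500000000 * (B * (M ^ 4 / (m * e ^ 2))) := by ring
      _ ≤ _ := by gcongr; norm_num
  -- The coarse estimates are absorbed since `e ≤ M ^ 2`; this is why the bound uses `ε'` instead of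
  -- `ε`.
  have hm_le : B / m ≤ B * (M ^ 4 / (m * e ^ 2)) := by
    rw [div_eq_mul_one_div]
    gcongr B * ?_
    rw [div_le_div_iff₀ hm0 (by positivity)]
    have : e ^ 2 ≤ (M ^ 2) ^ 2 := by gcongr
    nlinarith
  have hY0 : 0 ≤ B * (M ^ 4 / (m * e ^ 2)) := by positivity
  rw [distanceEstimator_eq, Program.expectedSteps_bind]
  have hexp := Program.expect_le_of_prob hU hU2 (outputs_multNormEstimator u t (1 / 4) D)
    (g := fun α₀ => (do
      let β₀ ← multNormEstimator N v t (1 / 4) D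
      refinedEstimate estimatorConstants N u v t δ (1 / 10 * min 1 (ε / max α₀ β₀ ^ 2)) :
        Program N ℝ).expectedSteps (walkOp G coin))
    (a := 4 * 10 ^ 8 * (B / m) + (5 * 10 ^ 12 * (B * (M ^ 4 / (m * e ^ 2))) +
      2 * 10 ^ 11 * (B * (M ^ 4 / (m * e ^ 2)))))
    (b := 4 * 10 ^ 8 * (B / m) + 3 * 10 ^ 12 * (B / (m * e ^ 2)))
    (hprob u) (by positivity) (by positivity) (fun α₀ hα₀ hα => ?_) (fun α₀ hα₀ => ?_)
  · refine (add_le_add hcu hexp).trans ?_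
    have : D * (4 * 10 ^ 8 * (B / m)) ≤ 1 * (4 * 10 ^ 8 * (B / m)) := by gcongr
    rw [mul_add]
    linarith
  · rw [Program.expectedSteps_bind]
    refine add_le_add hcv ((Program.expect_le_of_prob hU hU2
      (outputs_multNormEstimator v t (1 / 4) D) (hprob v) (by positivity) (by positivity)
      (fun β₀ hβ₀ hβ => hgood hα₀ hβ₀ hα hβ) (fun β₀ hβ₀ => hbad hα₀ hβ₀)).trans ?_)
    linarith
  · rw [Program.expectedSteps_bind]
    exact add_le_add hcv ((Program.expect_mono (outputs_multNormEstimator v t (1 / 4) D)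
      fun β₀ hβ₀ => hbad hα₀ hβ₀).trans_eq (Program.expect_const hU hU2 _ _))

end Cost

end QuantumWalk

/-! ### Conclusion -/

theorem mainTheorem5 :
    ∃ (c : QuantumWalk.EstimatorConstants) (C : ℝ), 0 < C ∧
      ∀ (N : ℕ) (_ : 2 ≤ N) (G : SimpleGraph (Fin N)) [DecidableRel G.Adj] (d : ℕ) (_ : 1 ≤ d)
        (_ : ∀ i, G.degree i ≤ d)
        (coin : Fin N → Matrix (Option (Fin N)) (Option (Fin N)) ℂ)
        (_ : QuantumWalk.IsCoin (QuantumWalk.lazyWalk G d) coin)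
        (u v : Fin N) (t : ℕ) (ε δ : ℝ) (_ : 0 < ε) (_ : 0 < δ),
        let p := QuantumWalk.walkDist G d t u
        let q := QuantumWalk.walkDist G d t v
        let U := QuantumWalk.walkOp G coin
        let alg := QuantumWalk.distanceEstimator c N u v t ε δ
        let amax := max ‖p‖ ‖q‖
        let amin := min ‖p‖ ‖q‖
        let ε' := min ε (amax ^ 2)
        1 - δ ≤ alg.prob U (fun a => |‖p - q‖ ^ 2 - a| ≤ ε) ∧
          (δ ≤ 1 / 2 →
            alg.expectedSteps U ≤
              C * (Real.sqrt t * (amax / ε' + amax ^ 4 / (amin * ε' ^ 2)) *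
                Real.log (Real.log N / δ) * Real.log (N / ε') ^ (3 / 2 : ℝ))) := by
  refine ⟨QuantumWalk.estimatorConstants, 10 ^ 13, by norm_num, ?_⟩
  intro N hN G _ d hd hdeg coin h u v t ε δ hε hδ p q U alg amax amin ε'
  refine ⟨QuantumWalk.prob_distanceEstimator hN hd hdeg h u v t hε hδ, fun hδ2 => ?_⟩
  refine (QuantumWalk.expectedSteps_distanceEstimator_le hN hd hdeg h u v t hε hδ hδ2 rfl).trans ?_
  have hM0 : 0 < amax := by
    have := QuantumWalk.one_le_sqrt_natCast u
    exact lt_max_of_lt_left ((by positivity : 0 < 1 / √(N : ℝ)).trans_le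
      (QuantumWalk.one_div_sqrt_le_norm_walkDist t u))
  have hM1 : amax ≤ 1 := max_le (QuantumWalk.norm_walkDist_le_one hd hdeg t u)
    (QuantumWalk.norm_walkDist_le_one hd hdeg t v)
  have he : 0 < ε' := lt_min hε (by positivity)
  have he1 : ε' ≤ 1 := (min_le_right _ _).trans (pow_le_one₀ hM0.le hM1)
  obtain ⟨h1, h2, h3⟩ := QuantumWalk.log_natCast_div hN he he1
  have hB := QuantumWalk.stepScale_nonneg hN t he he1 hδ hδ2
  have hpow : Real.log (N / ε') ^ (3 / 2 : ℝ) = Real.log (N / ε') * √(Real.log (N / ε')) := by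
    rw [show (3 / 2 : ℝ) = 1 + 1 / 2 by norm_num, Real.rpow_add (by linarith), Real.rpow_one,
      ← Real.sqrt_eq_rpow]
  rw [hpow]
  refine mul_le_mul_of_nonneg_left ?_ (by norm_num)
  -- The second summand alone bounds the cost; the first is nonnegative and is only added.
  calc _ ≤ QuantumWalk.stepScale N t ε' δ * (amax / ε' + amax ^ 4 / (amin * ε' ^ 2)) := by
        refine mul_le_mul_of_nonneg_left ?_ hB
        exact le_add_of_nonneg_left (by positivity)
    _ = _ := by rw [QuantumWalk.stepScale]; ring
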